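/- Let $G$ be an unweighted tree on the node set $\{0,\dots,L-1\}$, let $f:\mathbb{R}\to\mathbb{R}$ be an arbitrary function, and let $\mathbf{M}=[f(\mathrm{dist}_G(i,j))]_{i,j}$ be the corresponding mask matrix, where $\mathrm{dist}_G(i,j)$ is the number of edges of the path from $i$ to $j$ in $G$. Then $\mathbf{M}$ supports matrix-vector multiplication in time $O(L\log^2 L)$; hence such pairs $(G,f)$ are tractable. Precisely, the machine model is a real random access machine: a program is a finite structured program (assignments, conditionals, while-loops) over natural-number cells (with addition, truncated subtraction and comparison) and real cells (with exact addition, subtraction, multiplication, square root, and rational constants), both with indirect addressing by natural numbers; every operation, memory access, test and assignment costs one unit of time. The claim is that there is one program and one function $T:\mathbb{N}\to\mathbb{N}$ with $T(L)=O(L\log^2 L)$ as $L\to\infty$ such that for every $L$, every tree $G$ on $L$ nodes, every $f:\mathbb{R}\to\mathbb{R}$ and every $\mathbf{x}\in\mathbb{R}^L$, given $L$, any list of the edges of $G$ (and its length), the values $f(0),f(1),\dots,f(L-1)$ and $\mathbf{x}$, the program halts within $T(L)$ units of time and outputs $\mathbf{M}\mathbf{x}$ exactly. In particular the class of all pairs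 $(G,f)$ with $G$ an unweighted tree is tractable, i.e. there is a program that multiplies the masks of all these pairs with vectors in time $o(L^2)$ in the same sense. -/

import Mathlib

open Filter Asymptotics

/-! A real random access machine, presented as a structured language. Its memory consists of banks
of natural-number cells and banks of real cells, each bank being addressed by arbitrary natural
numbers. A program names finitely many banks. Every arithmetic operation, memory access, test and
assignment takes one unit of time. Reals cannot influence natural numbers or the flow of control,
and there is no conversion from reals to integers. -/

namespace RealRAM

/-- The contents of the memory: `nat a i` is cell `i` of the natural-number bank `a`, and
`real a i` is cell `i` of the real bank `a`. -/
structure Memory where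
  nat : ℕ → ℕ → ℕ
  real : ℕ → ℕ → ℝ

/-- Expressions of natural-number type. -/
inductive NExp where
  | lit (c : ℕ)
  | get (a : ℕ) (i : NExp)
  | add (e₁ e₂ : NExp)
  | sub (e₁ e₂ : NExp)

/-- The value of a natural-number expression; subtraction is truncated at `0`. -/
def NExp.eval (s : Memory) : NExp → ℕ
  | .lit c => c
  | .get a i => s.nat a (i.eval s)
  | .add e₁ e₂ => e₁.eval s + e₂.eval s
  | .sub e₁ e₂ => e₁.eval s - e₂.eval s

/-- The time to evaluate a natural-number expression: one unit for each of its nodes. -/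
def NExp.cost : NExp → ℕ
  | .lit _ => 1
  | .get _ i => 1 + i.cost
  | .add e₁ e₂ => 1 + e₁.cost + e₂.cost
  | .sub e₁ e₂ => 1 + e₁.cost + e₂.cost

/-- Expressions of real type. The only constants are rational. -/
inductive RExp where
  | lit (q : ℚ)
  | get (a : ℕ) (i : NExp)
  | add (e₁ e₂ : RExp)
  | sub (e₁ e₂ : RExp)
  | mul (e₁ e₂ : RExp)
  | sqrt (e : RExp)

/-- The value of a real expression, in exact arithmetic. -/
noncomputable def RExp.eval (s : Memory) : RExp → ℝ
  | .lit q => (q : ℝ)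
  | .get a i => s.real a (i.eval s)
  | .add e₁ e₂ => e₁.eval s + e₂.eval s
  | .sub e₁ e₂ => e₁.eval s - e₂.eval s
  | .mul e₁ e₂ => e₁.eval s * e₂.eval s
  | .sqrt e => Real.sqrt (e.eval s)

/-- The time to evaluate a real expression: one unit for each of its nodes. -/
def RExp.cost : RExp → ℕ
  | .lit _ => 1
  | .get _ i => 1 + i.cost
  | .add e₁ e₂ => 1 + e₁.cost + e₂.cost
  | .sub e₁ e₂ => 1 + e₁.cost + e₂.cost
  | .mul e₁ e₂ => 1 + e₁.cost + e₂.cost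
  | .sqrt e => 1 + e.cost

/-- Programs. A test has the form `e₁ < e₂` for two natural-number expressions. -/
inductive Program where
  | skip
  | setNat (a : ℕ) (i e : NExp)
  | setReal (a : ℕ) (i : NExp) (e : RExp)
  | seq (p q : Program)
  | ifLt (e₁ e₂ : NExp) (p q : Program)
  | whileLt (e₁ e₂ : NExp) (p : Program)

/-- Write `v` to cell `i` of the natural-number bank `a`. -/
def Memory.writeNat (s : Memory) (a i v : ℕ) : Memory where
  nat := fun b j => if b = a ∧ j = i then v else s.nat b j
  real := s.real

/-- Write `v` to cell `i` of the real bank `a`. -/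
noncomputable def Memory.writeReal (s : Memory) (a i : ℕ) (v : ℝ) : Memory where
  nat := s.nat
  real := fun b j => if b = a ∧ j = i then v else s.real b j

/-- `Exec p s t s₁`: started in memory `s`, the program `p` halts after exactly `t` units of time
with memory `s₁`. -/
inductive Exec : Program → Memory → ℕ → Memory → Prop where
  | skip (s : Memory) : Exec .skip s 1 s
  | setNat (s : Memory) (a : ℕ) (i e : NExp) :
      Exec (.setNat a i e) s (1 + i.cost + e.cost) (s.writeNat a (i.eval s) (e.eval s))
  | setReal (s : Memory) (a : ℕ) (i : NExp) (e : RExp) :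
      Exec (.setReal a i e) s (1 + i.cost + e.cost) (s.writeReal a (i.eval s) (e.eval s))
  | seq {p q : Program} {s s₁ s₂ : Memory} {t₁ t₂ : ℕ} :
      Exec p s t₁ s₁ → Exec q s₁ t₂ s₂ → Exec (.seq p q) s (t₁ + t₂) s₂
  | ifTrue {e₁ e₂ : NExp} {p q : Program} {s s₁ : Memory} {t : ℕ} :
      e₁.eval s < e₂.eval s → Exec p s t s₁ →
        Exec (.ifLt e₁ e₂ p q) s (1 + e₁.cost + e₂.cost + t) s₁
  | ifFalse {e₁ e₂ : NExp} {p q : Program} {s s₁ : Memory} {t : ℕ} :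
      ¬ e₁.eval s < e₂.eval s → Exec q s t s₁ →
        Exec (.ifLt e₁ e₂ p q) s (1 + e₁.cost + e₂.cost + t) s₁
  | whileTrue {e₁ e₂ : NExp} {p : Program} {s s₁ s₂ : Memory} {t₁ t₂ : ℕ} :
      e₁.eval s < e₂.eval s → Exec p s t₁ s₁ → Exec (.whileLt e₁ e₂ p) s₁ t₂ s₂ →
        Exec (.whileLt e₁ e₂ p) s (1 + e₁.cost + e₂.cost + t₁ + t₂) s₂
  | whileFalse {e₁ e₂ : NExp} {p : Program} {s : Memory} :
      ¬ e₁.eval s < e₂.eval s →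
        Exec (.whileLt e₁ e₂ p) s (1 + e₁.cost + e₂.cost) s

end RealRAM

namespace GraphMask

/-- The mask matrix `[f(dist_G(i, j))]` of an unweighted connected graph `G` on `L` nodes, where
`dist_G` is the number of edges of a shortest path. -/
noncomputable def mask {L : ℕ} (G : SimpleGraph (Fin L)) (f : ℝ → ℝ) :
    Matrix (Fin L) (Fin L) ℝ :=
  Matrix.of fun i j => f (G.dist i j : ℝ)

/-- `E` lists every edge of `G` exactly once, in any order and with any orientation. -/
def IsEdgeList {L : ℕ} (G : SimpleGraph (Fin L)) (E : List (Fin L × Fin L)) : Prop :=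
  (E.map fun e => s(e.1, e.2)).Nodup ∧ ∀ a b, G.Adj a b ↔ s(a, b) ∈ E.map fun e => s(e.1, e.2)

/-- The initial memory. Natural bank `0` holds the number of nodes and the number of edges, natural
banks `1` and `2` hold the two endpoints of each listed edge, real bank `0` holds the values
`f 0, …, f (L - 1)`, real bank `1` holds the vector `x`, and every other cell is `0`. -/
noncomputable def input {L : ℕ} (E : List (Fin L × Fin L)) (f : ℝ → ℝ) (x : Fin L → ℝ) :
    RealRAM.Memory where
  nat := fun a i =>
    match a with
    | 0 => if i = 0 then L else if i = 1 then E.length else 0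
    | 1 => if h : i < E.length then (E[i].1 : ℕ) else 0
    | 2 => if h : i < E.length then (E[i].2 : ℕ) else 0
    | _ => 0
  real := fun a i =>
    match a with
    | 0 => if i < L then f (i : ℝ) else 0
    | 1 => if h : i < L then x ⟨i, h⟩ else 0
    | _ => 0

/-- Given `G` by any list of its edges, the values of `f` and any vector `x`, the program `p` halts
within time `t` and leaves the product of the mask and `x` in real bank `2`. -/
def MultipliesMaskIn (p : RealRAM.Program) {L : ℕ} (G : SimpleGraph (Fin L)) (f : ℝ → ℝ)
    (t : ℕ) : Prop :=
  ∀ E : List (Fin L × Fin L), IsEdgeList G E → ∀ x : Fin L → ℝ,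
    ∃ (t₁ : ℕ) (s : RealRAM.Memory), t₁ ≤ t ∧ RealRAM.Exec p (input E f x) t₁ s ∧
      ∀ i : Fin L, s.real 2 i = ((mask G f).mulVec x) i

/-- A class `C` of pairs `(G, f)`, of all sizes `L`. -/
abbrev PairClass := ∀ L : ℕ, SimpleGraph (Fin L) → (ℝ → ℝ) → Prop

/-- The masks of the pairs in `C` support matrix-vector multiplication in time `T L`, by a single
program for the whole class. -/
def SupportsMulIn (C : PairClass) (T : ℕ → ℕ) : Prop :=
  ∃ p : RealRAM.Program, ∀ (L : ℕ) (G : SimpleGraph (Fin L)) (f : ℝ → ℝ),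
    C L G f → MultipliesMaskIn p G f (T L)

/-- The pairs in `C` are tractable: their masks support sub-quadratic matrix-vector
multiplication. -/
def Tractable (C : PairClass) : Prop :=
  ∃ T : ℕ → ℕ, SupportsMulIn C T ∧ (fun L => (T L : ℝ)) =o[atTop] fun L : ℕ => (L : ℝ) ^ 2

/-- All pairs of an unweighted tree and an arbitrary function. -/
def treePairs : PairClass := fun _ G _ => G.IsTree

end GraphMask

/-! The algorithm is a centroid decomposition combined with fast Hankel products. Let `A` be the set
of active nodes, initially all nodes. Every component of `A` has a centroid, whose removal leaves
components of at most half the size (`two_mul_card_comp_next_le`), so after about `log L` rounds no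
node is left. Let `d i` be the distance from `i` to the centroid of its component. If the removal of
the centroids separates `i` and `j`, then the path between them passes through the centroid and
`dist i j = d i + d j` (`dist_eq_add_of_separated`).

One round therefore adds `g (d i + d j) * x j` over all pairs in a common component of `A`, and
subtracts the same expression, with the same `d`, over all pairs in a common component of the
remaining set. Exactly the separated pairs survive, with their correct distances
(`interaction_sub_interaction`). Over the rounds these contributions telescope to the full product
(`allRounds_runs`).

Within a component of size `m`, the entries of the vector are first added up by their value of `d`.
What remains is the product of a vector with the Hankel matrix `g (a + b)`, where `a` and `b` run
through `0, …, m`. After reversal of the vector this is part of a convolution, which the fast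
Fourier transform computes in time `O(m log m)` (`hankelBlock_runs`). The sizes of the components
add up to at most `L`, so a round takes time `O(L log L)` and all rounds take `O(L log² L)`. The
roots of unity come from half-angle formulas, which need only real square roots.

To find components, sizes, centroids and distances by plain scans, the tree is rooted so that every
node precedes its parent. Leaf stripping produces such an order. It works with the degree and the
sum of the neighbours of each node, since for a leaf that sum is its only neighbour
(`Stripped.nbrs_eq`).

Time is measured by `RunsIn W p`: at most `W` times the size of the text of `p`. Sequential
composition leaves `W` unchanged, so constants never have to be tracked. Memory is controlled by
`Frame`: banks that a program does not mention as targets keep their contents, and for concrete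
programs this is decidable. -/

namespace RealRAM

/-! ### Reasoning about memory and running time of programs -/

instance (n : ℕ) : OfNat NExp n := ⟨.lit n⟩
instance : Add NExp := ⟨.add⟩
instance : Sub NExp := ⟨.sub⟩
instance : Add RExp := ⟨.add⟩
instance : Sub RExp := ⟨.sub⟩
instance : Mul RExp := ⟨.mul⟩

@[simp] theorem NExp.eval_ofNat (s : Memory) (n : ℕ) :
    NExp.eval s ofNat(n) = OfNat.ofNat n := rfl
@[simp] theorem NExp.eval_get (s : Memory) (a : ℕ) (i : NExp) :
    NExp.eval s (.get a i) = s.nat a (i.eval s) := rfl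
@[simp] theorem NExp.eval_add (s : Memory) (e₁ e₂ : NExp) :
    NExp.eval s (e₁ + e₂) = e₁.eval s + e₂.eval s := rfl
@[simp] theorem NExp.eval_sub (s : Memory) (e₁ e₂ : NExp) :
    NExp.eval s (e₁ - e₂) = e₁.eval s - e₂.eval s := rfl
@[simp] theorem RExp.eval_lit (s : Memory) (q : ℚ) : RExp.eval s (.lit q) = q := rfl
@[simp] theorem RExp.eval_get (s : Memory) (a : ℕ) (i : NExp) :
    RExp.eval s (.get a i) = s.real a (i.eval s) := rfl
@[simp] theorem RExp.eval_add (s : Memory) (e₁ e₂ : RExp) :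
    RExp.eval s (e₁ + e₂) = e₁.eval s + e₂.eval s := rfl
@[simp] theorem RExp.eval_sub (s : Memory) (e₁ e₂ : RExp) :
    RExp.eval s (e₁ - e₂) = e₁.eval s - e₂.eval s := rfl
@[simp] theorem RExp.eval_mul (s : Memory) (e₁ e₂ : RExp) :
    RExp.eval s (e₁ * e₂) = e₁.eval s * e₂.eval s := rfl
@[simp] theorem RExp.eval_sqrt (s : Memory) (e : RExp) :
    RExp.eval s (.sqrt e) = Real.sqrt (e.eval s) := rfl

@[simp] theorem Memory.writeNat_nat (s : Memory) (a i v b j : ℕ) :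
    (s.writeNat a i v).nat b j = if b = a ∧ j = i then v else s.nat b j := rfl
@[simp] theorem Memory.writeNat_real (s : Memory) (a i v : ℕ) :
    (s.writeNat a i v).real = s.real := rfl
@[simp] theorem Memory.writeReal_nat (s : Memory) (a i : ℕ) (v : ℝ) :
    (s.writeReal a i v).nat = s.nat := rfl
@[simp] theorem Memory.writeReal_real (s : Memory) (a i : ℕ) (v : ℝ) (b j : ℕ) :
    (s.writeReal a i v).real b j = if b = a ∧ j = i then v else s.real b j := rfl

infixr:30 " ;; " => Program.seq

/-- An upper bound for the time of one pass through the text of a program. -/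
def Program.size : Program → ℕ
  | .skip => 1
  | .setNat _ i e => 1 + i.cost + e.cost
  | .setReal _ i e => 1 + i.cost + e.cost
  | .seq p q => p.size + q.size
  | .ifLt e₁ e₂ p q => 1 + e₁.cost + e₂.cost + p.size + q.size
  | .whileLt e₁ e₂ p => 1 + e₁.cost + e₂.cost + p.size

/-- The natural-number banks that a program may write to. -/
def Program.natBanks : Program → List ℕ
  | .skip => []
  | .setNat a _ _ => [a]
  | .setReal _ _ _ => []
  | .seq p q => p.natBanks ++ q.natBanks
  | .ifLt _ _ p q => p.natBanks ++ q.natBanks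
  | .whileLt _ _ p => p.natBanks

/-- The real banks that a program may write to. -/
def Program.realBanks : Program → List ℕ
  | .skip => []
  | .setNat _ _ _ => []
  | .setReal a _ _ => [a]
  | .seq p q => p.realBanks ++ q.realBanks
  | .ifLt _ _ p q => p.realBanks ++ q.realBanks
  | .whileLt _ _ p => p.realBanks

/-- A program without loops. -/
def Program.loopFree : Program → Bool
  | .skip => true
  | .setNat _ _ _ => true
  | .setReal _ _ _ => true
  | .seq p q => p.loopFree && q.loopFree
  | .ifLt _ _ p q => p.loopFree && q.loopFree
  | .whileLt _ _ _ => false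

/-- The final memory of a loop-free program. -/
noncomputable def Program.run : Program → Memory → Memory
  | .skip, s => s
  | .setNat a i e, s => s.writeNat a (i.eval s) (e.eval s)
  | .setReal a i e, s => s.writeReal a (i.eval s) (e.eval s)
  | .seq p q, s => q.run (p.run s)
  | .ifLt e₁ e₂ p q, s => if e₁.eval s < e₂.eval s then p.run s else q.run s
  | .whileLt _ _ _, s => s

theorem Program.exists_exec_run (p : Program) (hp : p.loopFree = true) (s : Memory) :
    ∃ t ≤ p.size, Exec p s t (p.run s) := by
  induction p generalizing s with
  | skip => exact ⟨1, le_rfl, .skip s⟩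
  | setNat a i e => exact ⟨_, le_rfl, .setNat s a i e⟩
  | setReal a i e => exact ⟨_, le_rfl, .setReal s a i e⟩
  | seq p q ihp ihq =>
    simp only [loopFree, Bool.and_eq_true] at hp
    obtain ⟨t₁, h₁, e₁⟩ := ihp hp.1 s
    obtain ⟨t₂, h₂, e₂⟩ := ihq hp.2 (p.run s)
    exact ⟨_, Nat.add_le_add h₁ h₂, .seq e₁ e₂⟩
  | ifLt e₁ e₂ p q ihp ihq =>
    simp only [loopFree, Bool.and_eq_true] at hp
    by_cases h : e₁.eval s < e₂.eval s
    · obtain ⟨t, ht, e⟩ := ihp hp.1 s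
      refine ⟨_, ?_, by simpa only [run, if_pos h] using Exec.ifTrue (q := q) h e⟩
      simp only [size]; omega
    · obtain ⟨t, ht, e⟩ := ihq hp.2 s
      refine ⟨_, ?_, by simpa only [run, if_neg h] using Exec.ifFalse (p := p) h e⟩
      simp only [size]; omega
  | whileLt e₁ e₂ p => simp [loopFree] at hp

/-- The memories `s` and `s'` agree on all banks that `p` does not write to. -/
structure Frame (p : Program) (s s' : Memory) : Prop where
  nat : ∀ b, b ∉ p.natBanks → s'.nat b = s.nat b
  real : ∀ b, b ∉ p.realBanks → s'.real b = s.real b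

theorem Frame.refl (p : Program) (s : Memory) : Frame p s s := ⟨fun _ _ => rfl, fun _ _ => rfl⟩

theorem Frame.trans {p : Program} {s₁ s₂ s₃ : Memory} (h : Frame p s₁ s₂) (h' : Frame p s₂ s₃) :
    Frame p s₁ s₃ :=
  ⟨fun b hb => (h'.nat b hb).trans (h.nat b hb), fun b hb => (h'.real b hb).trans (h.real b hb)⟩

theorem Frame.mono {p q : Program} {s s' : Memory} (h : Frame p s s')
    (hn : p.natBanks ⊆ q.natBanks) (hr : p.realBanks ⊆ q.realBanks) : Frame q s s' :=
  ⟨fun b hb => h.nat b fun h => hb (hn h), fun b hb => h.real b fun h => hb (hr h)⟩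

theorem Exec.frame {p : Program} {s s' : Memory} {t : ℕ} (h : Exec p s t s') : Frame p s s' := by
  induction h with
  | skip s => exact .refl _ _
  | setNat s a i e =>
    refine ⟨fun b hb => ?_, fun b _ => rfl⟩
    funext j
    have : b ≠ a := by simpa [Program.natBanks] using hb
    simp [this]
  | setReal s a i e =>
    refine ⟨fun b _ => rfl, fun b hb => ?_⟩
    funext j
    have : b ≠ a := by simpa [Program.realBanks] using hb
    simp [this]
  | seq _ _ h₁ h₂ =>
    exact (h₁.mono (by simp [Program.natBanks]) (by simp [Program.realBanks])).trans
      (h₂.mono (by simp [Program.natBanks]) (by simp [Program.realBanks]))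
  | ifTrue _ _ h => exact h.mono (by simp [Program.natBanks]) (by simp [Program.realBanks])
  | ifFalse _ _ h => exact h.mono (by simp [Program.natBanks]) (by simp [Program.realBanks])
  | whileTrue _ _ _ h₁ h₂ =>
    exact (h₁.mono (by simp [Program.natBanks]) (by simp [Program.realBanks])).trans h₂
  | whileFalse _ => exact .refl _ _

theorem Program.frame_run {p : Program} (hp : p.loopFree = true) (s : Memory) :
    Frame p s (p.run s) :=
  let ⟨_, _, h⟩ := p.exists_exec_run hp s
  h.frame

/-- Started in `s`, the program `p` halts within time `T` in a memory that satisfies `Q`. -/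
def Runs (p : Program) (s : Memory) (T : ℕ) (Q : Memory → Prop) : Prop :=
  ∃ t s', t ≤ T ∧ Exec p s t s' ∧ Q s'

theorem Runs.mono {p : Program} {s : Memory} {T T' : ℕ} {Q Q' : Memory → Prop}
    (h : Runs p s T Q) (hT : T ≤ T') (hQ : ∀ s', Frame p s s' → Q s' → Q' s') :
    Runs p s T' Q' := by
  obtain ⟨t, s', ht, he, hq⟩ := h
  exact ⟨t, s', ht.trans hT, he, hQ s' he.frame hq⟩

theorem Runs.seq {p q : Program} {s : Memory} {T₁ T₂ T : ℕ} {Q₁ Q : Memory → Prop}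
    (h₁ : Runs p s T₁ Q₁) (h₂ : ∀ s₁, Frame p s s₁ → Q₁ s₁ → Runs q s₁ T₂ Q)
    (hT : T₁ + T₂ ≤ T) : Runs (p ;; q) s T Q := by
  obtain ⟨t₁, s₁, ht₁, he₁, hq₁⟩ := h₁
  obtain ⟨t₂, s₂, ht₂, he₂, hq₂⟩ := h₂ s₁ he₁.frame hq₁
  exact ⟨_, s₂, by omega, .seq he₁ he₂, hq₂⟩

theorem Runs.loopFree {p : Program} (hp : p.loopFree = true) {s : Memory} {T : ℕ}
    {Q : Memory → Prop} (h : Q (p.run s)) (hT : p.size ≤ T) : Runs p s T Q := by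
  obtain ⟨t, ht, he⟩ := p.exists_exec_run hp s
  exact ⟨t, _, ht.trans hT, he, h⟩

theorem Runs.ifLt {e₁ e₂ : NExp} {p q : Program} {s : Memory} {T T' : ℕ} {Q : Memory → Prop}
    (h₁ : e₁.eval s < e₂.eval s → Runs p s T Q) (h₂ : ¬ e₁.eval s < e₂.eval s → Runs q s T Q)
    (hT : 1 + e₁.cost + e₂.cost + T ≤ T') : Runs (.ifLt e₁ e₂ p q) s T' Q := by
  by_cases h : e₁.eval s < e₂.eval s
  · obtain ⟨t, s', ht, he, hq⟩ := h₁ h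
    exact ⟨_, s', by omega, .ifTrue h he, hq⟩
  · obtain ⟨t, s', ht, he, hq⟩ := h₂ h
    exact ⟨_, s', by omega, .ifFalse h he, hq⟩

/-- A loop that is known to be executed `n` times. -/
theorem Runs.whileLt {e₁ e₂ : NExp} {p : Program} {s : Memory} {n T : ℕ} {c : ℕ → ℕ}
    {I : ℕ → Memory → Prop} (h0 : I 0 s)
    (hstep : ∀ j < n, ∀ s', Frame p s s' → I j s' →
      e₁.eval s' < e₂.eval s' ∧ Runs p s' (c j) (I (j + 1)))
    (hend : ∀ s', Frame p s s' → I n s' → ¬ e₁.eval s' < e₂.eval s')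
    (hT : ∑ j ∈ Finset.range n, c j + (n + 1) * (1 + e₁.cost + e₂.cost) ≤ T) :
    Runs (.whileLt e₁ e₂ p) s T (I n) := by
  -- The induction is on the number `m` of iterations still to come, because `Exec.whileTrue` splits
  -- off the first iteration.
  suffices H : ∀ m ≤ n, ∀ s', Frame p s s' → I (n - m) s' → ∃ t s'',
      t ≤ ∑ j ∈ Finset.Ico (n - m) n, c j + (m + 1) * (1 + e₁.cost + e₂.cost) ∧
      Exec (.whileLt e₁ e₂ p) s' t s'' ∧ I n s'' by
    obtain ⟨t, s'', ht, he, hq⟩ := H n le_rfl s (.refl _ _) (by simpa using h0)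
    refine ⟨t, s'', ?_, he, hq⟩
    rw [Nat.sub_self, ← Finset.range_eq_Ico] at ht
    exact ht.trans hT
  intro m
  induction m with
  | zero =>
    intro _ s' hf hI
    rw [Nat.sub_zero] at hI
    exact ⟨_, s', by simp, .whileFalse (hend s' hf hI), hI⟩
  | succ m ih =>
    intro hm s' hf hI
    obtain ⟨hlt, t, s₁, ht, he, hI₁⟩ := hstep (n - (m + 1)) (by omega) s' hf hI
    have e : n - (m + 1) + 1 = n - m := by omega
    rw [e] at hI₁
    obtain ⟨t₂, s₂, ht₂, he₂, hI₂⟩ := ih (by omega) s₁ (hf.trans he.frame) hI₁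
    refine ⟨_, s₂, ?_, .whileTrue hlt he he₂, hI₂⟩
    rw [Finset.sum_eq_sum_Ico_succ_bot (by omega), e, add_mul (m + 1) 1]
    omega

/-- `for v < hi do body`, the counter being cell `0` of the natural-number bank `v`. -/
def forTo (v : ℕ) (hi : NExp) (body : Program) : Program :=
  .setNat v 0 0 ;; .whileLt (.get v 0) hi (body ;; .setNat v 0 (.get v 0 + 1))

/-- The time per iteration that a loop takes in addition to that of its body. -/
def forOverhead (v : ℕ) (hi : NExp) : ℕ := (forTo v hi .skip).size - 1

theorem size_forTo (v : ℕ) (hi : NExp) (body : Program) :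
    (forTo v hi body).size = forOverhead v hi + body.size := by
  simp only [forOverhead, forTo, Program.size]; omega

/-- The body must not write to the bank of the counter, so the counter still equals `j` when it is
incremented. The invariant is required after this increment, which is why `writeNat` appears in `h0`
and `hstep`. -/
theorem Runs.forTo {v : ℕ} {hi : NExp} {body : Program} {s : Memory} (n : ℕ) {T : ℕ} {c : ℕ → ℕ}
    (I : ℕ → Memory → Prop) (hv : v ∉ body.natBanks)
    (hhi : ∀ s', Frame (forTo v hi body) s s' → hi.eval s' = n)
    (h0 : I 0 (s.writeNat v 0 0))
    (hstep : ∀ j < n, ∀ s', Frame (RealRAM.forTo v hi body) s s' → s'.nat v 0 = j → I j s' →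
      Runs body s' (c j) fun s'' => I (j + 1) (s''.writeNat v 0 (j + 1)))
    (hT : ∑ j ∈ Finset.range n, c j + (n + 1) * forOverhead v hi ≤ T) :
    Runs (RealRAM.forTo v hi body) s T (I n) := by
  refine Runs.seq (T₁ := (Program.setNat v 0 0).size)
    (Q₁ := fun s' => s' = s.writeNat v 0 0) (.loopFree rfl rfl le_rfl) ?_
    (T₂ := ∑ j ∈ Finset.range n, (c j + (Program.setNat v 0 (.get v 0 + 1)).size) +
      (n + 1) * (1 + (NExp.get v 0).cost + hi.cost)) ?_
  · rintro _ hf rfl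
    have key : ∀ s', Frame (body ;; .setNat v 0 (.get v 0 + 1)) (s.writeNat v 0 0) s' →
        Frame (RealRAM.forTo v hi body) s s' := fun s' h =>
      (hf.mono (by simp [RealRAM.forTo, Program.natBanks]) (by simp [Program.realBanks])).trans
        (h.mono (by simp [RealRAM.forTo, Program.natBanks])
          (by simp [RealRAM.forTo, Program.realBanks]))
    refine (Runs.whileLt (I := fun j s' => s'.nat v 0 = j ∧ I j s') (n := n) ⟨by simp, h0⟩
      ?_ ?_ le_rfl).mono le_rfl fun s' _ h => h.2
    · rintro j hj s' hf' ⟨hv', hI⟩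
      refine ⟨by simpa [hhi s' (key s' hf'), hv'] using hj, ?_⟩
      refine Runs.seq (hstep j hj s' (key s' hf') hv' hI)
        (fun s₁ hf₁ h₁ => .loopFree rfl ?_ le_rfl) le_rfl
      have e : s₁.nat v 0 = j := by rw [hf₁.nat v hv, hv']
      simpa [Program.run, e] using h₁
    · rintro s' hf' ⟨hv', -⟩
      simp [hhi s' (key s' hf'), hv']
  · refine le_trans ?_ hT
    simp only [Finset.sum_add_distrib, Finset.sum_const, Finset.card_range, smul_eq_mul]
    have : (forOverhead v hi) = (Program.setNat v 0 0).size + (1 + (NExp.get v 0).cost + hi.cost)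
      + (Program.setNat v 0 (.get v 0 + 1)).size := by
      simp only [forOverhead, RealRAM.forTo, Program.size]; omega
    rw [this]
    nlinarith

/-- Started in `s`, the program `p` halts within `W` times its size in a memory that satisfies
`Q`. -/
def RunsIn (W : ℕ) (p : Program) (s : Memory) (Q : Memory → Prop) : Prop := Runs p s (W * p.size) Q

section RunsIn

variable {W W' : ℕ} {p q : Program} {s : Memory} {Q Q' Q₁ : Memory → Prop}

theorem RunsIn.mono (h : RunsIn W p s Q) (hW : W ≤ W') (hQ : ∀ s', Frame p s s' → Q s' → Q' s') :
    RunsIn W' p s Q' :=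
  Runs.mono h (Nat.mul_le_mul_right _ hW) hQ

/-- Sizes of programs add up, so both parts may use the same factor `W` and the composition needs no
larger one. -/
theorem RunsIn.seq (h₁ : RunsIn W p s Q₁)
    (h₂ : ∀ s₁, Frame p s s₁ → Q₁ s₁ → RunsIn W q s₁ Q) : RunsIn W (p ;; q) s Q :=
  Runs.seq h₁ h₂ (le_of_eq (by simp only [Program.size]; ring))

theorem RunsIn.loopFree (hp : p.loopFree = true) (h : Q (p.run s)) (hW : 1 ≤ W) :
    RunsIn W p s Q :=
  Runs.loopFree hp h (Nat.le_mul_of_pos_left _ hW)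

theorem RunsIn.ifLt {e₁ e₂ : NExp} (hW : 1 ≤ W) (h₁ : e₁.eval s < e₂.eval s → RunsIn W p s Q)
    (h₂ : ¬ e₁.eval s < e₂.eval s → RunsIn W q s Q) : RunsIn W (.ifLt e₁ e₂ p q) s Q := by
  refine Runs.ifLt (T := W * p.size + W * q.size)
    (fun h => Runs.mono (h₁ h) (Nat.le_add_right _ _) fun _ _ h => h)
    (fun h => Runs.mono (h₂ h) (Nat.le_add_left _ _) fun _ _ h => h) ?_
  have := Nat.le_mul_of_pos_left (1 + e₁.cost + e₂.cost) hW
  simp only [Program.size]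
  linarith

theorem RunsIn.forTo {v : ℕ} {hi : NExp} (n : ℕ) (I : ℕ → Memory → Prop) (hv : v ∉ p.natBanks)
    (hhi : ∀ s', Frame (RealRAM.forTo v hi p) s s' → hi.eval s' = n)
    (h0 : I 0 (s.writeNat v 0 0))
    (hstep : ∀ j < n, ∀ s', Frame (RealRAM.forTo v hi p) s s' → s'.nat v 0 = j → I j s' →
      RunsIn W' p s' fun s'' => I (j + 1) (s''.writeNat v 0 (j + 1)))
    (hW : (n + 1) * W' ≤ W) (hW' : 1 ≤ W') : RunsIn W (RealRAM.forTo v hi p) s (I n) := by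
  refine Runs.forTo n (c := fun _ => W' * p.size) I hv hhi h0 hstep
    (le_trans ?_ (Nat.mul_le_mul_right _ hW))
  rw [size_forTo, Finset.sum_const, Finset.card_range, smul_eq_mul]
  have := Nat.le_mul_of_pos_left ((n + 1) * forOverhead v hi) hW'
  nlinarith

/-- For loops whose iterations have very different costs, such as one block per component: the costs
are added instead of being bounded by the number of iterations times the largest one. -/
theorem RunsIn.forTo_sum {v : ℕ} {hi : NExp} (n : ℕ) (w : ℕ → ℕ) (I : ℕ → Memory → Prop)
    (hv : v ∉ p.natBanks) (hhi : ∀ s', Frame (RealRAM.forTo v hi p) s s' → hi.eval s' = n)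
    (h0 : I 0 (s.writeNat v 0 0))
    (hstep : ∀ j < n, ∀ s', Frame (RealRAM.forTo v hi p) s s' → s'.nat v 0 = j → I j s' →
      RunsIn (w j) p s' fun s'' => I (j + 1) (s''.writeNat v 0 (j + 1)))
    (hW : ∑ j ∈ Finset.range n, w j ≤ W) (hW' : n + 1 ≤ W) :
    RunsIn W (RealRAM.forTo v hi p) s (I n) := by
  refine Runs.forTo n (c := fun j => w j * p.size) I hv hhi h0 hstep ?_
  rw [size_forTo, ← Finset.sum_mul, mul_add, add_comm]
  exact Nat.add_le_add (Nat.mul_le_mul_right _ hW') (Nat.mul_le_mul_right _ hW)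

theorem RunsIn.forTo_loopFree {v : ℕ} {hi : NExp} (n : ℕ) (I : ℕ → Memory → Prop)
    (hb : p.loopFree = true) (hv : v ∉ p.natBanks)
    (hhi : ∀ s', Frame (RealRAM.forTo v hi p) s s' → hi.eval s' = n)
    (h0 : I 0 (s.writeNat v 0 0))
    (hstep : ∀ j < n, ∀ s', Frame (RealRAM.forTo v hi p) s s' → s'.nat v 0 = j → I j s' →
      I (j + 1) ((p.run s').writeNat v 0 (j + 1)))
    (hW : n + 1 ≤ W) : RunsIn W (RealRAM.forTo v hi p) s (I n) :=
  .forTo n (W' := 1) I hv hhi h0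
    (fun j hj s' hf hv' hI => .loopFree hb (hstep j hj s' hf hv' hI) le_rfl) (by omega) le_rfl

theorem RunsIn.whileLt {e₁ e₂ : NExp} (n : ℕ) (I : ℕ → Memory → Prop) (h0 : I 0 s)
    (hstep : ∀ j < n, ∀ s', Frame p s s' → I j s' →
      e₁.eval s' < e₂.eval s' ∧ RunsIn W' p s' (I (j + 1)))
    (hend : ∀ s', Frame p s s' → I n s' → ¬ e₁.eval s' < e₂.eval s')
    (hW : (n + 1) * W' ≤ W) (hW' : 1 ≤ W') : RunsIn W (.whileLt e₁ e₂ p) s (I n) := by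
  refine Runs.whileLt (c := fun _ => W' * p.size) h0 hstep hend
    (le_trans ?_ (Nat.mul_le_mul_right _ hW))
  rw [Finset.sum_const, Finset.card_range, smul_eq_mul, Program.size]
  have := Nat.le_mul_of_pos_left ((n + 1) * (1 + e₁.cost + e₂.cost)) hW'
  nlinarith

end RunsIn

end RealRAM

/-! ### Trees given by a parent function -/

namespace ParentTree

/-- `P` is the parent function of a tree on `0, …, L - 1` in which every node precedes its parent;
`L - 1` is the root. -/
structure IsParent (P : ℕ → ℕ) (L : ℕ) : Prop where
  lt : ∀ i, i < P i
  le : ∀ i, i + 1 < L → P i < L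

/-- The distance in the tree with parent function `P`. -/
def dist (P : ℕ → ℕ) (L i j : ℕ) : ℕ :=
  if i = j then 0
  else if _h : i < j then if _h' : j < L ∧ i < P i then 1 + dist P L (P i) j else 0
  else if _h' : i < L ∧ j < P j then 1 + dist P L i (P j) else 0
termination_by (L - i) + (L - j)

/-- The first node that is at least `m` or has no active parent, on the way from `j` to the root. -/
def rep (P : ℕ → ℕ) (A : Finset ℕ) (m j : ℕ) : ℕ :=
  if _h : j < m ∧ P j ∈ A ∧ j < P j then rep P A m (P j) else j
termination_by m - j

variable {P : ℕ → ℕ} {L : ℕ}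

theorem dist_self (i : ℕ) : dist P L i i = 0 := by rw [dist]; simp

/-- The guards in `dist` and their default `0` only serve termination; for a parent function and
nodes below `L` they always hold. -/
theorem dist_of_lt (hP : IsParent P L) {i j : ℕ} (h : i < j) (hj : j < L) :
    dist P L i j = 1 + dist P L (P i) j := by
  rw [dist]; simp [h.ne, h, hj, hP.lt i]

theorem dist_of_gt (hP : IsParent P L) {i j : ℕ} (h : j < i) (hi : i < L) :
    dist P L i j = 1 + dist P L i (P j) := by
  rw [dist]; simp [h.ne', h.not_gt, hi, hP.lt j]

/-- Induction along the recursion of `dist`. -/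
theorem pair_induction (hP : IsParent P L) {motive : ℕ → ℕ → Prop}
    (refl : ∀ i < L, motive i i)
    (lt : ∀ i j, i < j → j < L → motive (P i) j → motive i j)
    (gt : ∀ i j, j < i → i < L → motive i (P j) → motive i j) {i j : ℕ} (hi : i < L) (hj : j < L) :
    motive i j := by
  induction h : (L - i) + (L - j) using Nat.strong_induction_on generalizing i j with
  | _ k ih =>
    rcases lt_trichotomy i j with hij | rfl | hij
    · have := hP.lt i
      have := hP.le i (by omega)
      exact lt i j hij hj (ih _ (by omega) this hj rfl)
    · exact refl i hi
    · have := hP.lt j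
      have := hP.le j (by omega)
      exact gt i j hij hi (ih _ (by omega) hi this rfl)

theorem dist_comm (hP : IsParent P L) {i j : ℕ} (hi : i < L) (hj : j < L) :
    dist P L i j = dist P L j i := by
  refine pair_induction hP (motive := fun i j => dist P L i j = dist P L j i) (fun i _ => rfl)
    ?_ ?_ hi hj
  · intro i j h hj ih
    rw [dist_of_lt hP h hj, dist_of_gt hP h hj, ih]
  · intro i j h hi ih
    rw [dist_of_gt hP h hi, dist_of_lt hP h hi, ih]

theorem dist_eq_zero (hP : IsParent P L) {i j : ℕ} (hi : i < L) (hj : j < L)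
    (h : dist P L i j = 0) : i = j := by
  rcases lt_trichotomy i j with hij | rfl | hij
  · rw [dist_of_lt hP hij hj] at h; omega
  · rfl
  · rw [dist_of_gt hP hij hi] at h; omega

/-- Move the smallest of the three nodes to its parent. Both distances that involve it drop by one,
and this preserves the inequality backwards whichever node it is. -/
theorem dist_triangle (hP : IsParent P L) {i j k : ℕ} (hi : i < L) (hj : j < L) (hk : k < L) :
    dist P L i k ≤ dist P L i j + dist P L j k := by
  induction h : (L - i) + (L - j) + (L - k) using Nat.strong_induction_on
    generalizing i j k with
  | _ n ih =>
    rcases eq_or_ne i j with rfl | hij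
    · omega
    rcases eq_or_ne j k with rfl | hjk
    · omega
    rcases eq_or_ne i k with rfl | hik
    · rw [dist_self]; omega
    have h₁ := hP.lt i
    have h₂ := hP.lt j
    have h₃ := hP.lt k
    by_cases c₁ : i < j ∧ i < k
    · have h₄ := hP.le i (by omega)
      have := ih _ (by omega) h₄ hj hk rfl
      rw [dist_of_lt hP c₁.1 hj, dist_of_lt hP c₁.2 hk]; omega
    by_cases c₂ : j < i ∧ j < k
    · have h₄ := hP.le j (by omega)
      have := ih _ (by omega) hi h₄ hk rfl
      rw [dist_of_gt hP c₂.1 hi, dist_of_lt hP c₂.2 hk]; omega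
    · have c₃ : k < i ∧ k < j := by omega
      have h₄ := hP.le k (by omega)
      have := ih _ (by omega) hi hj h₄ rfl
      rw [dist_of_gt hP c₃.1 hi, dist_of_gt hP c₃.2 hj]; omega

theorem dist_parent (hP : IsParent P L) {i j : ℕ} (hi : i + 1 < L) (hj : j < L) :
    dist P L i j ≤ dist P L (P i) j + 1 ∧ dist P L (P i) j ≤ dist P L i j + 1 := by
  have h : dist P L i (P i) = 1 := by
    rw [dist_of_lt hP (hP.lt i) (hP.le i hi), dist_self]
  have h₁ := dist_triangle hP (show i < L by omega) (hP.le i hi) hj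
  have h₂ := dist_triangle hP (hP.le i hi) (show i < L by omega) hj
  have h₃ := dist_comm hP (hP.le i hi) (show i < L by omega)
  omega

/-- All nodes between `i` and `j` belong to `A`. -/
def Conn (P : ℕ → ℕ) (L : ℕ) (A : Finset ℕ) (i j : ℕ) : Prop :=
  ∀ w < L, dist P L i w + dist P L w j = dist P L i j → w ∈ A

theorem conn_of_lt (hP : IsParent P L) {A : Finset ℕ} {i j : ℕ} (h : i < j) (hj : j < L) :
    Conn P L A i j ↔ i ∈ A ∧ Conn P L A (P i) j := by
  have hi : i < L := by omega
  have hPi := hP.le i (by omega)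
  -- A node `w < i` is between neither pair, because the way to `w` and back uses the edge to `P w`
  -- twice. For `w > i`, replacing `i` by `P i` lowers both sides by one.
  have key : ∀ w < L, w ≠ i → (dist P L i w + dist P L w j = dist P L i j ↔
      dist P L (P i) w + dist P L w j = dist P L (P i) j) := by
    intro w hw hwi
    rcases lt_or_gt_of_ne hwi with hlt | hlt
    · have h₁ := hP.le w (by omega)
      have := hP.lt i
      have t₁ := dist_triangle hP hi h₁ hj
      have t₂ := dist_triangle hP hPi h₁ hj
      rw [dist_of_gt hP hlt hi, dist_of_lt hP (hlt.trans h) hj,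
        dist_of_gt hP (hlt.trans this) hPi]
      omega
    · rw [dist_of_lt hP hlt hw, dist_of_lt hP h hj]; omega
  constructor
  · intro hc
    refine ⟨hc i hi (by rw [dist_self]; omega), fun w hw hb => ?_⟩
    by_cases hwi : w = i
    · subst hwi; exact hc w hw (by rw [dist_self]; omega)
    · exact hc w hw ((key w hw hwi).2 hb)
  · rintro ⟨hA, hc⟩ w hw hb
    by_cases hwi : w = i
    · exact hwi ▸ hA
    · exact hc w hw ((key w hw hwi).1 hb)

theorem conn_comm (hP : IsParent P L) {A : Finset ℕ} {i j : ℕ} (hi : i < L) (hj : j < L) :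
    Conn P L A i j ↔ Conn P L A j i := by
  have : ∀ i j, i < L → j < L → Conn P L A i j → Conn P L A j i := by
    intro i j hi hj h w hw hb
    refine h w hw ?_
    rw [dist_comm hP hi hw, dist_comm hP hw hj, dist_comm hP hi hj]; omega
  exact ⟨this i j hi hj, this j i hj hi⟩

theorem conn_self (hP : IsParent P L) {A : Finset ℕ} {i : ℕ} (hi : i < L) :
    Conn P L A i i ↔ i ∈ A := by
  refine ⟨fun h => h i hi (by simp [dist_self]), fun h w hw hb => ?_⟩
  rw [dist_self] at hb
  have := dist_eq_zero hP hi hw (by omega)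
  exact this ▸ h

theorem Conn.left_mem {A : Finset ℕ} {i j : ℕ} (hi : i < L)
    (h : Conn P L A i j) : i ∈ A := h i hi (by rw [dist_self]; omega)

theorem Conn.of_between (hP : IsParent P L) {A : Finset ℕ} {i j w : ℕ} (hi : i < L) (hj : j < L)
    (hw : w < L) (h : Conn P L A i j) (hb : dist P L i w + dist P L w j = dist P L i j) :
    Conn P L A i w := by
  intro v hv hb'
  refine h v hv ?_
  have t₁ := dist_triangle hP hv hw hj
  have t₂ := dist_triangle hP hi hv hj
  omega

/-! ### Representatives -/

variable {A : Finset ℕ}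

theorem rep_of_mem (hP : IsParent P L) {m j : ℕ} (h : j < m) (h' : P j ∈ A) :
    rep P A m j = rep P A m (P j) := by
  rw [rep]; simp [h, h', hP.lt j]

theorem rep_of_notMem {m j : ℕ} (h' : P j ∉ A) : rep P A m j = j := by
  rw [rep]; simp [h']

theorem rep_of_le {m j : ℕ} (h : m ≤ j) : rep P A m j = j := by
  rw [rep]; simp [h.not_gt]

/-- Induction along the recursion of `rep`. -/
theorem rep_induction (hP : IsParent P L) {m : ℕ} {motive : ℕ → Prop}
    (step : ∀ j, j < m → P j ∈ A → rep P A m j = rep P A m (P j) → motive (P j) → motive j)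
    (last : ∀ j, (m ≤ j ∨ P j ∉ A) → rep P A m j = j → motive j) (j : ℕ) : motive j := by
  induction h : m - j using Nat.strong_induction_on generalizing j with
  | _ k ih =>
    by_cases c : j < m ∧ P j ∈ A
    · exact step j c.1 c.2 (rep_of_mem hP c.1 c.2) (ih _ (by have := hP.lt j; omega) _ rfl)
    · by_cases c' : m ≤ j
      · exact last j (.inl c') (rep_of_le c')
      · have : P j ∉ A := fun h => c ⟨by omega, h⟩
        exact last j (.inr this) (rep_of_notMem this)

theorem le_rep (hP : IsParent P L) (m j : ℕ) : j ≤ rep P A m j := by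
  induction j using rep_induction hP (A := A) (m := m) with
  | step j _ _ e ih =>
    have := hP.lt j; omega
  | last j _ e =>
    exact e.ge

theorem rep_mem (hP : IsParent P L) {m j : ℕ} (h : j ∈ A) : rep P A m j ∈ A := by
  induction j using rep_induction hP (A := A) (m := m) with
  | step j _ hp e ih =>
    rw [e]; exact ih hp
  | last j _ e =>
    rwa [e]

theorem rep_stop (hP : IsParent P L) (m j : ℕ) :
    m ≤ rep P A m j ∨ P (rep P A m j) ∉ A := by
  induction j using rep_induction hP (A := A) (m := m) with
  | step j _ h e ih =>
    rwa [e]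
  | last j h e =>
    rwa [e]

/-- The climb with the smaller bound is an initial segment of the climb with the larger one. -/
theorem rep_rep (hP : IsParent P L) {r m : ℕ} (h : r ≤ m) (j : ℕ) :
    rep P A m (rep P A r j) = rep P A m j := by
  induction j using rep_induction hP (A := A) (m := r) with
  | step j h₁ h₂ e ih =>
    rw [e, ih, rep_of_mem hP (by omega) h₂]
  | last j _ e =>
    rw [e]

/-- Raising the bound by one only releases the climbs that wait at `m`, and these advance by a
single edge since `m < P m`. This is the inductive step of the scans in increasing order. -/
theorem rep_succ (hP : IsParent P L) (m j : ℕ) :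
    rep P A (m + 1) j = if rep P A m j = m ∧ P m ∈ A then P m else rep P A m j := by
  rw [← rep_rep hP (Nat.le_succ m)]
  split_ifs with h
  · rw [h.1, rep_of_mem hP (by omega) h.2, rep_of_le]
    exact hP.lt m
  · rcases rep_stop hP (A := A) m j with h' | h'
    · by_cases e : rep P A m j = m
      · rw [e] at h ⊢
        exact rep_of_notMem fun h'' => h ⟨rfl, h''⟩
      · exact rep_of_le (by omega)
    · exact rep_of_notMem h'

/-- The topmost node of the component of `j`. -/
abbrev top (P : ℕ → ℕ) (L : ℕ) (A : Finset ℕ) (j : ℕ) : ℕ := rep P A L j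

theorem parent_top_notMem (hP : IsParent P L) (hA : A ⊆ Finset.range L) (j : ℕ) :
    P (top P L A j) ∉ A := by
  rcases rep_stop hP (A := A) L j with h | h
  · intro h'
    have := Finset.mem_range.1 (hA h')
    have := hP.lt (rep P A L j)
    change P (rep P A L j) ∈ A at h'
    have := Finset.mem_range.1 (hA h')
    omega
  · exact h

theorem top_of_parent_mem (hP : IsParent P L) (hA : A ⊆ Finset.range L) {j : ℕ} (h : P j ∈ A) :
    top P L A j = top P L A (P j) :=
  rep_of_mem hP (by have := Finset.mem_range.1 (hA h); have := hP.lt j; omega) h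

theorem top_eq_self_iff (hP : IsParent P L) (hA : A ⊆ Finset.range L) {j : ℕ} :
    top P L A j = j ↔ P j ∉ A := by
  refine ⟨fun h => h ▸ parent_top_notMem hP hA j, fun h => rep_of_notMem h⟩

theorem top_top (hP : IsParent P L) (j : ℕ) : top P L A (top P L A j) = top P L A j :=
  rep_rep hP le_rfl j

theorem top_rep (hP : IsParent P L) {m : ℕ} (hm : m ≤ L) (j : ℕ) :
    top P L A (rep P A m j) = top P L A j := rep_rep hP hm j

/-- The topmost node is a valid label of the component. Replace the smaller node, say `i`, by its
parent as long as the parent is active. If it is not, then `i` is its own topmost node, while that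
of `j` is at least `j > i`; and connectedness fails too, as the path from `i` to `j` starts with the
inactive `P i`. -/
theorem top_eq_top_iff_conn (hP : IsParent P L) (hA : A ⊆ Finset.range L) {i j : ℕ}
    (hi : i ∈ A) (hj : j ∈ A) : top P L A i = top P L A j ↔ Conn P L A i j := by
  have hL := fun {i} (h : i ∈ A) => Finset.mem_range.1 (hA h)
  have main : ∀ i j, i < L → j < L → i ∈ A → j ∈ A →
      (top P L A i = top P L A j ↔ Conn P L A i j) := by
    intro i j hi hj
    refine pair_induction hP (motive := fun i j => i ∈ A → j ∈ A →
      (top P L A i = top P L A j ↔ Conn P L A i j)) ?_ ?_ ?_ hi hj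
    · intro i hi hA' _
      simpa [conn_self hP hi] using hA'
    · intro i j hlt hj ih hiA hjA
      rw [conn_of_lt hP hlt hj]
      by_cases hp : P i ∈ A
      · rw [top_of_parent_mem hP hA hp, ih hp hjA]; simp [hiA]
      · have h₁ : top P L A i = i := rep_of_notMem hp
        have h₂ := le_rep hP (A := A) L j
        refine ⟨fun h => ?_, fun h => absurd (h.2.left_mem (hP.le i (by omega))) hp⟩
        change top P L A i = rep P A L j at h
        omega
    · intro i j hlt hi ih hiA hjA
      have hjL := hL hjA
      rw [conn_comm hP hi hjL, conn_of_lt hP hlt hi]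
      by_cases hp : P j ∈ A
      · rw [top_of_parent_mem hP hA hp, ih hiA hp, conn_comm hP hi (hL hp)]; simp [hjA]
      · have h₁ : top P L A j = j := rep_of_notMem hp
        have h₂ := le_rep hP (A := A) L i
        refine ⟨fun h => ?_, fun h => absurd (h.2.left_mem (hP.le j (by omega))) hp⟩
        change rep P A L i = top P L A j at h
        omega
  exact main i j (hL hi) (hL hj) hi hj

/-! ### Subtree sizes -/

/-- The number of active nodes in the part of the component of `v` that lies below `v`. -/
def below (P : ℕ → ℕ) (A : Finset ℕ) (v : ℕ) : ℕ := (A.filter fun j => rep P A v j = v).card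

/-- The component with topmost node `t`. -/
def comp (P : ℕ → ℕ) (L : ℕ) (A : Finset ℕ) (t : ℕ) : Finset ℕ := A.filter fun j => top P L A j = t

/-- The climb from `j` to `t` inside `A'` is also a climb inside `A`, and the bound `t` stops it
there. Hence a component of `A'` is contained in the part of `A` below its topmost node. -/
theorem rep_eq_of_top_eq (hP : IsParent P L) {A' : Finset ℕ} (h' : A' ⊆ A) {j t : ℕ}
    (h : top P L A' j = t) : rep P A t j = t := by
  subst h
  induction j using rep_induction hP (A := A') (m := L) with
  | step j h₁ h₂ e ih =>
    change rep P A (rep P A' L j) j = rep P A' L j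
    rw [e]
    have := le_rep hP (A := A') L (P j)
    have := hP.lt j
    rw [rep_of_mem hP (by omega) (h' h₂)]
    exact ih
  | last j _ e =>
    change rep P A (rep P A' L j) j = rep P A' L j
    rw [e, rep_of_le le_rfl]

theorem rep_self_eq_iff_top_eq (hP : IsParent P L) {j t : ℕ}
    (hL : t < L) (ht : P t ∉ A) : rep P A t j = t ↔ top P L A j = t := by
  refine ⟨fun h => ?_, fun h => rep_eq_of_top_eq hP subset_rfl h⟩
  rw [← top_rep hP hL.le j, h]
  exact rep_of_notMem ht

theorem below_eq_card_comp (hP : IsParent P L) {t : ℕ}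
    (hL : t < L) (ht : P t ∉ A) : below P A t = (comp P L A t).card := by
  simp only [below, comp, rep_self_eq_iff_top_eq hP hL ht]

/-! ### Centroids -/

/-- The centroid of the component of `i`: its first node that has more than half of the component
below it. -/
noncomputable def centroid (P : ℕ → ℕ) (L : ℕ) (A : Finset ℕ) (i : ℕ) : ℕ :=
  sInf {v | v ∈ A ∧ top P L A v = top P L A i ∧ below P A (top P L A i) < 2 * below P A v}

theorem centroid_spec (hP : IsParent P L) {i : ℕ} (hi : i ∈ A) :
    centroid P L A i ∈ A ∧ top P L A (centroid P L A i) = top P L A i ∧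
      below P A (top P L A i) < 2 * below P A (centroid P L A i) := by
  -- The topmost node has the whole component below it, so the set of candidates is nonempty.
  refine Nat.sInf_mem (s := {v | v ∈ A ∧ top P L A v = top P L A i ∧
    below P A (top P L A i) < 2 * below P A v}) ⟨top P L A i, rep_mem hP hi, top_top hP i, ?_⟩
  have : 0 < below P A (top P L A i) :=
    Finset.card_pos.2 ⟨top P L A i, Finset.mem_filter.2 ⟨rep_mem hP hi, rep_of_le le_rfl⟩⟩
  omega

theorem centroid_congr {i j : ℕ} (h : top P L A i = top P L A j) :
    centroid P L A i = centroid P L A j := by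
  simp only [centroid, h]

theorem below_le_of_lt_centroid {i v : ℕ} (hv : v ∈ A) (ht : top P L A v = top P L A i)
    (h : v < centroid P L A i) : 2 * below P A v ≤ below P A (top P L A i) := by
  by_contra hc
  exact Nat.notMem_of_lt_sInf h ⟨hv, ht, by omega⟩

/-- The nodes that remain when all centroids are removed. -/
noncomputable def next (P : ℕ → ℕ) (L : ℕ) (A : Finset ℕ) : Finset ℕ :=
  A.filter fun i => centroid P L A i ≠ i

theorem next_subset : next P L A ⊆ A := Finset.filter_subset _ _

/-- The climb from `j` in `A` passes through `c`. In `A'`, where `c` is missing, it must stop before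
`c`. -/
theorem top_lt_of_rep_eq (hP : IsParent P L) {A' : Finset ℕ} (hA' : A' ⊆ Finset.range L) {c : ℕ}
    (hc : c ∉ A') {j : ℕ} (hj : j ∈ A') (h : rep P A c j = c) : top P L A' j < c := by
  induction j using rep_induction hP (A := A) (m := c) with
  | step j h₁ h₂ e ih =>
    by_cases hp : P j ∈ A'
    · rw [top_of_parent_mem hP hA' hp]
      exact ih hp (e ▸ h)
    · rw [show top P L A' j = j from rep_of_notMem hp]; exact h₁
  | last j _ e =>
    exact absurd (show c ∈ A' by rw [← h, e]; exact hj) hc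

theorem top_top_of_subset (hP : IsParent P L) {A' : Finset ℕ} (h' : A' ⊆ A)
    (hA : A ⊆ Finset.range L) (j : ℕ) : top P L A (top P L A' j) = top P L A j := by
  induction j using rep_induction hP (A := A') (m := L) with
  | step j h₁ h₂ e ih =>
    rw [show top P L A' j = top P L A' (P j) from e, ih, top_of_parent_mem hP hA (h' h₂)]
  | last j _ e =>
    rw [show top P L A' j = j from e]

/-- A new component either hangs below the centroid or contains the old topmost node. In the first
case its topmost node precedes the centroid, so by minimality of the centroid at most half of the
nodes are below it. In the second case the component avoids everything below the centroid, which is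
more than half. -/
theorem two_mul_card_comp_next_le (hP : IsParent P L) (hA : A ⊆ Finset.range L) {i : ℕ}
    (hi : i ∈ next P L A) :
    2 * (comp P L (next P L A) (top P L (next P L A) i)).card ≤
      (comp P L A (top P L A i)).card := by
  set A' := next P L A with hA'def
  have hA' : A' ⊆ Finset.range L := next_subset.trans hA
  have hL := fun {i} (h : i ∈ A) => Finset.mem_range.1 (hA h)
  set t' := top P L A' i with ht'
  have ht'A : t' ∈ A' := rep_mem hP hi
  have hiA : i ∈ A := next_subset hi
  have e₁ : top P L A t' = top P L A i := top_top_of_subset hP next_subset hA i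
  have hb : below P A (top P L A i) = (comp P L A (top P L A i)).card :=
    below_eq_card_comp hP (hL (rep_mem hP hiA)) (parent_top_notMem hP hA i)
  obtain ⟨hc₁, hc₂, hc₃⟩ := centroid_spec hP hiA (L := L)
  set c := centroid P L A i with hc
  have hcA' : c ∉ A' := by
    intro h
    exact (Finset.mem_filter.1 h).2 ((centroid_congr hc₂).trans hc.symm)
  by_cases hp : P t' ∈ A
  · have hp' : P t' ∉ A' := parent_top_notMem hP hA' i
    have e₂ : top P L A (P t') = top P L A i := by rw [← top_of_parent_mem hP hA hp, e₁]
    -- The parent of `t'` was active and has been removed, so it is a centroid, and it lies in the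
    -- old component of `i`.
    have e₃ : c = P t' := by
      by_contra hne
      refine hp' (Finset.mem_filter.2 ⟨hp, ?_⟩)
      rw [centroid_congr e₂]; exact hne
    rw [← hb]
    refine le_trans (Nat.mul_le_mul_left 2 ?_)
      (below_le_of_lt_centroid (next_subset ht'A) e₁ (v := t') ?_)
    · refine Finset.card_le_card fun j hj => ?_
      obtain ⟨h₁, h₂⟩ := Finset.mem_filter.1 hj
      exact Finset.mem_filter.2 ⟨next_subset h₁, rep_eq_of_top_eq hP next_subset h₂⟩
    · rw [← hc, e₃]; exact hP.lt t'
  · have e₂ : t' = top P L A i := by rw [← e₁]; exact (rep_of_notMem hp).symm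
    -- A node below `c` has its new topmost node before `c`, whereas `t'` is the old topmost node
    -- and hence at least `c`.
    have hdisj : Disjoint (comp P L A' t') (A.filter fun j => rep P A c j = c) := by
      refine Finset.disjoint_left.2 fun j hj hj' => ?_
      obtain ⟨h₁, h₂⟩ := Finset.mem_filter.1 hj
      have h₃ := top_lt_of_rep_eq hP hA' hcA' h₁ (Finset.mem_filter.1 hj').2
      have h₄ := le_rep hP (A := A) L c
      change c ≤ top P L A c at h₄
      omega
    have hsub : comp P L A' t' ∪ (A.filter fun j => rep P A c j = c) ⊆ comp P L A t' := by
      refine Finset.union_subset (fun j hj => ?_) (fun j hj => ?_)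
      · obtain ⟨h₁, h₂⟩ := Finset.mem_filter.1 hj
        refine Finset.mem_filter.2 ⟨next_subset h₁, ?_⟩
        rw [← top_top_of_subset hP next_subset hA j, h₂, e₁, e₂]
      · obtain ⟨h₁, h₂⟩ := Finset.mem_filter.1 hj
        refine Finset.mem_filter.2 ⟨h₁, ?_⟩
        rw [← top_rep hP (hL hc₁).le j, h₂, hc₂, e₂]
    have := Finset.card_le_card hsub
    rw [Finset.card_union_of_disjoint hdisj] at this
    have e₄ : (A.filter fun j => rep P A c j = c).card = below P A c := rfl
    rw [e₂] at this ⊢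
    omega

/-! ### Distances to the centroid -/

/-- If `c` lies below `m`, the path from `P m` to `c` enters through `m`. This justifies the upward
sweep of `distPass`. -/
theorem dist_succ_of_rep_eq (hP : IsParent P L) (hA : A ⊆ Finset.range L) {c m : ℕ} (hc : c ∈ A)
    (hm : P m ∈ A) (h : rep P A m c = m) : dist P L (P m) c = dist P L m c + 1 := by
  have hPm := Finset.mem_range.1 (hA hm)
  induction c using rep_induction hP (A := A) (m := m) with
  | step c h₁ h₂ e ih =>
    have := hP.lt m
    have hPc := ih h₂ (e ▸ h)
    rw [dist_of_gt hP (by omega) hPm, dist_of_gt hP h₁ (by omega), hPc]; omega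
  | last c _ e =>
    have : c = m := e ▸ h
    subst this
    have := hP.lt c
    rw [dist_self, dist_of_gt hP this hPm, dist_self]

/-- If `c` does not lie below `v`, the path from `v` to `c` starts with the edge to the parent. This
justifies the downward sweep of `distPass`. -/
theorem dist_eq_succ_of_rep_ne (hP : IsParent P L) (hA : A ⊆ Finset.range L) {c v : ℕ} (hc : c ∈ A)
    (hv : v ∈ A) (ht : top P L A v = top P L A c) (h : rep P A v c ≠ v) :
    P v ∈ A ∧ dist P L v c = dist P L (P v) c + 1 := by
  have hvL := Finset.mem_range.1 (hA hv)
  have hvP : P v ∈ A := by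
    by_contra hp
    refine h ((rep_self_eq_iff_top_eq hP hvL hp).2 ?_)
    rw [← ht]; exact rep_of_notMem hp
  refine ⟨hvP, ?_⟩
  have hPL := Finset.mem_range.1 (hA hvP)
  induction c using rep_induction hP (A := A) (m := v) with
  | step c h₁ h₂ e ih =>
    have := hP.lt v
    have := ih h₂ (by rw [ht, top_of_parent_mem hP hA h₂]) (e ▸ h)
    rw [dist_of_gt hP h₁ hvL, dist_of_gt hP (by omega) hPL, this]; omega
  -- The climb stops at `c` itself, and then `v < c` in both cases: either the bound was exceeded,
  -- or `c` is the topmost node of the common component.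
  | last c hs e =>
    have hne : c ≠ v := e ▸ h
    have hcL := Finset.mem_range.1 (hA hc)
    rcases hs with hs | hs
    · rw [dist_of_lt hP (by omega) hcL]; omega
    · have h₁ : top P L A c = c := rep_of_notMem hs
      have h₂ : v ≤ top P L A v := le_rep hP L v
      rw [dist_of_lt hP (by omega) hcL]; omega

/-- Two nodes of a component that are in different components after the removal of the centroid are
connected through the centroid. -/
theorem dist_eq_add_of_separated (hP : IsParent P L) (hA : A ⊆ Finset.range L) {i j : ℕ}
    (hi : i ∈ A) (hj : j ∈ A) (h : top P L A i = top P L A j)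
    (h' : ¬ (i ∈ next P L A ∧ j ∈ next P L A ∧ top P L (next P L A) i = top P L (next P L A) j)) :
    dist P L i j = dist P L i (centroid P L A i) + dist P L j (centroid P L A j) := by
  have hL := fun {i} (h : i ∈ A) => Finset.mem_range.1 (hA h)
  have hA' : next P L A ⊆ Finset.range L := next_subset.trans hA
  have hc := (top_eq_top_iff_conn hP hA hi hj).1 h
  have hn : ¬ Conn P L (next P L A) i j := by
    intro hn
    have h₁ := hn.left_mem (hL hi)
    have h₂ := ((conn_comm hP (hL hi) (hL hj)).1 hn).left_mem (hL hj)
    exact h' ⟨h₁, h₂, (top_eq_top_iff_conn hP hA' h₁ h₂).2 hn⟩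
  -- Some node `w` on the path belongs to `A` but was removed. Being on the path it lies in the
  -- component of `i` and `j`, so it is the centroid of both.
  simp only [Conn, not_forall] at hn
  obtain ⟨w, hw, hb, hwn⟩ := hn
  have hwA := hc w hw hb
  have hiw := (top_eq_top_iff_conn hP hA hi hwA).2 (hc.of_between hP (hL hi) (hL hj) hw hb)
  have hwc : centroid P L A w = w := by
    by_contra hne
    exact hwn (Finset.mem_filter.2 ⟨hwA, hne⟩)
  rw [← centroid_congr h, centroid_congr hiw, hwc, dist_comm hP (hL hj) hw, hb]

/-- A path meets every intermediate distance to its end. This bounds distances by numbers of nodes.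
-/
theorem exists_between (hP : IsParent P L) {i j : ℕ} (hi : i < L) (hj : j < L) {e : ℕ}
    (he : e ≤ dist P L i j) :
    ∃ w < L, dist P L i w + dist P L w j = dist P L i j ∧ dist P L w j = e := by
  revert he
  refine pair_induction hP (motive := fun i j => ∀ e ≤ dist P L i j, ∃ w < L,
    dist P L i w + dist P L w j = dist P L i j ∧ dist P L w j = e) ?_ ?_ ?_ hi hj e
  · intro i hi e he
    rw [dist_self] at he
    exact ⟨i, hi, by simp [dist_self], by rw [dist_self]; omega⟩
  · intro i j h hj ih e he
    rcases he.eq_or_lt with rfl | he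
    · exact ⟨i, by omega, by rw [dist_self]; omega, rfl⟩
    rw [dist_of_lt hP h hj] at he ⊢
    obtain ⟨w, hw, h₁, h₂⟩ := ih e (by omega)
    refine ⟨w, hw, ?_, h₂⟩
    have t₁ := dist_triangle hP (show i < L by omega) hw hj
    have t₂ := (dist_parent hP (show i + 1 < L by omega) hw).1
    rw [dist_of_lt hP h hj] at t₁
    omega
  · intro i j h hi ih e he
    rw [dist_of_gt hP h hi] at he ⊢
    have hPj := hP.le j (by omega)
    rcases Nat.eq_zero_or_pos e with rfl | hpos
    · refine ⟨j, by omega, ?_, dist_self j⟩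
      rw [dist_self, dist_of_gt hP h hi]; omega
    obtain ⟨w, hw, h₁, h₂⟩ := ih (e - 1) (by omega)
    have t₁ := dist_triangle hP hi hw (show j < L by omega)
    have t₂ := (dist_parent hP (show j + 1 < L by omega) hw).1
    rw [dist_comm hP (by omega) hw, dist_comm hP hPj hw] at t₂
    rw [dist_of_gt hP h hi] at t₁
    exact ⟨w, hw, by omega, by omega⟩

/-- The path to the centroid stays in the component and has nodes at all the distances `0, …, d`,
which are `d + 1` different nodes. -/
theorem dist_centroid_lt_card (hP : IsParent P L) (hA : A ⊆ Finset.range L) {i : ℕ} (hi : i ∈ A) :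
    dist P L i (centroid P L A i) < (comp P L A (top P L A i)).card := by
  have hL := fun {i} (h : i ∈ A) => Finset.mem_range.1 (hA h)
  obtain ⟨hc₁, hc₂, -⟩ := centroid_spec hP hi (L := L)
  set c := centroid P L A i
  have hconn := (top_eq_top_iff_conn hP hA hi hc₁).1 hc₂.symm
  have : Finset.range (dist P L i c + 1) ⊆
      (comp P L A (top P L A i)).image fun w => dist P L w c := by
    intro e he
    obtain ⟨w, hw, h₁, h₂⟩ := exists_between hP (hL hi) (hL hc₁)
      (Nat.lt_succ_iff.1 (Finset.mem_range.1 he))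
    have hwA := hconn w hw h₁
    have := (top_eq_top_iff_conn hP hA hi hwA).2
      (hconn.of_between hP (hL hi) (hL hc₁) hw h₁)
    exact Finset.mem_image.2 ⟨w, Finset.mem_filter.2 ⟨hwA, this.symm⟩, h₂⟩
  have := (Finset.card_le_card this).trans Finset.card_image_le
  rw [Finset.card_range] at this
  omega

/-- The path to the removed centroid lies in the new component except for its last node. So the old
distances may equal the size of the new component, and this is why blocks have one cell more than
the component has nodes. -/
theorem dist_centroid_le_card_next (hP : IsParent P L) (hA : A ⊆ Finset.range L) {i : ℕ}
    (hi : i ∈ next P L A) : dist P L i (centroid P L A i) ≤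
      (comp P L (next P L A) (top P L (next P L A) i)).card := by
  have hL := fun {i} (h : i ∈ A) => Finset.mem_range.1 (hA h)
  have hiA := next_subset hi
  have hA' : next P L A ⊆ Finset.range L := next_subset.trans hA
  obtain ⟨hc₁, hc₂, -⟩ := centroid_spec hP hiA (L := L)
  set c := centroid P L A i with hc
  have hconn := (top_eq_top_iff_conn hP hA hiA hc₁).1 hc₂.symm
  have : Finset.Icc 1 (dist P L i c) ⊆
      (comp P L (next P L A) (top P L (next P L A) i)).image fun w => dist P L w c := by
    intro e he
    obtain ⟨he₁, he₂⟩ := Finset.mem_Icc.1 he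
    obtain ⟨w, hw, h₁, h₂⟩ := exists_between hP (hL hiA) (hL hc₁) he₂
    have hiw := hconn.of_between hP (hL hiA) (hL hc₁) hw h₁
    have hiw' : Conn P L (next P L A) i w := by
      intro v hv hb
      have hvA := hiw v hv hb
      refine Finset.mem_filter.2 ⟨hvA, fun hvc => ?_⟩
      have hiv := (top_eq_top_iff_conn hP hA hiA hvA).2
        (hiw.of_between hP (hL hiA) hw hv hb)
      rw [← centroid_congr hiv, ← hc] at hvc
      subst hvc
      have := dist_comm hP hw (hL hc₁)
      omega
    have hwn : w ∈ next P L A := hiw' w hw (by rw [dist_self]; omega)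
    exact Finset.mem_image.2
      ⟨w, Finset.mem_filter.2 ⟨hwn, ((top_eq_top_iff_conn hP hA' hi hwn).2 hiw').symm⟩, h₂⟩
  have := (Finset.card_le_card this).trans Finset.card_image_le
  simpa using this

end ParentTree

/-! ### The Fourier transform with roots of unity from square roots -/

namespace FFT

/-- Unit complex numbers in the upper half plane, each being a square root of its predecessor
`⌊t / 2⌋` in the binary tree or of the negative of it. -/
noncomputable def twiddle (t : ℕ) : ℂ :=
  if _h : t ≤ 1 then 1
  else if t % 2 = 0 then
    ⟨Real.sqrt ((1 + (twiddle (t / 2)).re) * (1 / 2)), Real.sqrt ((1 - (twiddle (t / 2)).re) * (1 / 2))⟩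
  else
    ⟨0 - Real.sqrt ((1 - (twiddle (t / 2)).re) * (1 / 2)),
      Real.sqrt ((1 + (twiddle (t / 2)).re) * (1 / 2))⟩
termination_by t
decreasing_by all_goals omega

theorem twiddle_one : twiddle 1 = 1 := by rw [twiddle]; simp

theorem twiddle_two_mul {t : ℕ} (ht : 1 ≤ t) : twiddle (2 * t) =
    ⟨Real.sqrt ((1 + (twiddle t).re) * (1 / 2)), Real.sqrt ((1 - (twiddle t).re) * (1 / 2))⟩ := by
  rw [twiddle, dif_neg (by omega), if_pos (by omega), show 2 * t / 2 = t by omega]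

theorem twiddle_two_mul_add_one {t : ℕ} (ht : 1 ≤ t) : twiddle (2 * t + 1) =
    ⟨0 - Real.sqrt ((1 - (twiddle t).re) * (1 / 2)),
      Real.sqrt ((1 + (twiddle t).re) * (1 / 2))⟩ := by
  rw [twiddle, dif_neg (by omega), if_neg (by omega), show (2 * t + 1) / 2 = t by omega]

theorem twiddle_im_nonneg (t : ℕ) : 0 ≤ (twiddle t).im := by
  rw [twiddle]
  split_ifs
  · simp
  · exact Real.sqrt_nonneg _
  · exact Real.sqrt_nonneg _

theorem twiddle_sq_add_sq (t : ℕ) : (twiddle t).re ^ 2 + (twiddle t).im ^ 2 = 1 := by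
  induction t using Nat.strong_induction_on with
  | _ t ih =>
    rw [twiddle]
    split_ifs with h₁ h₂
    · simp
    all_goals
      have h := ih (t / 2) (by omega)
      have h₃ : 0 ≤ (1 + (twiddle (t / 2)).re) * (1 / 2) := by nlinarith
      have h₄ : 0 ≤ (1 - (twiddle (t / 2)).re) * (1 / 2) := by nlinarith
      have h₅ := Real.sq_sqrt h₃
      have h₆ := Real.sq_sqrt h₄
      simp only
      nlinarith

theorem twiddle_mul_conj (t : ℕ) : twiddle t * (starRingEnd ℂ) (twiddle t) = 1 := by
  rw [Complex.mul_conj, Complex.normSq_apply, ← sq, ← sq, twiddle_sq_add_sq, Complex.ofReal_one]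

/-- These are the half-angle formulas. The product has the right sign because the imaginary part of
`twiddle t` is nonnegative. -/
theorem sqrt_twiddle (t : ℕ) :
    Real.sqrt ((1 + (twiddle t).re) * (1 / 2)) ^ 2 = (1 + (twiddle t).re) * (1 / 2) ∧
    Real.sqrt ((1 - (twiddle t).re) * (1 / 2)) ^ 2 = (1 - (twiddle t).re) * (1 / 2) ∧
    Real.sqrt ((1 + (twiddle t).re) * (1 / 2)) * Real.sqrt ((1 - (twiddle t).re) * (1 / 2)) =
      (twiddle t).im / 2 := by
  have h := twiddle_sq_add_sq t
  have h₃ : 0 ≤ (1 + (twiddle t).re) * (1 / 2) := by nlinarith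
  have h₄ : 0 ≤ (1 - (twiddle t).re) * (1 / 2) := by nlinarith
  refine ⟨Real.sq_sqrt h₃, Real.sq_sqrt h₄, ?_⟩
  rw [← Real.sqrt_mul h₃, ← Real.sqrt_sq (show 0 ≤ (twiddle t).im / 2 by
    have := twiddle_im_nonneg t; positivity)]
  congr 1
  nlinarith

theorem twiddle_two_mul_sq {t : ℕ} (ht : 1 ≤ t) : twiddle (2 * t) ^ 2 = twiddle t := by
  obtain ⟨h₁, h₂, h₃⟩ := sqrt_twiddle t
  rw [twiddle_two_mul ht]
  apply Complex.ext
  · rw [sq, Complex.mul_re]; simp only; nlinarith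
  · rw [sq, Complex.mul_im]; simp only; nlinarith

theorem twiddle_two_mul_add_one_sq {t : ℕ} (ht : 1 ≤ t) :
    twiddle (2 * t + 1) ^ 2 = -twiddle t := by
  obtain ⟨h₁, h₂, h₃⟩ := sqrt_twiddle t
  rw [twiddle_two_mul_add_one ht]
  apply Complex.ext
  · rw [sq, Complex.mul_re, Complex.neg_re]; simp only; nlinarith
  · rw [sq, Complex.mul_im, Complex.neg_im]; simp only; nlinarith

/-- The square of `twiddle t`. -/
noncomputable def node (t : ℕ) : ℂ :=
  if t = 1 then 1 else if t % 2 = 0 then twiddle (t / 2) else -twiddle (t / 2)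

theorem twiddle_sq {t : ℕ} (ht : 1 ≤ t) : twiddle t ^ 2 = node t := by
  rw [node]
  split_ifs with h₁ h₂
  · rw [h₁, twiddle_one, one_pow]
  · conv_lhs => rw [show t = 2 * (t / 2) by omega]
    exact twiddle_two_mul_sq (by omega)
  · conv_lhs => rw [show t = 2 * (t / 2) + 1 by omega]
    exact twiddle_two_mul_add_one_sq (by omega)

/-- The stages of the Fourier transform of the sequence `a` of length `2 * H`. -/
noncomputable def stage (H : ℕ) (a : ℕ → ℂ) : ℕ → ℕ → ℂ
  | 0, i => a i
  | l + 1, i =>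
    if i % 2 = 0 then
      stage H a l (i / 2) + twiddle (2 ^ l + i / 2 % 2 ^ l) * stage H a l (i / 2 + H)
    else stage H a l (i / 2) - twiddle (2 ^ l + i / 2 % 2 ^ l) * stage H a l (i / 2 + H)

theorem stage_even (H : ℕ) (a : ℕ → ℂ) (l q : ℕ) : stage H a (l + 1) (2 * q) =
    stage H a l q + twiddle (2 ^ l + q % 2 ^ l) * stage H a l (q + H) := by
  rw [stage, if_pos (by omega), show 2 * q / 2 = q by omega]

theorem stage_odd (H : ℕ) (a : ℕ → ℂ) (l q : ℕ) : stage H a (l + 1) (2 * q + 1) =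
    stage H a l q - twiddle (2 ^ l + q % 2 ^ l) * stage H a l (q + H) := by
  rw [stage, if_neg (by omega), show (2 * q + 1) / 2 = q by omega]

/-- A single butterfly can be undone, since the twiddle factor has modulus one. The inverse
transform undoes the stages in reverse order; neither orthogonality nor distinctness of the
evaluation points is needed. -/
theorem stage_left (H : ℕ) (a : ℕ → ℂ) (l q : ℕ) : stage H a l q =
    (stage H a (l + 1) (2 * q) + stage H a (l + 1) (2 * q + 1)) * (1 / 2) := by
  rw [stage_even, stage_odd]; ring

theorem stage_right (H : ℕ) (a : ℕ → ℂ) (l q : ℕ) : stage H a l (q + H) =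
    (stage H a (l + 1) (2 * q) - stage H a (l + 1) (2 * q + 1)) * (1 / 2) *
      (starRingEnd ℂ) (twiddle (2 ^ l + q % 2 ^ l)) := by
  rw [stage_even, stage_odd]
  linear_combination (-stage H a l (q + H)) * twiddle_mul_conj (2 ^ l + q % 2 ^ l)

/-- For each `b < 2 ^ l`, stage `l` holds with stride `2 ^ l` the coefficients of the polynomial `a`
modulo `X ^ n - node (2 ^ l + b)`, where `n = 2 ^ (k + 1 - l)`. The next stage uses the
factorization `X ^ (2 * n) - w ^ 2 = (X ^ n - w) * (X ^ n + w)`, with a twiddle factor as `w`. -/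
theorem sum_stage_mul_pow (k : ℕ) (a : ℕ → ℂ) {l : ℕ} (hl : l ≤ k + 1) {b : ℕ} (hb : b < 2 ^ l)
    {z : ℂ} (hz : z ^ 2 ^ (k + 1 - l) = node (2 ^ l + b)) :
    ∑ j ∈ Finset.range (2 ^ (k + 1 - l)), stage (2 ^ k) a l (j * 2 ^ l + b) * z ^ j =
      ∑ j ∈ Finset.range (2 ^ (k + 1)), a j * z ^ j := by
  induction l generalizing b with
  | zero =>
    obtain rfl : b = 0 := by simpa using hb
    simp [stage]
  | succ l ih =>
    have e₁ : k + 1 - l = (k - l) + 1 := by omega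
    have e₂ : k + 1 - (l + 1) = k - l := by omega
    have hp : 1 ≤ 2 ^ l := Nat.one_le_two_pow
    have hb2 : b / 2 < 2 ^ l := by rw [pow_succ] at hb; omega
    have hH : 2 ^ (k - l) * 2 ^ l = 2 ^ k := by rw [← pow_add]; congr 1; omega
    rw [e₂] at hz ⊢
    have hz₁ : z ^ 2 ^ (k - l) =
        if b % 2 = 0 then twiddle (2 ^ l + b / 2) else -twiddle (2 ^ l + b / 2) := by
      rw [hz, node, if_neg (by rw [pow_succ]; omega),
        show (2 ^ (l + 1) + b) % 2 = b % 2 by rw [pow_succ]; omega,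
        show (2 ^ (l + 1) + b) / 2 = 2 ^ l + b / 2 by rw [pow_succ]; omega]
    have hz₂ : z ^ 2 ^ (k + 1 - l) = node (2 ^ l + b / 2) := by
      rw [e₁, pow_succ, pow_mul, hz₁, ← twiddle_sq (by omega)]
      split_ifs <;> ring
    -- The lower and the upper half of the coefficients are combined in pairs. Partners are `2 ^ k`
    -- cells apart at every stage, so all stages have the same addressing pattern.
    rw [← ih (by omega) hb2 hz₂, e₁, show 2 ^ (k - l + 1) = 2 ^ (k - l) + 2 ^ (k - l) by ring, Finset.sum_range_add,
      ← Finset.sum_add_distrib]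
    refine Finset.sum_congr rfl fun j _ => ?_
    have e₃ : (j * 2 ^ l + b / 2) % 2 ^ l = b / 2 := by
      rw [mul_comm, Nat.mul_add_mod, Nat.mod_eq_of_lt hb2]
    have e₄ : (2 ^ (k - l) + j) * 2 ^ l + b / 2 = j * 2 ^ l + b / 2 + 2 ^ k := by
      rw [add_mul, hH]; ring
    rw [e₄, pow_add z, hz₁]
    split_ifs with h
    · rw [show j * 2 ^ (l + 1) + b = 2 * (j * 2 ^ l + b / 2) by rw [pow_succ, ← mul_assoc]; omega,
        stage_even, e₃]; ring
    · rw [show j * 2 ^ (l + 1) + b = 2 * (j * 2 ^ l + b / 2) + 1 by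
        rw [pow_succ, ← mul_assoc]; omega, stage_odd, e₃]; ring

theorem stage_last (k : ℕ) (a : ℕ → ℂ) {b : ℕ} (hb : b < 2 ^ (k + 1)) :
    stage (2 ^ k) a (k + 1) b =
      ∑ j ∈ Finset.range (2 ^ (k + 1)), a j * node (2 ^ (k + 1) + b) ^ j := by
  rw [← sum_stage_mul_pow k a le_rfl hb (by simp)]
  simp

open Polynomial in
/-- The coefficients of the product of the polynomials with coefficients `a` and `b`, both of
length `N`. -/
noncomputable def conv (N : ℕ) (a b : ℕ → ℂ) : ℕ → ℂ :=
  ((∑ j ∈ Finset.range N, C (a j) * X ^ j) * ∑ j ∈ Finset.range N, C (b j) * X ^ j).coeff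

open Polynomial in
theorem conv_apply {N : ℕ} {a b : ℕ → ℂ} (ha : ∀ j, N ≤ j → a j = 0) (hb : ∀ j, N ≤ j → b j = 0)
    (n : ℕ) : conv N a b n = ∑ p ∈ Finset.HasAntidiagonal.antidiagonal n, a p.1 * b p.2 := by
  have h : ∀ a : ℕ → ℂ, (∀ j, N ≤ j → a j = 0) → ∀ i,
      (∑ j ∈ Finset.range N, C (a j) * X ^ j : ℂ[X]).coeff i = a i := by
    intro a ha i
    simp only [finsetSum_coeff, coeff_C_mul_X_pow, Finset.sum_ite_eq, Finset.mem_range]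
    split_ifs with hi
    · rfl
    · exact (ha i (by omega)).symm
  rw [conv, coeff_mul]
  exact Finset.sum_congr rfl fun p _ => by rw [h a ha, h b hb]

open Polynomial in
-- The last stage consists of values of polynomials, and evaluation is multiplicative. The bound on
-- `m + m'` makes the product fit into `2 ^ (k + 1)` coefficients, so nothing wraps around.
theorem stage_conv {k : ℕ} {a b : ℕ → ℂ} {m m' : ℕ} (ha : ∀ j, m ≤ j → a j = 0)
    (hb : ∀ j, m' ≤ j → b j = 0) (hm : m + m' ≤ 2 ^ (k + 1)) {i : ℕ} (hi : i < 2 ^ (k + 1)) :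
    stage (2 ^ k) (conv (2 ^ (k + 1)) a b) (k + 1) i =
      stage (2 ^ k) a (k + 1) i * stage (2 ^ k) b (k + 1) i := by
  rw [stage_last k _ hi, stage_last k _ hi, stage_last k _ hi]
  set N := 2 ^ (k + 1)
  set z := node (N + i)
  have hr : ∀ n, N ≤ n → conv N a b n = 0 := by
    intro n hn
    rw [conv_apply (fun j hj => ha j (by omega)) (fun j hj => hb j (by omega))]
    refine Finset.sum_eq_zero fun p hp => ?_
    have := Finset.HasAntidiagonal.mem_antidiagonal.1 hp
    by_cases h : m ≤ p.1
    · rw [ha _ h, zero_mul]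
    · rw [hb _ (by omega), mul_zero]
  have he : ∀ a : ℕ → ℂ, ∑ j ∈ Finset.range N, a j * z ^ j =
      (∑ j ∈ Finset.range N, C (a j) * X ^ j : ℂ[X]).eval z := by
    intro a; simp [eval_finsetSum]
  rw [he a, he b, ← eval_mul, eval_eq_sum_range' (n := N)]
  · rfl
  · by_cases h0 : ((∑ j ∈ Finset.range N, C (a j) * X ^ j) *
        ∑ j ∈ Finset.range N, C (b j) * X ^ j : ℂ[X]) = 0
    · rw [h0, natDegree_zero]; positivity
    · rw [natDegree_lt_iff_degree_lt h0, degree_lt_iff_coeff_zero]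
      exact fun n hn => hr n hn

/-- The product with a Hankel matrix is a part of a convolution. -/
theorem conv_hankel {N m : ℕ} (hN : m + m ≤ N) (g x : ℕ → ℝ) {d : ℕ} (hd : d < m) :
    conv N (fun j => if j < m + m then (g j : ℂ) else 0)
      (fun j => if j < m then (x (m - 1 - j) : ℂ) else 0) (d + m - 1) =
      ((∑ e ∈ Finset.range m, g (d + e) * x e : ℝ) : ℂ) := by
  rw [conv_apply (fun j hj => if_neg (by omega)) (fun j hj => if_neg (by omega)),
    Complex.ofReal_sum]
  symm
  -- Since the vector is reversed, the terms with `g (d + e)` and `x e` all lie on the antidiagonal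
  -- of `d + m - 1`. Its remaining pairs have second index at least `m` and contribute zero.
  refine Finset.sum_of_injOn (fun e => (d + e, m - 1 - e)) ?_ ?_ ?_ ?_
  · intro e he e' he' h
    simpa using congrArg Prod.fst h
  · intro e he
    have := Finset.mem_range.1 he
    simp only [Finset.mem_coe, Finset.HasAntidiagonal.mem_antidiagonal]
    omega
  · intro p hp hn
    have := Finset.HasAntidiagonal.mem_antidiagonal.1 hp
    by_cases h : p.2 < m
    · exact absurd ⟨m - 1 - p.2, by simpa using (by omega), by ext <;> simp <;> omega⟩ hn
    · rw [if_neg h, mul_zero]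
  · intro e he
    have := Finset.mem_range.1 he
    simp only
    rw [if_pos (by omega), if_pos (by omega), show m - 1 - (m - 1 - e) = e by omega,
      Complex.ofReal_mul]

end FFT

/-! ### Butterflies on the machine -/

namespace RealRAM

notation "nat[" a ", " i "]" => NExp.get a i
notation "real[" a ", " i "]" => RExp.get a i

/-- A natural-number variable. -/
abbrev var (v : ℕ) : NExp := NExp.get v 0

/-- Assignment to a natural-number variable. -/
abbrev setVar (v : ℕ) (e : NExp) : Program := .setNat v 0 e

/-! Names of the natural-number banks. -/
notation "bIn" => 0
notation "bDeg" => 3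
notation "bSum" => 4
notation "bOrd" => 5
notation "bPar" => 6
notation "bPos" => 7
notation "bUp" => 8
notation "bRem" => 9
notation "bTop" => 10
notation "bSize" => 11
notation "bCen" => 12
notation "bDist" => 13
notation "bOff" => 14
notation "bPow" => 15
notation "vI" => 20
notation "vJ" => 21
notation "vTail" => 22
notation "vT" => 23
notation "vE" => 24
notation "vM" => 25
notation "vN" => 26
notation "vK" => 27
notation "vH" => 28
notation "vL" => 29
notation "vBase" => 30
notation "vLo" => 31
notation "vTw" => 32
notation "vRound" => 33
notation "vU" => 34
notation "vQ" => 35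

/-! Names of the real banks. -/
notation "rF" => 0
notation "rX" => 1
notation "rY" => 2
notation "rTwRe" => 3
notation "rTwIm" => 4
notation "rARe" => 5
notation "rAIm" => 6
notation "rBRe" => 7
notation "rBIm" => 8
notation "rCRe" => 9
notation "rCIm" => 10
notation "rIn" => 11
notation "rOut" => 12

/-- The complex number in cell `a` of the pair of banks `re`, `im`. -/
noncomputable def Memory.cx (s : Memory) (re im a : ℕ) : ℂ := ⟨s.real re a, s.real im a⟩

/-- Computes the least power of two `N = 2 ^ K` that is at least `4 * M`, its half `H`, and a table
of the smaller powers of two. -/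
def chooseSize : Program :=
  setVar vN 1 ;; setVar vK 0 ;;
  .whileLt (var vN) (var vM + var vM + var vM + var vM)
    (.setNat bPow (var vK) (var vN) ;; setVar vH (var vN) ;; setVar vN (var vN + var vN) ;;
      setVar vK (var vK + 1))

structure SizeReady (k : ℕ) (s : Memory) : Prop where
  K : s.nat vK 0 = k + 1
  N : s.nat vN 0 = 2 ^ (k + 1)
  H : s.nat vH 0 = 2 ^ k
  pow : ∀ j ≤ k, s.nat bPow j = 2 ^ j

theorem chooseSize_runs {s : Memory} {m : ℕ} (hm : 1 ≤ m) (hM : s.nat vM 0 = m) :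
    ∃ k, 4 * m ≤ 2 ^ (k + 1) ∧ 2 ^ (k + 1) < 8 * m ∧
      RunsIn (k + 3) chooseSize s (SizeReady k) := by
  -- The loop doubles from `1` until it reaches `4 * m`, hence runs `k + 1` times. The length `2 ^
  -- (k + 1)` has room for the product of a sequence of length `2 * m` and one of length `m`.
  obtain ⟨k, hk⟩ : ∃ k, Nat.clog 2 (4 * m) = k + 1 :=
    ⟨Nat.clog 2 (4 * m) - 1, by have := Nat.clog_pos (b := 2) (n := 4 * m) (by omega) (by omega); omega⟩
  have h₁ : ∀ j, 2 ^ j < 4 * m ↔ j < k + 1 := by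
    intro j; rw [← hk, Nat.lt_clog_iff_pow_lt (by omega)]
  refine ⟨k, ?_, ?_, ?_⟩
  · have := h₁ (k + 1); omega
  · have := (h₁ k).2 (by omega); rw [pow_succ]; omega
  · set body : Program := (.setNat bPow (var vK) (var vN) ;; setVar vH (var vN) ;;
      setVar vN (var vN + var vN) ;; setVar vK (var vK + 1)) with hbody
    refine Runs.seq (T₁ := 3) (Q₁ := fun s' => s'.nat vN 0 = 1 ∧ s'.nat vM 0 = m)
      (.loopFree rfl (by simp [Program.run, hM]) (by decide)) (fun s₁ _ h₁' => ?_)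
      (T₂ := (k + 2) * chooseSize.size + chooseSize.size - 3) ?_
    · refine Runs.seq (T₁ := 3) (Q₁ := fun s' => s'.nat vN 0 = 1 ∧ s'.nat vM 0 = m ∧ s'.nat vK 0 = 0)
        (.loopFree rfl (by simp [Program.run, h₁']) (by decide)) (fun s₂ _ h₂ => ?_)
        (T₂ := (k + 2) * chooseSize.size + chooseSize.size - 6) ?_
      · refine (Runs.whileLt (n := k + 1) (c := fun _ => body.size)
          (I := fun j s' => s'.nat vN 0 = 2 ^ j ∧ s'.nat vM 0 = m ∧ s'.nat vK 0 = j ∧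
            (∀ i < j, s'.nat bPow i = 2 ^ i) ∧ (0 < j → s'.nat vH 0 = 2 ^ (j - 1)))
          ⟨by simpa using h₂.1, h₂.2.1, h₂.2.2, by simp, by simp⟩ ?_ ?_ ?_).mono le_rfl ?_
        · rintro j hj s' - ⟨a₁, a₂, a₃, a₄, a₅⟩
          refine ⟨by have := (h₁ j).2 hj; simp [a₁, a₂]; omega, .loopFree rfl ?_ le_rfl⟩
          simp [Program.run, a₁, a₂, a₃, pow_succ, mul_two]
          intro i hi
          split_ifs with hij
          · rw [hij]
          · exact a₄ i (by omega)
        · rintro s' - ⟨a₁, a₂, -⟩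
          have := h₁ (k + 1)
          simp [a₁, a₂]; omega
        · simp only [Finset.sum_const, Finset.card_range, smul_eq_mul]
          have e : chooseSize.size = 6 + (1 + (var vN).cost +
            (var vM + var vM + var vM + var vM).cost + body.size) := rfl
          rw [e]
          generalize (1 + (var vN).cost + (var vM + var vM + var vM + var vM).cost) = x
          generalize body.size = y
          ring_nf; omega
        · rintro s' - ⟨a₁, a₂, a₃, a₄, a₅⟩
          exact ⟨a₃, a₁, by simpa using a₅ (by omega), fun j hj => a₄ j (by omega)⟩
      · have : 6 ≤ chooseSize.size := by decide
        omega
    · have : 6 ≤ chooseSize.size := by decide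
      have e : (k + 3) * chooseSize.size = (k + 2) * chooseSize.size + chooseSize.size := by ring
      omega

/-- The twiddle factors below `n` are in memory. -/
def TwiddleReady (n : ℕ) (s : Memory) : Prop :=
  ∀ t, 1 ≤ t → t < n → s.cx rTwRe rTwIm t = FFT.twiddle t

/-- Two different real banks that do not hold the twiddle factors. -/
structure BankPair (re im : ℕ) : Prop where
  ne : re ≠ im
  re_re : rTwRe ≠ re
  re_im : rTwRe ≠ im
  im_re : rTwIm ≠ re
  im_im : rTwIm ≠ im

section butterflies

variable (re im : ℕ)

/-- The index of the twiddle factor of the next butterfly. -/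
def nextTwiddle : Program :=
  setVar vTw (var vTw + 1) ;; .ifLt (var vTw) (var vLo + var vLo) .skip (setVar vTw (var vLo))

/-- A butterfly from the stage at `vBase` to the next one. -/
def butterfly : Program :=
  .setReal re (var vBase + var vN + (var vE + var vE)) (real[re, var vBase + var vE] +
    (real[rTwRe, var vTw] * real[re, var vBase + (var vE + var vH)] -
      real[rTwIm, var vTw] * real[im, var vBase + (var vE + var vH)])) ;;
  .setReal im (var vBase + var vN + (var vE + var vE)) (real[im, var vBase + var vE] +
    (real[rTwRe, var vTw] * real[im, var vBase + (var vE + var vH)] +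
      real[rTwIm, var vTw] * real[re, var vBase + (var vE + var vH)])) ;;
  .setReal re (var vBase + var vN + (var vE + var vE + 1)) (real[re, var vBase + var vE] -
    (real[rTwRe, var vTw] * real[re, var vBase + (var vE + var vH)] -
      real[rTwIm, var vTw] * real[im, var vBase + (var vE + var vH)])) ;;
  .setReal im (var vBase + var vN + (var vE + var vE + 1)) (real[im, var vBase + var vE] -
    (real[rTwRe, var vTw] * real[im, var vBase + (var vE + var vH)] +
      real[rTwIm, var vTw] * real[re, var vBase + (var vE + var vH)]))

/-- The inverse of a butterfly, from the stage after `vBase` to the one at `vBase`. -/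
def invButterfly : Program :=
  .setReal re (var vBase + var vE) ((real[re, var vBase + var vN + (var vE + var vE)] +
    real[re, var vBase + var vN + (var vE + var vE + 1)]) * .lit (1 / 2)) ;;
  .setReal im (var vBase + var vE) ((real[im, var vBase + var vN + (var vE + var vE)] +
    real[im, var vBase + var vN + (var vE + var vE + 1)]) * .lit (1 / 2)) ;;
  .setReal re (var vBase + (var vE + var vH))
    ((real[re, var vBase + var vN + (var vE + var vE)] -
      real[re, var vBase + var vN + (var vE + var vE + 1)]) * .lit (1 / 2) * real[rTwRe, var vTw] +
    (real[im, var vBase + var vN + (var vE + var vE)] -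
      real[im, var vBase + var vN + (var vE + var vE + 1)]) * .lit (1 / 2) *
        real[rTwIm, var vTw]) ;;
  .setReal im (var vBase + (var vE + var vH))
    ((real[im, var vBase + var vN + (var vE + var vE)] -
      real[im, var vBase + var vN + (var vE + var vE + 1)]) * .lit (1 / 2) * real[rTwRe, var vTw] -
    (real[re, var vBase + var vN + (var vE + var vE)] -
      real[re, var vBase + var vN + (var vE + var vE + 1)]) * .lit (1 / 2) * real[rTwIm, var vTw])

variable {re im}

/-- The machine has no division, so the residue modulo `2 ^ l` in the index of the twiddle factor is
tracked by a counter that wraps around. -/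
theorem nextTwiddle_run {s : Memory} {l j : ℕ} (hlo : s.nat vLo 0 = 2 ^ l)
    (htw : s.nat vTw 0 = 2 ^ l + j % 2 ^ l) :
    (nextTwiddle.run s).nat vTw 0 = 2 ^ l + (j + 1) % 2 ^ l := by
  have hp : 0 < 2 ^ l := by positivity
  have h : (j + 1) % 2 ^ l = if j % 2 ^ l + 1 < 2 ^ l then j % 2 ^ l + 1 else 0 := by
    have := Nat.mod_lt j hp
    split_ifs with h
    · rw [Nat.add_mod, Nat.mod_eq_of_lt (a := 1) (by omega), Nat.mod_eq_of_lt h]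
    · have e : j + 1 = 2 ^ l * (j / 2 ^ l) + 2 ^ l := by
        have := Nat.div_add_mod j (2 ^ l); omega
      rw [e]; simp
  rw [h]
  simp only [nextTwiddle, Program.run, NExp.eval_add, NExp.eval_get, NExp.eval_ofNat,
    Memory.writeNat_nat]
  norm_num [hlo, htw]
  by_cases hc : j % 2 ^ l + 1 < 2 ^ l
  · rw [if_pos (by omega), if_pos hc]; simp; omega
  · rw [if_neg (by omega), if_neg hc]; simp

/-- The assignments read from the block at `vBase` and write to the block after it. As `vE < H`, no
cell is read after having been overwritten, so the four assignments act simultaneously. -/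
theorem butterfly_run (hp : BankPair re im) {s : Memory} {H : ℕ} (hN : s.nat vN 0 = H + H) (hH : s.nat vH 0 = H)
    (hj : s.nat vE 0 < H) (a : ℕ) :
    ((butterfly re im).run s).cx re im a =
      if a = s.nat vBase 0 + s.nat vN 0 + 2 * s.nat vE 0 then
        s.cx re im (s.nat vBase 0 + s.nat vE 0) + s.cx rTwRe rTwIm (s.nat vTw 0) *
          s.cx re im (s.nat vBase 0 + (s.nat vE 0 + s.nat vH 0))
      else if a = s.nat vBase 0 + s.nat vN 0 + (2 * s.nat vE 0 + 1) then
        s.cx re im (s.nat vBase 0 + s.nat vE 0) - s.cx rTwRe rTwIm (s.nat vTw 0) *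
          s.cx re im (s.nat vBase 0 + (s.nat vE 0 + s.nat vH 0))
      else s.cx re im a := by
  obtain ⟨h₁, h₂, h₃, h₄, h₅⟩ := hp
  generalize hb : s.nat vBase 0 = b at *
  generalize he : s.nat vE 0 = e at *
  have d₁ : b + e ≠ b + (H + H) + (e + e) := by omega
  have d₂ : b + e ≠ b + (H + H) + (e + e + 1) := by omega
  have d₃ : b + (e + H) ≠ b + (H + H) + (e + e) := by omega
  have d₄ : b + (e + H) ≠ b + (H + H) + (e + e + 1) := by omega
  simp only [butterfly, Program.run, NExp.eval_add, NExp.eval_get, NExp.eval_ofNat,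
    Memory.writeReal_real, Memory.writeReal_nat, RExp.eval_add, RExp.eval_sub, RExp.eval_mul,
    RExp.eval_get, hb, he, hN, hH, d₁, d₂, d₃, d₄, h₁, h₁.symm, h₂, h₃, h₄, h₅, if_false, and_false,
    false_and, true_and, Memory.cx, two_mul]
  by_cases c₁ : a = b + (H + H) + (e + e)
  · subst c₁
    apply Complex.ext <;> simp [Complex.add_re, Complex.mul_re]
  · by_cases c₂ : a = b + (H + H) + (e + e + 1)
    · subst c₂
      apply Complex.ext <;> simp
    · simp [c₁, c₂]

theorem invButterfly_run (hp : BankPair re im) {s : Memory} {H : ℕ} (hN : s.nat vN 0 = H + H) (hH : s.nat vH 0 = H)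
    (hj : s.nat vE 0 < H) (a : ℕ) :
    ((invButterfly re im).run s).cx re im a =
      if a = s.nat vBase 0 + s.nat vE 0 then
        (s.cx re im (s.nat vBase 0 + s.nat vN 0 + 2 * s.nat vE 0) +
          s.cx re im (s.nat vBase 0 + s.nat vN 0 + (2 * s.nat vE 0 + 1))) * (1 / 2)
      else if a = s.nat vBase 0 + (s.nat vE 0 + s.nat vH 0) then
        (s.cx re im (s.nat vBase 0 + s.nat vN 0 + 2 * s.nat vE 0) -
          s.cx re im (s.nat vBase 0 + s.nat vN 0 + (2 * s.nat vE 0 + 1))) * (1 / 2) *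
          (starRingEnd ℂ) (s.cx rTwRe rTwIm (s.nat vTw 0))
      else s.cx re im a := by
  obtain ⟨h₁, h₂, h₃, h₄, h₅⟩ := hp
  generalize hb : s.nat vBase 0 = b at *
  generalize he : s.nat vE 0 = e at *
  have d₁ : b + (H + H) + (e + e) ≠ b + e := by omega
  have d₂ : b + (H + H) + (e + e + 1) ≠ b + e := by omega
  have d₃ : b + (H + H) + (e + e) ≠ b + (e + H) := by omega
  have d₄ : b + (H + H) + (e + e + 1) ≠ b + (e + H) := by omega
  have hH₀ : H ≠ 0 := by omega
  simp only [invButterfly, Program.run, NExp.eval_add, NExp.eval_get, NExp.eval_ofNat,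
    Memory.writeReal_real, Memory.writeReal_nat, RExp.eval_add, RExp.eval_sub, RExp.eval_mul,
    RExp.eval_get, RExp.eval_lit, hb, he, hN, hH, d₁, d₂, d₃, d₄, h₁, h₁.symm, h₂, h₃, h₄, h₅,
    if_false, and_false, false_and, true_and, Memory.cx, two_mul]
  have r : (1 / 2 : ℂ) = ((1 / 2 : ℝ) : ℂ) := by norm_num
  rw [r]
  by_cases c₁ : a = b + e
  · subst c₁
    apply Complex.ext <;> simp [hH₀, -Complex.ofReal_div]
  · by_cases c₂ : a = b + (e + H)
    · subst c₂
      apply Complex.ext <;> simp [hH₀, -Complex.ofReal_div]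
      ring
    · simp [c₁, c₂]

end butterflies

end RealRAM

/-! ### Forward and backward transforms -/

namespace RealRAM

theorem SizeReady.frame {k : ℕ} {s s' : Memory} {p : Program} (h : SizeReady k s)
    (hf : Frame p s s') (hp : ∀ b ∈ [vK, vN, vH, bPow], b ∉ p.natBanks) : SizeReady k s' where
  K := by rw [hf.nat _ (hp _ (by simp))]; exact h.K
  N := by rw [hf.nat _ (hp _ (by simp))]; exact h.N
  H := by rw [hf.nat _ (hp _ (by simp))]; exact h.H
  pow := by rw [hf.nat _ (hp _ (by simp))]; exact h.pow

theorem TwiddleReady.frame {n : ℕ} {s s' : Memory} {p : Program} (h : TwiddleReady n s)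
    (hf : Frame p s s') (h₁ : rTwRe ∉ p.realBanks) (h₂ : rTwIm ∉ p.realBanks) :
    TwiddleReady n s' := by
  intro t ht ht'
  rw [← h t ht ht', Memory.cx, Memory.cx, hf.real _ h₁, hf.real _ h₂]

section transforms

variable (re im : ℕ)

/-- Stage `l` occupies the block of `N` cells that starts at `l * N`, and its twiddle factors are
those with indices from `2 ^ l` to `2 ^ (l + 1) - 1`. -/
def forwardStage : Program :=
  setVar vLo nat[bPow, var vL] ;; setVar vTw (var vLo) ;;
  forTo vE (var vH) (butterfly re im ;; nextTwiddle) ;;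
  setVar vBase (var vBase + var vN)

/-- The discrete Fourier transform. Each stage is written to fresh cells. -/
def forward : Program := setVar vBase 0 ;; forTo vL (var vK) (forwardStage re im)

/-- The counter `vL` runs upwards while the stages are undone from the last to the first, whence the
index `K - 1 - vL`. -/
def backwardStage : Program :=
  setVar vLo nat[bPow, var vK - 1 - var vL] ;; setVar vTw (var vLo) ;;
  setVar vBase (var vBase - var vN) ;;
  forTo vE (var vH) (invButterfly re im ;; nextTwiddle)

/-- The inverse of the discrete Fourier transform. -/
def backward : Program := forTo vL (var vK) (backwardStage re im)

variable {re im}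

@[simp] theorem Memory.writeNat_cx (s : Memory) (a i v : ℕ) (b : ℕ) :
    (s.writeNat a i v).cx re im b = s.cx re im b := rfl

theorem nextTwiddle_run_cx (s : Memory) (b : ℕ) :
    (nextTwiddle.run s).cx re im b = s.cx re im b := by
  have h := nextTwiddle.frame_run rfl s
  rw [Memory.cx, Memory.cx, h.real re (by simp [nextTwiddle, Program.realBanks]),
    h.real im (by simp [nextTwiddle, Program.realBanks])]

theorem butterfly_run_nat (s : Memory) : ((butterfly re im).run s).nat = s.nat := rfl

theorem invButterfly_run_nat (s : Memory) : ((invButterfly re im).run s).nat = s.nat := rfl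

theorem forwardStage_runs (hp : BankPair re im) {s : Memory} {k l : ℕ} (hl : l ≤ k) {a : ℕ → ℂ}
    (hs : SizeReady k s) (ht : TwiddleReady (2 ^ (k + 1)) s) (hL : s.nat vL 0 = l)
    (hB : s.nat vBase 0 = l * 2 ^ (k + 1))
    (ha : ∀ i < 2 ^ (k + 1), s.cx re im (l * 2 ^ (k + 1) + i) = FFT.stage (2 ^ k) a l i) :
    RunsIn (2 ^ k + 1) (forwardStage re im) s fun s' => s'.nat vBase 0 = (l + 1) * 2 ^ (k + 1) ∧
      ∀ i < 2 ^ (k + 1),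
        s'.cx re im ((l + 1) * 2 ^ (k + 1) + i) = FFT.stage (2 ^ k) a (l + 1) i := by
  have hW : 1 ≤ 2 ^ k + 1 := Nat.le_add_left 1 _
  refine .seq (Q₁ := fun s' => s' = (setVar vLo nat[bPow, var vL]).run s) (.loopFree rfl rfl hW) ?_
  rintro _ - rfl
  refine .seq (Q₁ := fun s' => s' = (setVar vTw (var vLo)).run
    ((setVar vLo nat[bPow, var vL]).run s)) (.loopFree rfl rfl hW) ?_
  rintro s₁ - hs₁
  have hN : 2 ^ (k + 1) = 2 ^ k + 2 ^ k := by ring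
  have b₁ : s₁.nat vLo 0 = 2 ^ l := by simp [hs₁, Program.run, hL, hs.pow l hl]
  have b₂ : s₁.nat vTw 0 = 2 ^ l := by simp [hs₁, Program.run, hL, hs.pow l hl]
  have b₃ : s₁.nat vBase 0 = l * 2 ^ (k + 1) := by simp [hs₁, Program.run, hB]
  have b₄ : s₁.nat vH 0 = 2 ^ k := by simp [hs₁, Program.run, hs.H]
  have b₅ : s₁.nat vN 0 = 2 ^ k + 2 ^ k := by simp [hs₁, Program.run, hs.N, hN]
  have b₆ : s₁.real = s.real := by simp [hs₁, Program.run]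
  -- After `j` butterflies the block of stage `l` is intact and the first `2 * j` cells of the next
  -- block are complete.
  refine .seq (.forTo_loopFree (2 ^ k) (fun j s' => s'.nat vTw 0 = 2 ^ l + j % 2 ^ l ∧
    (∀ i < 2 ^ (k + 1), s'.cx re im (l * 2 ^ (k + 1) + i) = FFT.stage (2 ^ k) a l i) ∧
    ∀ i < 2 * j, s'.cx re im ((l + 1) * 2 ^ (k + 1) + i) = FFT.stage (2 ^ k) a (l + 1) i)
    rfl ?_ ?_ ?_ ?_ le_rfl) ?_
  · simp [butterfly, nextTwiddle, Program.natBanks]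
  · intro s' hf
    simp only [NExp.eval_get, NExp.eval_ofNat]
    rw [hf.nat _ (by simp [forTo, butterfly, nextTwiddle, Program.natBanks]), b₄]
  · refine ⟨by simp [b₂], fun i hi => ?_, by simp⟩
    rw [← ha i hi]
    simp only [Memory.cx, Memory.writeNat_real, b₆]
  · rintro j hj s' hf hv ⟨i₁, i₂, i₃⟩
    have c₁ : s'.nat vLo 0 = 2 ^ l := by
      rw [hf.nat _ (by simp [forTo, butterfly, nextTwiddle, Program.natBanks]), b₁]
    have c₃ : s'.nat vBase 0 = l * 2 ^ (k + 1) := by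
      rw [hf.nat _ (by simp [forTo, butterfly, nextTwiddle, Program.natBanks]), b₃]
    have c₄ : s'.nat vH 0 = 2 ^ k := by
      rw [hf.nat _ (by simp [forTo, butterfly, nextTwiddle, Program.natBanks]), b₄]
    have c₅ : s'.nat vN 0 = 2 ^ k + 2 ^ k := by
      rw [hf.nat _ (by simp [forTo, butterfly, nextTwiddle, Program.natBanks]), b₅]
    have hlt : 2 ^ l + j % 2 ^ l < 2 ^ (k + 1) := by
      have h₁ : j % 2 ^ l < 2 ^ l := Nat.mod_lt _ (by positivity)
      have h₂ : 2 ^ (l + 1) ≤ 2 ^ (k + 1) := Nat.pow_le_pow_right (by omega) (by omega)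
      rw [pow_succ] at h₂; omega
    have c₆ : s'.cx rTwRe rTwIm (2 ^ l + j % 2 ^ l) = FFT.twiddle (2 ^ l + j % 2 ^ l) := by
      rw [← ht _ (by have : 0 < 2 ^ l := by positivity
                     omega) hlt, Memory.cx, Memory.cx, ← b₆,
        hf.real _ (by simp [forTo, butterfly, nextTwiddle, Program.realBanks, hp.re_re, hp.re_im]),
        hf.real _ (by simp [forTo, butterfly, nextTwiddle, Program.realBanks, hp.im_re, hp.im_im])]
    have key := butterfly_run hp c₅ c₄ (by rwa [hv])
    rw [c₃, c₅, hv, i₁, c₄, c₆, i₂ j (by omega), i₂ (j + 2 ^ k) (by omega)] at key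
    have hmul : (l + 1) * 2 ^ (k + 1) = l * 2 ^ (k + 1) + (2 ^ k + 2 ^ k) := by rw [hN]; ring
    refine ⟨?_, fun i hi => ?_, fun i hi => ?_⟩
    · simp only [Program.run]
      have := nextTwiddle_run (s := (butterfly re im).run s') (l := l) (j := j)
        (by rw [butterfly_run_nat, c₁]) (by rw [butterfly_run_nat, i₁])
      simpa using this
    · simp only [Program.run, Memory.writeNat_cx, nextTwiddle_run_cx]
      rw [key, if_neg (by omega), if_neg (by omega), i₂ i hi]
    · simp only [Program.run, Memory.writeNat_cx, nextTwiddle_run_cx]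
      rw [key, hmul]
      by_cases e₁ : i = 2 * j
      · rw [if_pos (by omega), e₁, FFT.stage_even]
      · by_cases e₂ : i = 2 * j + 1
        · rw [if_neg (by omega), if_pos (by omega), e₂, FFT.stage_odd]
        · rw [if_neg (by omega), if_neg (by omega), ← hmul, i₃ i (by omega)]
  · rintro s₂ hf ⟨i₁, i₂, i₃⟩
    refine .loopFree rfl ⟨?_, fun i hi => ?_⟩ hW
    · simp only [Program.run, NExp.eval_add, NExp.eval_get, NExp.eval_ofNat, Memory.writeNat_nat]
      rw [hf.nat vBase (by simp [forTo, butterfly, nextTwiddle, Program.natBanks]), b₃,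
        hf.nat vN (by simp [forTo, butterfly, nextTwiddle, Program.natBanks]), b₅]
      simp; rw [hN]; ring
    · exact i₃ i (by rw [hN] at hi; omega)

theorem forward_runs (hp : BankPair re im) {s : Memory} {k : ℕ} {a : ℕ → ℂ}
    (hs : SizeReady k s) (ht : TwiddleReady (2 ^ (k + 1)) s)
    (ha : ∀ i < 2 ^ (k + 1), s.cx re im i = a i) :
    RunsIn ((k + 3) * (2 ^ k + 1)) (forward re im) s fun s' =>
      s'.nat vBase 0 = (k + 1) * 2 ^ (k + 1) ∧ ∀ i < 2 ^ (k + 1),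
        s'.cx re im ((k + 1) * 2 ^ (k + 1) + i) = FFT.stage (2 ^ k) a (k + 1) i := by
  refine .seq (Q₁ := fun s' => s'.nat vBase 0 = 0 ∧ ∀ i < 2 ^ (k + 1), s'.cx re im i = a i)
    (.loopFree rfl ⟨by simp [Program.run], ha⟩ (Nat.mul_pos (by omega) (Nat.succ_pos _))) ?_
  rintro s₁ hf₁ ⟨h₁, h₂⟩
  have hs₁ := hs.frame hf₁ (by simp [Program.natBanks])
  have ht₁ := ht.frame hf₁ (by simp [Program.realBanks]) (by simp [Program.realBanks])
  refine .forTo (k + 1) (W' := 2 ^ k + 1) (fun l s' => s'.nat vBase 0 = l * 2 ^ (k + 1) ∧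
    ∀ i < 2 ^ (k + 1), s'.cx re im (l * 2 ^ (k + 1) + i) = FFT.stage (2 ^ k) a l i) ?_ ?_ ?_ ?_
    (Nat.mul_le_mul_right _ (by omega)) (Nat.le_add_left 1 _)
  · simp [forwardStage, forTo, butterfly, nextTwiddle, Program.natBanks]
  · intro s' hf
    exact (hs₁.frame hf (by
      simp [forwardStage, forTo, butterfly, nextTwiddle, Program.natBanks])).K
  · exact ⟨by simp [h₁], fun i hi => by simpa [FFT.stage] using h₂ i hi⟩
  · rintro l hl s' hf hv ⟨i₁, i₂⟩
    exact forwardStage_runs hp (Nat.lt_succ_iff.1 hl)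
      (hs₁.frame hf (by simp [forwardStage, forTo, butterfly, nextTwiddle, Program.natBanks]))
      (ht₁.frame hf
        (by simp [forwardStage, forTo, butterfly, nextTwiddle, Program.realBanks, hp.re_re,
          hp.re_im])
        (by simp [forwardStage, forTo, butterfly, nextTwiddle, Program.realBanks, hp.im_re,
          hp.im_im])) hv i₁ i₂

theorem backwardStage_runs (hp : BankPair re im) {s : Memory} {k l : ℕ} (hl : l ≤ k) {a : ℕ → ℂ}
    (hs : SizeReady k s) (ht : TwiddleReady (2 ^ (k + 1)) s) (hL : s.nat vL 0 = k - l)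
    (hB : s.nat vBase 0 = (l + 1) * 2 ^ (k + 1))
    (ha : ∀ i < 2 ^ (k + 1),
      s.cx re im ((l + 1) * 2 ^ (k + 1) + i) = FFT.stage (2 ^ k) a (l + 1) i) :
    RunsIn (2 ^ k + 1) (backwardStage re im) s fun s' => s'.nat vBase 0 = l * 2 ^ (k + 1) ∧
      ∀ i < 2 ^ (k + 1), s'.cx re im (l * 2 ^ (k + 1) + i) = FFT.stage (2 ^ k) a l i := by
  have hW : 1 ≤ 2 ^ k + 1 := Nat.le_add_left 1 _
  refine .seq (Q₁ := fun s' => s' = (setVar vLo nat[bPow, var vK - 1 - var vL]).run s)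
    (.loopFree rfl rfl hW) ?_
  rintro _ - rfl
  refine .seq (Q₁ := fun s' => s' = (setVar vTw (var vLo)).run
    ((setVar vLo nat[bPow, var vK - 1 - var vL]).run s)) (.loopFree rfl rfl hW) ?_
  rintro _ - rfl
  refine .seq (Q₁ := fun s' => s' = (setVar vBase (var vBase - var vN)).run
    ((setVar vTw (var vLo)).run ((setVar vLo nat[bPow, var vK - 1 - var vL]).run s)))
    (.loopFree rfl rfl hW) ?_
  rintro s₁ - hs₁
  have hN : 2 ^ (k + 1) = 2 ^ k + 2 ^ k := by ring
  have hmul : (l + 1) * 2 ^ (k + 1) = l * 2 ^ (k + 1) + (2 ^ k + 2 ^ k) := by rw [hN]; ring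
  have hkl : k - (k - l) = l := by omega
  have b₁ : s₁.nat vLo 0 = 2 ^ l := by
    simp [hs₁, Program.run, hL, hs.K, hkl, hs.pow l hl]
  have b₂ : s₁.nat vTw 0 = 2 ^ l := by
    simp [hs₁, Program.run, hL, hs.K, hkl, hs.pow l hl]
  have b₃ : s₁.nat vBase 0 = l * 2 ^ (k + 1) := by
    simp [hs₁, Program.run, hB, hs.N, hmul]; omega
  have b₄ : s₁.nat vH 0 = 2 ^ k := by simp [hs₁, Program.run, hs.H]
  have b₅ : s₁.nat vN 0 = 2 ^ k + 2 ^ k := by simp [hs₁, Program.run, hs.N, hN]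
  have b₆ : s₁.real = s.real := by simp [hs₁, Program.run]
  -- After `j` inverse butterflies the first `j` cells of each half of the block of stage `l` are
  -- recovered.
  refine (RunsIn.forTo_loopFree (2 ^ k) (fun j s' => s'.nat vTw 0 = 2 ^ l + j % 2 ^ l ∧
    (∀ i < 2 ^ (k + 1),
      s'.cx re im ((l + 1) * 2 ^ (k + 1) + i) = FFT.stage (2 ^ k) a (l + 1) i) ∧
    ∀ i < j, s'.cx re im (l * 2 ^ (k + 1) + i) = FFT.stage (2 ^ k) a l i ∧
      s'.cx re im (l * 2 ^ (k + 1) + (i + 2 ^ k)) = FFT.stage (2 ^ k) a l (i + 2 ^ k))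
    rfl ?_ ?_ ?_ ?_ le_rfl).mono le_rfl ?_
  · simp [invButterfly, nextTwiddle, Program.natBanks]
  · intro s' hf
    simp only [NExp.eval_get, NExp.eval_ofNat]
    rw [hf.nat _ (by simp [forTo, invButterfly, nextTwiddle, Program.natBanks]), b₄]
  · refine ⟨by simp [b₂], fun i hi => ?_, by simp⟩
    rw [← ha i hi]
    simp only [Memory.cx, Memory.writeNat_real, b₆]
  · rintro j hj s' hf hv ⟨i₁, i₂, i₃⟩
    have c₁ : s'.nat vLo 0 = 2 ^ l := by
      rw [hf.nat _ (by simp [forTo, invButterfly, nextTwiddle, Program.natBanks]), b₁]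
    have c₃ : s'.nat vBase 0 = l * 2 ^ (k + 1) := by
      rw [hf.nat _ (by simp [forTo, invButterfly, nextTwiddle, Program.natBanks]), b₃]
    have c₄ : s'.nat vH 0 = 2 ^ k := by
      rw [hf.nat _ (by simp [forTo, invButterfly, nextTwiddle, Program.natBanks]), b₄]
    have c₅ : s'.nat vN 0 = 2 ^ k + 2 ^ k := by
      rw [hf.nat _ (by simp [forTo, invButterfly, nextTwiddle, Program.natBanks]), b₅]
    have hlt : 2 ^ l + j % 2 ^ l < 2 ^ (k + 1) := by
      have h₁ : j % 2 ^ l < 2 ^ l := Nat.mod_lt _ (by positivity)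
      have h₂ : 2 ^ (l + 1) ≤ 2 ^ (k + 1) := Nat.pow_le_pow_right (by omega) (by omega)
      rw [pow_succ] at h₂; omega
    have c₆ : s'.cx rTwRe rTwIm (2 ^ l + j % 2 ^ l) = FFT.twiddle (2 ^ l + j % 2 ^ l) := by
      rw [← ht _ (by have : 0 < 2 ^ l := by positivity
                     omega) hlt, Memory.cx, Memory.cx, ← b₆,
        hf.real _ (by
          simp [forTo, invButterfly, nextTwiddle, Program.realBanks, hp.re_re, hp.re_im]),
        hf.real _ (by
          simp [forTo, invButterfly, nextTwiddle, Program.realBanks, hp.im_re, hp.im_im])]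
    have key := invButterfly_run hp c₅ c₄ (by rwa [hv])
    have j₁ := i₂ (2 * j) (by omega)
    have j₂ := i₂ (2 * j + 1) (by omega)
    rw [hmul] at j₁ j₂
    rw [c₃, c₅, hv, i₁, c₄, c₆, j₁, j₂, ← FFT.stage_left, ← FFT.stage_right] at key
    refine ⟨?_, fun i hi => ?_, fun i hi => ?_⟩
    · simp only [Program.run]
      have := nextTwiddle_run (s := (invButterfly re im).run s') (l := l) (j := j)
        (by rw [invButterfly_run_nat, c₁]) (by rw [invButterfly_run_nat, i₁])
      simpa using this
    · simp only [Program.run, Memory.writeNat_cx, nextTwiddle_run_cx]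
      rw [key, if_neg (by omega), if_neg (by omega), i₂ i hi]
    · simp only [Program.run, Memory.writeNat_cx, nextTwiddle_run_cx]
      rw [key, key]
      by_cases e₁ : i = j
      · rw [if_pos (by omega), if_neg (by omega), if_pos (by omega), e₁]
        exact ⟨rfl, rfl⟩
      · rw [if_neg (by omega), if_neg (by omega), if_neg (by omega), if_neg (by omega)]
        exact i₃ i (by omega)
  · rintro s₂ hf ⟨i₁, i₂, i₃⟩
    refine ⟨?_, fun i hi => ?_⟩
    · rw [hf.nat vBase (by simp [forTo, invButterfly, nextTwiddle, Program.natBanks]), b₃]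
    · by_cases h : i < 2 ^ k
      · exact (i₃ i h).1
      · have := (i₃ (i - 2 ^ k) (by omega)).2
        rwa [show i - 2 ^ k + 2 ^ k = i by omega] at this

theorem backward_runs (hp : BankPair re im) {s : Memory} {k : ℕ} {a : ℕ → ℂ}
    (hs : SizeReady k s) (ht : TwiddleReady (2 ^ (k + 1)) s)
    (hB : s.nat vBase 0 = (k + 1) * 2 ^ (k + 1))
    (ha : ∀ i < 2 ^ (k + 1),
      s.cx re im ((k + 1) * 2 ^ (k + 1) + i) = FFT.stage (2 ^ k) a (k + 1) i) :
    RunsIn ((k + 3) * (2 ^ k + 1)) (backward re im) s fun s' =>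
      ∀ i < 2 ^ (k + 1), s'.cx re im i = a i := by
  refine (RunsIn.forTo (k + 1) (W' := 2 ^ k + 1) (fun l s' =>
    s'.nat vBase 0 = (k + 1 - l) * 2 ^ (k + 1) ∧ ∀ i < 2 ^ (k + 1),
      s'.cx re im ((k + 1 - l) * 2 ^ (k + 1) + i) = FFT.stage (2 ^ k) a (k + 1 - l) i) ?_ ?_ ?_ ?_
    (Nat.mul_le_mul_right _ (by omega)) (Nat.le_add_left 1 _)).mono le_rfl ?_
  · simp [backwardStage, forTo, invButterfly, nextTwiddle, Program.natBanks]
  · intro s' hf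
    exact (hs.frame hf (by
      simp [backwardStage, forTo, invButterfly, nextTwiddle, Program.natBanks])).K
  · exact ⟨by simp [hB], fun i hi => ha i hi⟩
  · rintro l hl s' hf hv ⟨i₁, i₂⟩
    have e : k + 1 - l = (k - l) + 1 := by omega
    have e' : k + 1 - (l + 1) = k - l := by omega
    rw [e']
    rw [e] at i₁ i₂
    exact backwardStage_runs hp (by omega)
      (hs.frame hf (by simp [backwardStage, forTo, invButterfly, nextTwiddle, Program.natBanks]))
      (ht.frame hf
        (by simp [backwardStage, forTo, invButterfly, nextTwiddle, Program.realBanks, hp.re_re,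
          hp.re_im])
        (by simp [backwardStage, forTo, invButterfly, nextTwiddle, Program.realBanks, hp.im_re,
          hp.im_im])) (by omega) i₁ i₂
  · rintro s' - ⟨-, h⟩ i hi
    simpa [FFT.stage] using h i hi

end transforms

end RealRAM

/-! ### Products with Hankel matrices -/

namespace RealRAM

/-- Replaces the first `M` cells of the block `T` of `rIn` by their product with the Hankel matrix
of `rF`, which goes to the block `T` of `rOut`. -/
def hankelBlock : Program :=
  chooseSize ;;
  forTo vE (var vN) (.setReal rARe (var vE) (.lit 0) ;; .setReal rAIm (var vE) (.lit 0) ;;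
    .setReal rBRe (var vE) (.lit 0) ;; .setReal rBIm (var vE) (.lit 0)) ;;
  forTo vE (var vM + var vM) (.setReal rARe (var vE) real[rF, var vE]) ;;
  forTo vE (var vM)
    (.setReal rBRe (var vM - 1 - var vE) real[rIn, nat[bOff, var vT] + var vE]) ;;
  forward rARe rAIm ;; forward rBRe rBIm ;;
  forTo vE (var vN) (
    .setReal rCRe (var vBase + var vE) (
      real[rARe, var vBase + var vE] * real[rBRe, var vBase + var vE] -
      real[rAIm, var vBase + var vE] * real[rBIm, var vBase + var vE]) ;;
    .setReal rCIm (var vBase + var vE) (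
      real[rARe, var vBase + var vE] * real[rBIm, var vBase + var vE] +
      real[rAIm, var vBase + var vE] * real[rBRe, var vBase + var vE])) ;;
  backward rCRe rCIm ;;
  forTo vE (var vM)
    (.setReal rOut (nat[bOff, var vT] + var vE) real[rCRe, var vE + var vM - 1])

/-- Everything that the later steps of `hankelBlock` still read, compared with the initial memory
`s₀`. -/
structure BlockReady (k m : ℕ) (s₀ s : Memory) : Prop where
  size : SizeReady k s
  twiddle : TwiddleReady (2 ^ (k + 1)) s
  M : s.nat vM 0 = m
  off : s.nat bOff = s₀.nat bOff
  T : s.nat vT = s₀.nat vT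
  f : s.real rF = s₀.real rF
  inp : s.real rIn = s₀.real rIn

theorem BlockReady.frame {k m : ℕ} {s₀ s s' : Memory} {p : Program} (h : BlockReady k m s₀ s)
    (hf : Frame p s s') (hn : ∀ b ∈ [vK, vN, vH, bPow, vM, bOff, vT], b ∉ p.natBanks)
    (hr : ∀ b ∈ [rTwRe, rTwIm, rF, rIn], b ∉ p.realBanks) : BlockReady k m s₀ s' where
  size := h.size.frame hf fun b hb => hn b (by simp at hb ⊢; omega)
  twiddle := h.twiddle.frame hf (hr _ (by simp)) (hr _ (by simp))
  M := by rw [hf.nat _ (hn _ (by simp))]; exact h.M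
  off := by rw [hf.nat _ (hn _ (by simp))]; exact h.off
  T := by rw [hf.nat _ (hn _ (by simp))]; exact h.T
  f := by rw [hf.real _ (hr _ (by simp))]; exact h.f
  inp := by rw [hf.real _ (hr _ (by simp))]; exact h.inp

/-- The length of the transforms is below `8 * m`, which gives the cost and the required size of the
table of twiddle factors. The last clause protects the results of other blocks, which share the bank
`rOut`. -/
theorem hankelBlock_runs {s : Memory} {m n : ℕ} (hm : 1 ≤ m) (hM : s.nat vM 0 = m)
    (ht : TwiddleReady n s) (hn : 8 * m ≤ n) :
    RunsIn ((Nat.log 2 (8 * m) + 2) * (8 * m)) hankelBlock s fun s' =>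
      (∀ d < m, s'.real rOut (s.nat bOff (s.nat vT 0) + d) = ∑ e ∈ Finset.range m,
        s.real rF (d + e) * s.real rIn (s.nat bOff (s.nat vT 0) + e)) ∧
      ∀ a, (∀ d < m, a ≠ s.nat bOff (s.nat vT 0) + d) → s'.real rOut a = s.real rOut a := by
  obtain ⟨k, hk₁, hk₂, hch⟩ := chooseSize_runs hm hM
  have hlog : k + 1 ≤ Nat.log 2 (8 * m) := Nat.le_log_of_pow_le (by omega) hk₂.le
  have hH : 2 ^ (k + 1) = 2 ^ k + 2 ^ k := by ring
  have hp : 0 < 2 ^ k := by positivity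
  have hW : (k + 3) * (2 ^ (k + 1) + 1) ≤ (Nat.log 2 (8 * m) + 2) * (8 * m) :=
    Nat.mul_le_mul (by omega) (by omega)
  refine RunsIn.mono (W := (k + 3) * (2 ^ (k + 1) + 1)) ?_ hW fun _ _ h => h
  have hW₁ : 2 ^ (k + 1) + 1 ≤ (k + 3) * (2 ^ (k + 1) + 1) := Nat.le_mul_of_pos_left _ (by omega)
  have hW₂ : (k + 3) * (2 ^ k + 1) ≤ (k + 3) * (2 ^ (k + 1) + 1) :=
    Nat.mul_le_mul_left _ (by omega)
  have hW₃ : k + 3 ≤ (k + 3) * (2 ^ (k + 1) + 1) := Nat.le_mul_of_pos_right _ (by omega)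
  set o := s.nat bOff (s.nat vT 0) with ho
  refine .seq (hch.mono hW₃ fun _ _ h => h) fun s₁ f₁ h₁ => ?_
  have r₁ : BlockReady k m s s₁ :=
    { size := h₁
      twiddle := fun t ht₁ ht₂ => (ht.frame f₁ (by decide) (by decide)) t ht₁ (by omega)
      M := by rw [f₁.nat _ (by decide), hM]
      off := f₁.nat _ (by decide)
      T := f₁.nat _ (by decide)
      f := f₁.real _ (by decide)
      inp := f₁.real _ (by decide) }
  have q₁ : s₁.real rOut = s.real rOut := f₁.real _ (by decide)
  -- The buffers may contain data of earlier blocks. Clearing stage `0` suffices, since the blocks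
  -- of the later stages are written before they are read.
  refine .seq (.forTo_loopFree (2 ^ (k + 1)) (fun j s' => ∀ i < j, s'.real rARe i = 0 ∧
    s'.real rAIm i = 0 ∧ s'.real rBRe i = 0 ∧ s'.real rBIm i = 0) rfl (by decide)
    (fun s' hf => (r₁.frame hf (by decide) (by decide)).size.N) (by simp) ?_ hW₁) ?_
  · intro j hj s' hf hv hI i hi
    simp only [Program.run, Memory.writeNat_real, Memory.writeReal_real, Memory.writeReal_nat,
      NExp.eval_get, NExp.eval_ofNat, hv, RExp.eval_lit]
    by_cases e : i = j
    · simp [e]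
    · simpa [e] using hI i (by omega)
  intro s₂ f₂ h₂
  have r₂ := r₁.frame f₂ (by decide) (by decide)
  have q₂ : s₂.real rOut = s.real rOut := (f₂.real _ (by decide)).trans q₁
  refine .seq (.forTo_loopFree (m + m) (fun j s' => ∀ i < 2 ^ (k + 1),
    s'.cx rARe rAIm i = if i < j then (s.real rF i : ℂ) else 0) rfl (by decide)
    (fun s' hf => ?_) (fun i hi => ?_) ?_ (by omega)) ?_
  · have := (r₂.frame hf (by decide) (by decide)).M
    simp [this]
  · have := h₂ i hi
    apply Complex.ext <;> simp [Memory.cx, this]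
  · intro j hj s' hf hv hI i hi
    have c₁ : s'.real rF = s.real rF := (r₂.frame hf (by decide) (by decide)).f
    by_cases e : i = j
    · subst e
      have := congrArg Complex.im (hI i hi)
      simp [Memory.cx] at this
      apply Complex.ext <;> simp [Program.run, Memory.cx, hv, c₁, this]
    · have := hI i hi
      simp only [Memory.cx] at this
      simp only [Program.run, Memory.cx, Memory.writeNat_real, Memory.writeReal_real,
        NExp.eval_get, NExp.eval_ofNat, hv, e, and_false, if_false, this]
      simp only [show i < j + 1 ↔ i < j by omega]
  intro s₃ f₃ h₃
  have r₃ := r₂.frame f₃ (by decide) (by decide)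
  have q₃ : s₃.real rOut = s.real rOut := (f₃.real _ (by decide)).trans q₂
  have g₃ : ∀ i < 2 ^ (k + 1), s₃.real rBRe i = 0 ∧ s₃.real rBIm i = 0 := by
    intro i hi
    rw [f₃.real rBRe (by decide), f₃.real rBIm (by decide)]
    exact (h₂ i hi).2.2
  -- The vector is loaded in reverse order, which turns the Hankel product into a convolution.
  refine .seq (.forTo_loopFree m (fun j s' => ∀ i < 2 ^ (k + 1), s'.cx rBRe rBIm i =
    if i < m ∧ m - 1 - i < j then (s.real rIn (o + (m - 1 - i)) : ℂ) else 0) rfl (by decide)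
    (fun s' hf => (r₃.frame hf (by decide) (by decide)).M) (fun i hi => ?_) ?_ (by omega)) ?_
  · apply Complex.ext <;> simp [Memory.cx, g₃ i hi]
  · intro j hj s' hf hv hI i hi
    have c := r₃.frame hf (by decide) (by decide)
    by_cases e : i = m - 1 - j
    · have e' : m - 1 - i = j := by omega
      have := congrArg Complex.im (hI i hi)
      simp [Memory.cx, e'] at this
      rw [if_pos (by omega), e']
      apply Complex.ext <;>
        simp [Program.run, Memory.cx, hv, c.M, c.T, c.off, c.inp, ← e, this, ho]
    · have := hI i hi
      simp only [Memory.cx] at this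
      simp only [Program.run, Memory.cx, Memory.writeNat_real, Memory.writeReal_real,
        NExp.eval_get, NExp.eval_ofNat, NExp.eval_sub, hv, c.M, e, and_false, if_false, this]
      simp only [show (i < m ∧ m - 1 - i < j + 1) ↔ (i < m ∧ m - 1 - i < j) by omega]
  intro s₄ f₄ h₄
  have r₄ := r₃.frame f₄ (by decide) (by decide)
  have q₄ : s₄.real rOut = s.real rOut := (f₄.real _ (by decide)).trans q₃
  have g₄ : ∀ i < 2 ^ (k + 1), s₄.cx rARe rAIm i = if i < m + m then (s.real rF i : ℂ) else 0 := by
    intro i hi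
    rw [Memory.cx, f₄.real rARe (by decide), f₄.real rAIm (by decide)]
    exact h₃ i hi
  have h₄' : ∀ i < 2 ^ (k + 1),
      s₄.cx rBRe rBIm i = if i < m then (s.real rIn (o + (m - 1 - i)) : ℂ) else 0 := by
    intro i hi
    rw [h₄ i hi]
    simp only [show (i < m ∧ m - 1 - i < m) ↔ i < m by omega]
  set a : ℕ → ℂ := fun i => if i < m + m then (s.real rF i : ℂ) else 0 with ha
  set b : ℕ → ℂ := fun i => if i < m then (s.real rIn (o + (m - 1 - i)) : ℂ) else 0 with hb
  have pA : BankPair rARe rAIm := by constructor <;> decide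
  have pB : BankPair rBRe rBIm := by constructor <;> decide
  have pC : BankPair rCRe rCIm := by constructor <;> decide
  refine .seq ((forward_runs pA r₄.size r₄.twiddle g₄).mono hW₂ fun _ _ h => h)
    fun s₅ f₅ ⟨_, h₅⟩ => ?_
  have r₅ := r₄.frame f₅ (by decide) (by decide)
  have q₅ : s₅.real rOut = s.real rOut := (f₅.real _ (by decide)).trans q₄
  have g₅ : ∀ i < 2 ^ (k + 1), s₅.cx rBRe rBIm i = b i := by
    intro i hi
    rw [Memory.cx, f₅.real rBRe (by decide), f₅.real rBIm (by decide)]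
    exact h₄' i hi
  refine .seq ((forward_runs pB r₅.size r₅.twiddle g₅).mono hW₂ fun _ _ h => h)
    fun s₆ f₆ ⟨b₆, h₆⟩ => ?_
  have r₆ := r₅.frame f₆ (by decide) (by decide)
  have q₆ : s₆.real rOut = s.real rOut := (f₆.real _ (by decide)).trans q₅
  have g₆ : ∀ i < 2 ^ (k + 1), s₆.cx rARe rAIm ((k + 1) * 2 ^ (k + 1) + i) =
      FFT.stage (2 ^ k) a (k + 1) i := by
    intro i hi
    rw [Memory.cx, f₆.real rARe (by decide), f₆.real rAIm (by decide)]
    exact h₅ i hi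
  set B := (k + 1) * 2 ^ (k + 1) with hB
  refine .seq (.forTo_loopFree (2 ^ (k + 1)) (fun j s' => ∀ i < j, s'.cx rCRe rCIm (B + i) =
    s₆.cx rARe rAIm (B + i) * s₆.cx rBRe rBIm (B + i)) rfl (by decide)
    (fun s' hf => (r₆.frame hf (by decide) (by decide)).size.N) (by simp) ?_ hW₁) ?_
  · intro j hj s' hf hv hI i hi
    have c₁ : s'.nat vBase 0 = B := by rw [hf.nat _ (by decide), b₆]
    have c₂ : s'.real rARe = s₆.real rARe := hf.real _ (by decide)
    have c₃ : s'.real rAIm = s₆.real rAIm := hf.real _ (by decide)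
    have c₄ : s'.real rBRe = s₆.real rBRe := hf.real _ (by decide)
    have c₅ : s'.real rBIm = s₆.real rBIm := hf.real _ (by decide)
    by_cases e : i = j
    · apply Complex.ext <;> simp [Program.run, Memory.cx, hv, c₁, c₂, c₃, c₄, c₅, e]
    · rw [← hI i (by omega)]
      simp [Program.run, Memory.cx, hv, c₁, e]
  intro s₇ f₇ h₇
  have r₇ := r₆.frame f₇ (by decide) (by decide)
  have q₇ : s₇.real rOut = s.real rOut := (f₇.real _ (by decide)).trans q₆
  -- The pointwise product is the last stage of the transform of the convolution, and it already
  -- stands in the block from which `backward` starts.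
  have g₇ : ∀ i < 2 ^ (k + 1), s₇.cx rCRe rCIm (B + i) =
      FFT.stage (2 ^ k) (FFT.conv (2 ^ (k + 1)) a b) (k + 1) i := by
    intro i hi
    rw [h₇ i hi, g₆ i hi, h₆ i hi, ← FFT.stage_conv (m := m + m) (m' := m)
      (fun j hj => if_neg (by omega)) (fun j hj => if_neg (by omega)) (by omega) hi]
  refine .seq ((backward_runs pC r₇.size r₇.twiddle
    (by rw [f₇.nat _ (by decide), b₆]) g₇).mono hW₂ fun _ _ h => h) fun s₈ f₈ h₈ => ?_
  have r₈ := r₇.frame f₈ (by decide) (by decide)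
  have q₈ : s₈.real rOut = s.real rOut := (f₈.real _ (by decide)).trans q₇
  have g₈ : ∀ d < m, s₈.real rCRe (d + m - 1) =
      ∑ e ∈ Finset.range m, s.real rF (d + e) * s.real rIn (o + e) := by
    intro d hd
    have := h₈ (d + m - 1) (by omega)
    rw [FFT.conv_hankel (N := 2 ^ (k + 1)) (by omega) (s.real rF) (fun e => s.real rIn (o + e)) hd]
      at this
    exact congrArg Complex.re this
  refine RunsIn.mono (RunsIn.forTo_loopFree m (fun j s' =>
    (∀ d < j, s'.real rOut (o + d) = s₈.real rCRe (d + m - 1)) ∧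
    ∀ a, (∀ d < m, a ≠ o + d) → s'.real rOut a = s.real rOut a) rfl (by decide)
    (fun s' hf => (r₈.frame hf (by decide) (by decide)).M) ⟨by simp, by simp [q₈]⟩ ?_
    (by omega)) le_rfl fun s' _ h => ⟨fun d hd => by rw [h.1 d hd, g₈ d hd], h.2⟩
  rintro j hj s' hf hv ⟨i₁, i₂⟩
  have c := r₈.frame hf (by decide) (by decide)
  have c₁ : s'.real rCRe = s₈.real rCRe := hf.real _ (by decide)
  refine ⟨fun d hd => ?_, fun a ha => ?_⟩
  · by_cases e : d = j
    · simp [Program.run, hv, c.M, c.T, c.off, c₁, e, ← ho]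
    · rw [← i₁ d (by omega)]
      simp [Program.run, hv, c.T, c.off, e, ← ho]
  · rw [← i₂ a ha]
    have := ha j hj
    simp [Program.run, hv, c.T, c.off, ← ho, this]

end RealRAM

/-! ### Scans for labels, sizes, centroids and distances -/

namespace RealRAM

open ParentTree

/-- The number of nodes. -/
abbrev len : NExp := nat[bIn, 0]

/-- Finds the topmost node of the component of each active node. -/
def labelPass : Program :=
  forTo vI len (setVar vJ (len - 1 - var vI) ;; .ifLt nat[bRem, var vJ] 1
    (.ifLt nat[bRem, nat[bUp, var vJ]] 1
      (.setNat bTop (var vJ) nat[bTop, nat[bUp, var vJ]]) (.setNat bTop (var vJ) (var vJ))) .skip)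

/-- Counts the nodes below each active node in its component. -/
def sizePass : Program :=
  forTo vI len (.setNat bSize (var vI) 1) ;;
  forTo vI len (.ifLt nat[bRem, var vI] 1 (.ifLt nat[bRem, nat[bUp, var vI]] 1
    (.setNat bSize nat[bUp, var vI] (nat[bSize, nat[bUp, var vI]] + nat[bSize, var vI]))
    .skip) .skip)

/-- Finds the centroid of each component. -/
def centroidPass : Program :=
  forTo vI len (setVar vJ (len - 1 - var vI) ;; .ifLt nat[bRem, var vJ] 1
    (.ifLt nat[bSize, nat[bTop, var vJ]] (nat[bSize, var vJ] + nat[bSize, var vJ])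
      (.setNat bCen nat[bTop, var vJ] (var vJ)) .skip) .skip)

/-- Runs `p` if the node `vI` is the centroid of its component. -/
def ifCentroid (p : Program) : Program :=
  .ifLt nat[bRem, var vI] 1 (.ifLt nat[bCen, nat[bTop, var vI]] (var vI + 1)
    (.ifLt (var vI) (nat[bCen, nat[bTop, var vI]] + 1) p .skip) .skip) .skip

/-- Computes the distance of each active node to the centroid of its component, plus one. -/
def distPass : Program :=
  forTo vI len (.setNat bDist (var vI) 0 ;; ifCentroid (.setNat bDist (var vI) 1)) ;;
  forTo vI len (.ifLt nat[bRem, var vI] 1 (.ifLt 0 nat[bDist, var vI]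
    (.ifLt nat[bRem, nat[bUp, var vI]] 1
      (.setNat bDist nat[bUp, var vI] (nat[bDist, var vI] + 1)) .skip) .skip) .skip) ;;
  forTo vI len (setVar vJ (len - 1 - var vI) ;; .ifLt nat[bRem, var vJ] 1
    (.ifLt nat[bDist, var vJ] 1
      (.setNat bDist (var vJ) (nat[bDist, nat[bUp, var vJ]] + 1)) .skip) .skip)

/-- Removes all centroids. -/
def removePass : Program := forTo vI len (ifCentroid (.setNat bRem (var vI) 1))

/-- The tree, the vector, the values of the function and the tables are in memory. -/
structure TreeReady (P ord : ℕ → ℕ) (g x : ℕ → ℝ) (L : ℕ) (s : Memory) : Prop where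
  len : s.nat bIn 0 = L
  up : ∀ i < L, s.nat bUp i = P i
  ord : ∀ i < L, s.nat bOrd i = ord i
  off : ∀ i < L, s.nat bOff i = i * (L + 1)
  f : s.real rF = g
  x : s.real rX = x
  twiddle : TwiddleReady (8 * (L + 1)) s

theorem TreeReady.frame {P ord : ℕ → ℕ} {g x : ℕ → ℝ} {L : ℕ} {s s' : Memory} {p : Program}
    (h : TreeReady P ord g x L s) (hf : Frame p s s')
    (hn : ∀ b ∈ [bIn, bUp, bOrd, bOff], b ∉ p.natBanks)
    (hr : ∀ b ∈ [rF, rX, rTwRe, rTwIm], b ∉ p.realBanks) : TreeReady P ord g x L s' where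
  len := by rw [hf.nat _ (hn _ (by simp))]; exact h.len
  up := by rw [hf.nat _ (hn _ (by simp))]; exact h.up
  ord := by rw [hf.nat _ (hn _ (by simp))]; exact h.ord
  off := by rw [hf.nat _ (hn _ (by simp))]; exact h.off
  f := by rw [hf.real _ (hr _ (by simp))]; exact h.f
  x := by rw [hf.real _ (hr _ (by simp))]; exact h.x
  twiddle := h.twiddle.frame hf (hr _ (by simp)) (hr _ (by simp))

/-- The nodes that are not removed are those in `A`. -/
def Active (A : Finset ℕ) (L : ℕ) (s : Memory) : Prop := ∀ i ≤ L, s.nat bRem i = 0 ↔ i ∈ A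

theorem Active.frame {A : Finset ℕ} {L : ℕ} {s s' : Memory} {p : Program} (h : Active A L s)
    (hf : Frame p s s') (hn : bRem ∉ p.natBanks) : Active A L s' := by
  rw [Active, hf.nat _ hn]; exact h

section passes

variable {P ord : ℕ → ℕ} {g x : ℕ → ℝ} {L : ℕ} {A : Finset ℕ} {s : Memory}

/-- Nodes are visited in decreasing order, so the label of the parent is already known. By `hPL`
every parent index is a node or the sentinel `L`, which is covered by `Active` and never belongs to
`A`; so the root needs no special treatment. -/
theorem labelPass_runs (hP : IsParent P L) (hPL : ∀ i < L, P i ≤ L) (hA : A ⊆ Finset.range L)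
    (hs : TreeReady P ord g x L s) (ha : Active A L s) :
    RunsIn (L + 1) labelPass s fun s' => ∀ i ∈ A, s'.nat bTop i = top P L A i := by
  have hL := fun {i} (h : i ∈ A) => Finset.mem_range.1 (hA h)
  refine RunsIn.mono (RunsIn.forTo_loopFree L
    (fun m s' => ∀ i ∈ A, L - m ≤ i → s'.nat bTop i = top P L A i) rfl (by decide)
    (fun s' hf => (hs.frame hf (by decide) (by decide)).len)
    (fun i hi h => by have := hL hi; omega) ?_ le_rfl) le_rfl
    fun s' _ h i hi => h i hi (by omega)
  intro m hm s' hf hv hI i hi hmi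
  have c := hs.frame hf (by decide) (by decide)
  have a := ha.frame hf (by decide)
  have e : L - 1 - m < L := by omega
  by_cases hJ : L - 1 - m ∈ A
  · have r₁ := (a _ e.le).2 hJ
    by_cases hU : P (L - 1 - m) ∈ A
    · have r₂ := (a _ (hPL _ e)).2 hU
      by_cases hij : i = L - 1 - m
      · have := hI (P (L - 1 - m)) hU (by have := hP.lt (L - 1 - m); omega)
        rw [hij, top_of_parent_mem hP hA hU]
        simp [Program.run, hv, c.len, c.up _ e, r₁, r₂, this]
      · rw [← hI i hi (by omega)]
        simp [Program.run, hv, c.len, c.up _ e, r₁, r₂, hij]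
    · have r₂ := mt (a _ (hPL _ e)).1 hU
      by_cases hij : i = L - 1 - m
      · rw [hij, show top P L A (L - 1 - m) = L - 1 - m from rep_of_notMem hU]
        simp [Program.run, hv, c.len, c.up _ e, r₁, r₂]
      · rw [← hI i hi (by omega)]
        simp [Program.run, hv, c.len, c.up _ e, r₁, r₂, hij]
  · have r₁ := mt (a _ e.le).1 hJ
    have hij : i ≠ L - 1 - m := fun h => hJ (h ▸ hi)
    rw [← hI i hi (by omega)]
    simp [Program.run, hv, c.len, r₁]

/-- When the bound passes `m`, all climbs that wait at `m` move on to `P m` together. So one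
addition per node maintains the sizes. -/
theorem card_filter_rep_succ (hP : IsParent P L) {m v : ℕ} (hv : m < v) :
    (A.filter fun j => rep P A (m + 1) j = v).card =
      (A.filter fun j => rep P A m j = v).card +
        if m ∈ A ∧ P m ∈ A ∧ P m = v then below P A m else 0 := by
  split_ifs with h
  · rw [below, ← Finset.card_union_of_disjoint]
    · congr 1
      ext j
      simp only [Finset.mem_filter, Finset.mem_union, rep_succ hP]
      split_ifs with h'
      · rw [h'.1]
        simp only [h.2.2, and_true]
        exact ⟨fun h => .inr h, fun h => h.elim (·.1) id⟩
      · have : rep P A m j ≠ m := fun e => h' ⟨e, h.2.1⟩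
        simp [this]
    · refine Finset.disjoint_left.2 fun j h₁ h₂ => ?_
      have := (Finset.mem_filter.1 h₁).2
      have := (Finset.mem_filter.1 h₂).2
      omega
  · rw [add_zero]
    congr 1
    refine Finset.filter_congr fun j hj => ?_
    rw [rep_succ hP]
    split_ifs with h'
    · have : m ∈ A := h'.1 ▸ rep_mem hP hj
      rw [h'.1]
      exact ⟨fun e => absurd ⟨this, h'.2, e⟩ h, fun e => by omega⟩
    · rfl

theorem sizePass_runs (hP : IsParent P L) (hPL : ∀ i < L, P i ≤ L) (hA : A ⊆ Finset.range L)
    (hs : TreeReady P ord g x L s) (ha : Active A L s) :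
    RunsIn (L + 1) sizePass s fun s' => ∀ i ∈ A, s'.nat bSize i = below P A i := by
  have hL := fun {i} (h : i ∈ A) => Finset.mem_range.1 (hA h)
  refine .seq (.forTo_loopFree L (fun m s' => ∀ i < m, s'.nat bSize i = 1) rfl (by decide)
    (fun s' hf => (hs.frame hf (by decide) (by decide)).len) (by simp) ?_ le_rfl) ?_
  · intro m hm s' hf hv hI i hi
    by_cases e : i = m
    · simp [Program.run, hv, e]
    · simpa [Program.run, hv, e] using hI i (by omega)
  intro s₁ f₁ h₁
  have hs₁ := hs.frame f₁ (by decide) (by decide)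
  have ha₁ := ha.frame f₁ (by decide)
  -- The minimum expresses that the count of `v` is final as soon as the scan arrives at `v`:
  -- contributions come only from smaller nodes.
  refine RunsIn.mono (RunsIn.forTo_loopFree L
    (fun m s' => ∀ v ∈ A, s'.nat bSize v = (A.filter fun j => rep P A (min m v) j = v).card)
    rfl (by decide) (fun s' hf => (hs₁.frame hf (by decide) (by decide)).len) ?_ ?_ le_rfl) le_rfl
    fun s' _ h i hi => ?_
  · intro v hv
    have : (A.filter fun j => rep P A (min 0 v) j = v) = {v} := by
      ext j
      rw [Finset.mem_filter, Nat.zero_min, rep_of_le (Nat.zero_le j), Finset.mem_singleton]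
      exact ⟨fun h => h.2, fun h => ⟨h ▸ hv, h⟩⟩
    rw [this]
    simpa using h₁ v (hL hv)
  · intro m hm s' hf hv hI v hvA
    have c := hs₁.frame hf (by decide) (by decide)
    have a := ha₁.frame hf (by decide)
    have key : (A.filter fun j => rep P A (min (m + 1) v) j = v).card =
        s'.nat bSize v + if m ∈ A ∧ P m ∈ A ∧ P m = v then s'.nat bSize m else 0 := by
      rw [hI v hvA]
      rcases Nat.lt_or_ge m v with h | h
      · rw [min_eq_left (by omega), min_eq_left h.le, card_filter_rep_succ hP h]
        split_ifs with h'
        · rw [hI m h'.1, min_self]; rfl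
        · rfl
      · rw [min_eq_right (by omega), min_eq_right h, if_neg, add_zero]
        have := hP.lt m
        rintro ⟨-, -, e⟩; omega
    rw [key]
    by_cases hJ : m ∈ A
    · have r₁ := (a m hm.le).2 hJ
      by_cases hU : P m ∈ A
      · have r₂ := (a _ (hPL m hm)).2 hU
        by_cases e : P m = v
        · simp [Program.run, hv, c.up m hm, r₁, e, hJ, hvA, (e ▸ r₂ : s'.nat bRem v = 0)]
        · simp [Program.run, hv, c.up m hm, r₁, r₂, e, Ne.symm e]
      · have r₂ := mt (a _ (hPL m hm)).1 hU
        simp [Program.run, hv, c.up m hm, r₁, r₂, hU]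
    · have r₁ := mt (a m hm.le).1 hJ
      simp [Program.run, hv, r₁, hJ]
  · rw [h i hi, min_eq_right (hL hi).le]; rfl

/-- The centroids of the components are in memory. -/
def CentroidReady (P : ℕ → ℕ) (L : ℕ) (A : Finset ℕ) (s : Memory) : Prop :=
  ∀ i ∈ A, s.nat bTop i = top P L A i ∧ s.nat bCen (top P L A i) = centroid P L A i

theorem CentroidReady.frame {s s' : Memory} {p : Program} (h : CentroidReady P L A s)
    (hf : Frame p s s') (h₁ : bTop ∉ p.natBanks) (h₂ : bCen ∉ p.natBanks) :
    CentroidReady P L A s' := by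
  rw [CentroidReady, hf.nat _ h₁, hf.nat _ h₂]; exact h

theorem centroidPass_runs (hP : IsParent P L) (hA : A ⊆ Finset.range L)
    (hs : TreeReady P ord g x L s) (ha : Active A L s)
    (ht : ∀ i ∈ A, s.nat bTop i = top P L A i) (hz : ∀ i ∈ A, s.nat bSize i = below P A i) :
    RunsIn (L + 1) centroidPass s (CentroidReady P L A) := by
  have hL := fun {i} (h : i ∈ A) => Finset.mem_range.1 (hA h)
  -- The scan is decreasing and each candidate overwrites the previous one. So once a candidate `v`
  -- has been visited, the cell of its component holds a candidate that is at most `v`.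
  refine RunsIn.mono (RunsIn.forTo_loopFree L (fun m s' => ∀ v ∈ A,
      below P A (top P L A v) < 2 * below P A v → L - m ≤ v →
      s'.nat bCen (top P L A v) ∈ A ∧
      top P L A (s'.nat bCen (top P L A v)) = top P L A v ∧
      below P A (top P L A v) < 2 * below P A (s'.nat bCen (top P L A v)) ∧
      L - m ≤ s'.nat bCen (top P L A v) ∧ s'.nat bCen (top P L A v) ≤ v) rfl (by decide)
    (fun s' hf => (hs.frame hf (by decide) (by decide)).len)
    (fun i hi _ h => by have := hL hi; omega) ?_ le_rfl) le_rfl ?_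
  · intro m hm s' hf hv hI v hvA hvH hmv
    have c := hs.frame hf (by decide) (by decide)
    have a := ha.frame hf (by decide)
    have e : L - 1 - m < L := by omega
    have e' : L - (m + 1) = L - 1 - m := by omega
    have t' : s'.nat bTop = s.nat bTop := hf.nat _ (by decide)
    have z' : s'.nat bSize = s.nat bSize := hf.nat _ (by decide)
    rw [e'] at hmv ⊢
    generalize hJ : L - 1 - m = J at *
    have hIv := fun h => hI v hvA hvH h
    by_cases hJA : J ∈ A
    · have r₁ := (a _ e.le).2 hJA
      have tJ := ht J hJA
      have zJ := hz J hJA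
      have zT := hz _ (rep_mem hP hJA : top P L A J ∈ A)
      by_cases hH : below P A (top P L A J) < below P A J + below P A J
      · by_cases hT : top P L A v = top P L A J
        · simp only [Program.run, hv, c.len, t', z', hT, hJ, NExp.eval_get, NExp.eval_sub,
             NExp.eval_add, NExp.eval_ofNat, Memory.writeNat_nat]
          simp [r₁, tJ, zJ, zT, hH, hJA]
          omega
        · have hne : v ≠ J := fun h => hT (h ▸ rfl)
          have := hIv (by omega)
          simp [Program.run, hv, c.len, r₁, t', z', tJ, zJ, zT, hH, hT, hJ]
          refine ⟨this.1, this.2.1, this.2.2.1, by omega, this.2.2.2.2⟩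
      · have hne : v ≠ J := by rintro rfl; omega
        have := hIv (by omega)
        simp [Program.run, hv, c.len, r₁, t', z', tJ, zJ, zT, hH, hJ]
        refine ⟨this.1, this.2.1, this.2.2.1, by omega, this.2.2.2.2⟩
    · have r₁ := mt (a _ e.le).1 hJA
      have hne : v ≠ J := fun h => hJA (h ▸ hvA)
      have := hIv (by omega)
      simp [Program.run, hv, c.len, r₁, hJ]
      refine ⟨this.1, this.2.1, this.2.2.1, by omega, this.2.2.2.2⟩
  · intro s' hf h i hi
    refine ⟨by rw [hf.nat _ (by decide)]; exact ht i hi, ?_⟩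
    obtain ⟨c₁, c₂, c₃⟩ := centroid_spec hP hi (L := L)
    -- Applied to the centroid itself, the invariant gives a candidate that is at most the least
    -- candidate.
    obtain ⟨d₁, d₂, d₃, -, d₅⟩ := h _ c₁ (by rw [c₂]; exact c₃) (by omega)
    rw [c₂] at d₁ d₂ d₃ d₅
    exact le_antisymm d₅ (Nat.sInf_le ⟨d₁, d₂, d₃⟩)

/-- Equality with the centroid is tested by two strict inequalities. Only the flag of the node `i`
itself is assumed to be that of `A`, because `removePass` changes the flags of smaller nodes before
it reaches `i`. -/
theorem ifCentroid_run {p : Program} {i : ℕ} (ha : s.nat bRem i = 0 ↔ i ∈ A)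
    (hc : CentroidReady P L A s) (hv : s.nat vI 0 = i) : (ifCentroid p).run s =
      if i ∈ A ∧ centroid P L A i = i then p.run s else s := by
  by_cases h : i ∈ A
  · have r₁ := ha.2 h
    obtain ⟨t, c⟩ := hc i h
    by_cases h' : centroid P L A i = i
    · simp [ifCentroid, Program.run, hv, r₁, t, c, h, h']
    · by_cases h₁ : centroid P L A i < i + 1
      · have h₂ : ¬ i < centroid P L A i + 1 := by omega
        simp [ifCentroid, Program.run, hv, r₁, t, c, h', h₁, h₂]
      · simp [ifCentroid, Program.run, hv, r₁, t, c, h', h₁]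
  · have r₁ := mt ha.1 h
    simp [ifCentroid, Program.run, hv, r₁, h]

theorem removePass_runs (hA : A ⊆ Finset.range L) (hs : TreeReady P ord g x L s)
    (ha : Active A L s) (hc : CentroidReady P L A s) :
    RunsIn (L + 1) removePass s (Active (next P L A) L) := by
  have hL := fun {i} (h : i ∈ A) => Finset.mem_range.1 (hA h)
  refine RunsIn.mono (RunsIn.forTo_loopFree L (fun m s' =>
      Active (A.filter fun i => i < m → centroid P L A i ≠ i) L s') rfl (by decide)
    (fun s' hf => (hs.frame hf (by decide) (by decide)).len) ?_ ?_ le_rfl) le_rfl ?_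
  · intro i hi; simpa using ha i hi
  · intro m hm s' hf hv hI i hi
    have c := hc.frame hf (by decide) (by decide)
    have e : s'.nat bRem m = 0 ↔ m ∈ A := by simpa using hI m hm.le
    have hI' := hI i hi
    rw [ifCentroid_run e c hv]
    rw [Finset.mem_filter] at hI' ⊢
    by_cases him : i = m
    · subst him
      by_cases h : i ∈ A ∧ centroid P L A i = i
      · rw [if_pos h]
        simp [Program.run, hv, h.2]
      · rw [if_neg h]
        simp only [Memory.writeNat_nat, show ((bRem : ℕ) = vI) = False by simp, false_and, if_false,
          e]
        exact ⟨fun h' => ⟨h', fun _ h'' => h ⟨h', h''⟩⟩, fun h' => h'.1⟩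
    · have : (i < m + 1) ↔ i < m := by omega
      rw [this, ← hI']
      split_ifs <;> simp [Program.run, hv, him]
  · intro s' hf h i hi
    rw [h i hi, next, Finset.mem_filter, Finset.mem_filter]
    exact ⟨fun h => ⟨h.1, h.2 (hL h.1)⟩, fun h => ⟨h.1, fun _ => h.2⟩⟩

/-- The nodes `rep P A r c` with `r ≤ m` are those on the climb from `c` that the upward sweep has
discovered after `m` steps. Step `m` discovers at most `P m`. -/
theorem exists_rep_eq_succ (hP : IsParent P L) {m c v : ℕ} :
    (∃ r ≤ m + 1, rep P A r c = v) ↔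
      (∃ r ≤ m, rep P A r c = v) ∨ (rep P A m c = m ∧ P m ∈ A ∧ P m = v) := by
  constructor
  · rintro ⟨r, hr, h⟩
    rcases Nat.lt_or_ge m r with h' | h'
    · obtain rfl : r = m + 1 := by omega
      rw [rep_succ hP] at h
      split_ifs at h with h₁
      · exact .inr ⟨h₁.1, h₁.2, h⟩
      · exact .inl ⟨m, le_rfl, h⟩
    · exact .inl ⟨r, h', h⟩
  · rintro (⟨r, hr, h⟩ | ⟨h₁, h₂, h₃⟩)
    · exact ⟨r, by omega, h⟩
    · exact ⟨m + 1, le_rfl, by rw [rep_succ hP, if_pos ⟨h₁, h₂⟩, h₃]⟩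

theorem exists_rep_eq_iff (hP : IsParent P L) {m c v : ℕ} (h : v ≤ m) :
    (∃ r ≤ m, rep P A r c = v) ↔ rep P A v c = v := by
  refine ⟨?_, fun h' => ⟨v, h, h'⟩⟩
  rintro ⟨r, -, h'⟩
  rcases Nat.le_total r v with hr | hr
  · rw [← rep_rep hP hr, h', rep_of_le le_rfl]
  · rw [← rep_rep hP hr] at h'
    rcases rep_stop hP (A := A) v c with h₁ | h₁
    · have := le_rep hP (A := A) r (rep P A v c)
      omega
    · rwa [rep_of_notMem h₁] at h'

/-- Distances spread from the centroid upwards along its climb, and from there downwards to all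
other nodes of the component. They are stored with one added, so that `0` can mark nodes not yet
reached. -/
theorem distPass_runs (hP : IsParent P L) (hPL : ∀ i < L, P i ≤ L) (hA : A ⊆ Finset.range L)
    (hs : TreeReady P ord g x L s) (ha : Active A L s) (hc : CentroidReady P L A s) :
    RunsIn (L + 1) distPass s fun s' =>
      ∀ i ∈ A, s'.nat bDist i = dist P L i (centroid P L A i) + 1 := by
  classical
  have hL := fun {i} (h : i ∈ A) => Finset.mem_range.1 (hA h)
  refine .seq (.forTo_loopFree L (fun m s' => ∀ i < m, s'.nat bDist i =
    if i ∈ A ∧ centroid P L A i = i then 1 else 0) rfl (by decide)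
    (fun s' hf => (hs.frame hf (by decide) (by decide)).len) (by simp) ?_ le_rfl) ?_
  · intro m hm s' hf hv hI i hi
    have c := hc.frame hf (by decide) (by decide)
    have a := (ha.frame hf (by decide)) m hm.le
    rw [Program.run, ifCentroid_run (i := m) (A := A) (P := P) (L := L)
      (by simpa [Program.run] using a) (by simpa [CentroidReady, Program.run] using c)
      (by simp [Program.run, hv])]
    by_cases him : i = m
    · subst him
      split_ifs <;> simp [Program.run, hv]
    · have := hI i (by omega)
      split_ifs at this ⊢ <;> simp [Program.run, hv, him, this]
  intro s₁ f₁ h₁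
  have hs₁ := hs.frame f₁ (by decide) (by decide)
  have ha₁ := ha.frame f₁ (by decide)
  -- Upward sweep: exactly the nodes discovered so far on the climb from the centroid carry their
  -- distance.
  refine .seq (.forTo_loopFree L (fun m s' => ∀ v ∈ A, s'.nat bDist v =
    if ∃ r ≤ m, rep P A r (centroid P L A v) = v then dist P L v (centroid P L A v) + 1 else 0)
    rfl (by decide) (fun s' hf => (hs₁.frame hf (by decide) (by decide)).len) ?_ ?_ le_rfl) ?_
  · intro v hv
    have e : (∃ r ≤ 0, rep P A r (centroid P L A v) = v) ↔ centroid P L A v = v := by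
      constructor
      · rintro ⟨r, hr, h⟩
        rwa [rep_of_le (by omega)] at h
      · exact fun h => ⟨0, le_rfl, by rw [rep_of_le (Nat.zero_le _), h]⟩
    simp only [e]
    have := h₁ v (hL hv)
    simp only [hv, true_and] at this
    rw [Memory.writeNat_nat, if_neg (by simp), this]
    split_ifs with h
    · rw [h, dist_self]
    · rfl
  · intro m hm s' hf hv hI v hvA
    have c := hs₁.frame hf (by decide) (by decide)
    have a := ha₁.frame hf (by decide)
    simp only [exists_rep_eq_succ hP]
    by_cases hmA : m ∈ A
    · have r₁ := (a m hm.le).2 hmA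
      have hIm := hI m hmA
      rw [if_congr (exists_rep_eq_iff hP le_rfl) rfl rfl] at hIm
      by_cases hU : P m ∈ A
      · have r₂ := (a _ (hPL m hm)).2 hU
        have hcm : centroid P L A (P m) = centroid P L A m :=
          (centroid_congr (top_of_parent_mem hP hA hU)).symm
        by_cases hR : rep P A m (centroid P L A m) = m
        · rw [if_pos hR] at hIm
          by_cases e : P m = v
          · subst e
            rw [if_pos (.inr ⟨by rw [hcm, hR], hU, rfl⟩), hcm, dist_succ_of_rep_eq hP hA
              (centroid_spec hP hmA).1 hU hR]
            simp [Program.run, hv, c.up m hm, r₁, r₂, hIm]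
          · have := hI v hvA
            simp only [e, and_false, or_false]
            rw [← this]
            simp [Program.run, hv, c.up m hm, r₁, r₂, hIm, Ne.symm e]
        · rw [if_neg hR] at hIm
          have : ¬ (rep P A m (centroid P L A v) = m ∧ P m ∈ A ∧ P m = v) := by
            rintro ⟨h, -, rfl⟩
            exact hR (hcm ▸ h)
          simp only [this, or_false]
          rw [← hI v hvA]
          simp [Program.run, hv, r₁, hIm]
      · have r₂ := mt (a _ (hPL m hm)).1 hU
        simp only [hU, false_and, and_false, or_false]
        rw [← hI v hvA]
        by_cases h0 : s'.nat bDist m = 0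
        · simp [Program.run, hv, r₁, h0]
        · simp [Program.run, hv, c.up m hm, r₁, r₂, Nat.pos_of_ne_zero h0]
    · have r₁ := mt (a m hm.le).1 hmA
      have : rep P A m (centroid P L A v) ≠ m :=
        fun h => hmA (h ▸ rep_mem hP (centroid_spec hP hvA).1)
      simp only [this, false_and, or_false]
      rw [← hI v hvA]
      simp [Program.run, hv, r₁]
  intro s₂ f₂ h₂
  have hs₂ := hs₁.frame f₂ (by decide) (by decide)
  have ha₂ := ha₁.frame f₂ (by decide)
  have h₂' : ∀ v ∈ A, s₂.nat bDist v = if rep P A v (centroid P L A v) = v then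
      dist P L v (centroid P L A v) + 1 else 0 := by
    intro v hv
    rw [h₂ v hv, if_congr (exists_rep_eq_iff hP (hL hv).le) rfl rfl]
  -- Downward sweep: all visited nodes carry their distance. An unmarked node has an active parent,
  -- which was visited before it.
  refine RunsIn.mono (RunsIn.forTo_loopFree L (fun m s' => ∀ v ∈ A, s'.nat bDist v =
    if L - m ≤ v ∨ rep P A v (centroid P L A v) = v then dist P L v (centroid P L A v) + 1 else 0)
    rfl (by decide) (fun s' hf => (hs₂.frame hf (by decide) (by decide)).len) ?_ ?_ le_rfl) le_rfl
    fun s' _ h i hi => by rw [h i hi, if_pos (.inl (by omega))]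
  · intro v hv
    have : ¬ L - 0 ≤ v := by have := hL hv; omega
    simp only [this, false_or]
    simpa using h₂' v hv
  · intro m hm s' hf hv hI v hvA
    have c := hs₂.frame hf (by decide) (by decide)
    have a := ha₂.frame hf (by decide)
    have e : L - 1 - m < L := by omega
    have e' : L - (m + 1) = L - 1 - m := by omega
    have e'' : L - m = L - 1 - m + 1 := by omega
    rw [e']
    rw [e''] at hI
    generalize hJ : L - 1 - m = J at *
    have hle : J ≤ v ↔ J + 1 ≤ v ∨ v = J := by omega
    by_cases hJA : J ∈ A
    · have r₁ := (a J e.le).2 hJA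
      have hIJ := hI J hJA
      by_cases hR : rep P A J (centroid P L A J) = J
      · rw [if_pos (.inr hR)] at hIJ
        have : (J ≤ v ∨ rep P A v (centroid P L A v) = v) ↔
            (J + 1 ≤ v ∨ rep P A v (centroid P L A v) = v) := by
          rw [hle]
          constructor
          · rintro ((h | rfl) | h)
            · exact .inl h
            · exact .inr hR
            · exact .inr h
          · exact fun h => h.elim (fun h => .inl (.inl h)) .inr
        rw [if_congr this rfl rfl, ← hI v hvA]
        simp [Program.run, hv, c.len, r₁, hJ, hIJ]
      · rw [if_neg (by simp [hR])] at hIJ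
        obtain ⟨c₁, c₂, -⟩ := centroid_spec hP hJA (L := L)
        obtain ⟨hU, hd⟩ := dist_eq_succ_of_rep_ne hP hA c₁ hJA c₂.symm hR
        by_cases hvJ : v = J
        · subst hvJ
          have := hI _ hU
          rw [if_pos (.inl (hP.lt v)), ← centroid_congr (top_of_parent_mem hP hA hU)] at this
          rw [if_pos (.inl le_rfl), hd]
          simp [Program.run, hv, c.len, c.up v e, r₁, hJ, hIJ, this]
        · simp only [hle, hvJ, or_false]
          rw [← hI v hvA]
          simp [Program.run, hv, c.len, r₁, hJ, hIJ, hvJ]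
    · have r₁ := mt (a J e.le).1 hJA
      have hvJ : v ≠ J := fun h => hJA (h ▸ hvA)
      simp only [hle, hvJ, or_false]
      rw [← hI v hvA]
      simp [Program.run, hv, c.len, r₁, hJ]

end passes

end RealRAM

/-! ### Interactions within the components -/

namespace RealRAM

open ParentTree

/-- Runs `p` for all nodes `vT` that are topmost in their component. -/
def forTops (p : Program) : Program :=
  forTo vT len (.ifLt nat[bRem, var vT] 1 (.ifLt nat[bTop, var vT] (var vT + 1) p .skip) .skip)

/-- Sets the blocks of `rIn` to zero. -/
def clearPass : Program :=
  forTops (setVar vM (nat[bSize, var vT] + 1) ;;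
    forTo vE (var vM) (.setReal rIn (nat[bOff, var vT] + var vE) (.lit 0)))

/-- The cell that belongs to the component and the distance of the node `vI`. -/
abbrev bucket : NExp := nat[bOff, nat[bTop, var vI]] + (nat[bDist, var vI] - 1)

/-- Adds up the entries of the vector with the same component and distance. -/
def gatherPass : Program :=
  forTo vI len (.ifLt nat[bRem, var vI] 1
    (.setReal rIn bucket (real[rIn, bucket] + real[rX, nat[bOrd, var vI]])) .skip)

/-- Multiplies the blocks by Hankel matrices. -/
def blockPass : Program := forTops (setVar vM (nat[bSize, var vT] + 1) ;; hankelBlock)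

/-- Adds `q` times the entries of the blocks to the result. -/
def scatterPass (q : ℚ) : Program :=
  forTo vI len (.ifLt nat[bRem, var vI] 1 (.setReal rY nat[bOrd, var vI]
    (real[rY, nat[bOrd, var vI]] + .lit q * real[rOut, bucket])) .skip)

/-- Adds `q` times the sum of the interactions within each component to the result. -/
def interactionPass (q : ℚ) : Program := clearPass ;; gatherPass ;; blockPass ;; scatterPass q

/-- The components of `A` with their sizes, and the distances `d`, are in memory. -/
structure GroupReady (P : ℕ → ℕ) (L : ℕ) (A : Finset ℕ) (d : ℕ → ℕ) (s : Memory) : Prop where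
  top : ∀ i ∈ A, s.nat bTop i = top P L A i
  size : ∀ i ∈ A, s.nat bSize i = below P A i
  dist : ∀ i ∈ A, s.nat bDist i = d i + 1

theorem GroupReady.frame {P : ℕ → ℕ} {L : ℕ} {A : Finset ℕ} {d : ℕ → ℕ} {s s' : Memory}
    {p : Program} (h : GroupReady P L A d s) (hf : Frame p s s')
    (hn : ∀ b ∈ [bTop, bSize, bDist], b ∉ p.natBanks) : GroupReady P L A d s' where
  top := by rw [hf.nat _ (hn _ (by simp))]; exact h.top
  size := by rw [hf.nat _ (hn _ (by simp))]; exact h.size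
  dist := by rw [hf.nat _ (hn _ (by simp))]; exact h.dist

/-- The cost factor of a pass of interactions on `L` nodes. -/
def interactionCost (L : ℕ) : ℕ := (Nat.log 2 (8 * (L + 1)) + 3) * (16 * (L + 1))

theorem le_interactionCost (L : ℕ) : L + 1 ≤ interactionCost L := by
  rw [interactionCost, ← mul_assoc]
  exact Nat.le_mul_of_pos_left _ (by omega)

section interactions

variable {P ord : ℕ → ℕ} {g x : ℕ → ℝ} {L : ℕ} {A : Finset ℕ} {d : ℕ → ℕ} {s : Memory}

/-- A topmost node is one whose label does not exceed it, since labels are never smaller than the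
node. Only these nodes cost `w t`; all others cost one unit. -/
theorem RunsIn.forTops {p : Program} {W : ℕ} (w : ℕ → ℕ) (I : ℕ → Memory → Prop)
    (hP : IsParent P L) (hA : A ⊆ Finset.range L) (hs : TreeReady P ord g x L s)
    (ha : Active A L s) (hd : GroupReady P L A d s)
    (hn : ∀ b ∈ [vT, bIn, bRem, bTop], b ∉ p.natBanks) (h0 : I 0 (s.writeNat vT 0 0))
    (hstep : ∀ t ∈ A, P t ∉ A → ∀ s', Frame (RealRAM.forTops p) s s' → s'.nat vT 0 = t → I t s' →
      RunsIn (w t) p s' fun s'' => I (t + 1) (s''.writeNat vT 0 (t + 1)))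
    (hskip : ∀ t < L, ¬ (t ∈ A ∧ P t ∉ A) → ∀ s', I t s' → I (t + 1) (s'.writeNat vT 0 (t + 1)))
    (hw : ∀ t, 1 ≤ w t) (hW' : L + 1 ≤ W)
    (hW : ∑ t ∈ Finset.range L, (if t ∈ A ∧ P t ∉ A then w t else 1) ≤ W) :
    RunsIn W (RealRAM.forTops p) s (I L) := by
  have hL := fun {i} (h : i ∈ A) => Finset.mem_range.1 (hA h)
  have hn' : ∀ b ∈ [bIn, bRem, bTop], b ∉ (RealRAM.forTops p).natBanks := by
    intro b hb
    have := hn b (by simp at hb ⊢; omega)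
    have h₁ : b ≠ vT := by simp at hb; omega
    simp [RealRAM.forTops, RealRAM.forTo, Program.natBanks, this, h₁]
  refine .forTo_sum L _ I ?_ ?_ h0 ?_ hW hW'
  · simpa [Program.natBanks] using hn vT (by simp)
  · intro s' hf
    simp only [NExp.eval_get, NExp.eval_ofNat]
    rw [hf.nat _ (hn' _ (by simp))]; exact hs.len
  · intro t ht s' hf hv hI
    have a := ha t ht.le
    rw [← hf.nat _ (hn' _ (by simp))] at a
    have top' : t ∈ A → s'.nat bTop t = top P L A t := by
      rw [hf.nat _ (hn' _ (by simp))]; exact hd.top t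
    have hW₁ : 1 ≤ if t ∈ A ∧ P t ∉ A then w t else 1 := by
      split_ifs
      · exact hw t
      · exact le_rfl
    refine .ifLt hW₁ (fun h => ?_) (fun h => .loopFree rfl ?_ hW₁)
    · simp [hv, a] at h
      refine .ifLt hW₁ (fun h' => ?_) (fun h' => .loopFree rfl ?_ hW₁)
      · simp [hv, top' h] at h'
        have h₁ : t ≤ top P L A t := le_rep hP L t
        have h₂ := (top_eq_self_iff hP hA (j := t)).1 (by omega)
        rw [if_pos ⟨h, h₂⟩]
        exact hstep t h h₂ s' hf hv hI
      · simp [hv, top' h] at h'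
        refine hskip t ht (fun h₁ => ?_) s' hI
        have := (top_eq_self_iff hP hA (j := t)).2 h₁.2
        omega
    · simp [hv, a] at h
      exact hskip t ht (fun h₁ => h h₁.1) s' hI

theorem below_le (hA : A ⊆ Finset.range L) (t : ℕ) : below P A t ≤ L := by
  have := (Finset.card_le_card (Finset.filter_subset (fun j => rep P A t j = t) A)).trans
    (Finset.card_le_card hA)
  rwa [Finset.card_range] at this

theorem one_le_below {t : ℕ} (ht : t ∈ A) : 1 ≤ below P A t :=
  Finset.card_pos.2 ⟨t, Finset.mem_filter.2 ⟨ht, rep_of_le le_rfl⟩⟩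

/-- The components partition `A`, and the number of nodes below a topmost node is the size of its
component. -/
theorem sum_below_le (hP : IsParent P L) (hA : A ⊆ Finset.range L) :
    ∑ t ∈ Finset.range L, (if t ∈ A ∧ P t ∉ A then below P A t else 0) ≤ L := by
  have h : ∀ j ∈ A, top P L A j ∈ Finset.range L := fun j hj => hA (rep_mem hP hj)
  have h₁ := Finset.card_eq_sum_card_fiberwise h
  have h₂ := Finset.card_le_card hA
  rw [Finset.card_range, h₁] at h₂
  refine le_trans (Finset.sum_le_sum fun t ht => ?_) h₂
  split_ifs with h
  · rw [below_eq_card_comp hP (Finset.mem_range.1 ht) h.2, comp]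
  · exact Nat.zero_le _

theorem sum_weight_le (hP : IsParent P L) (hA : A ⊆ Finset.range L) :
    ∑ t ∈ Finset.range L, (if t ∈ A ∧ P t ∉ A then
      (Nat.log 2 (8 * (below P A t + 1)) + 2) * (8 * (below P A t + 1)) else 1) ≤
      interactionCost L := by
  set K := Nat.log 2 (8 * (L + 1)) with hK
  have : ∀ t ∈ Finset.range L, (if t ∈ A ∧ P t ∉ A then
      (Nat.log 2 (8 * (below P A t + 1)) + 2) * (8 * (below P A t + 1)) else 1) ≤
      (K + 2) * 16 * (if t ∈ A ∧ P t ∉ A then below P A t else 0) + 1 := by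
    intro t ht
    split_ifs with h
    · have h₁ := below_le (P := P) hA t
      have h₂ := one_le_below (P := P) h.1
      have h₃ : Nat.log 2 (8 * (below P A t + 1)) ≤ K := Nat.log_mono_right (by omega)
      -- A component is nonempty, so one more than its size is at most twice its size. The logarithm
      -- is bounded by that of the largest possible block.
      calc _ ≤ (K + 2) * (16 * below P A t) := Nat.mul_le_mul (by omega) (by omega)
        _ ≤ _ := by rw [mul_assoc]; omega
    · omega
  refine (Finset.sum_le_sum this).trans ?_
  rw [Finset.sum_add_distrib, ← Finset.mul_sum, Finset.sum_const, Finset.card_range, smul_eq_mul,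
    interactionCost, ← hK]
  have := Nat.mul_le_mul_left ((K + 2) * 16) (sum_below_le hP hA)
  nlinarith

/-- Blocks with distance `L + 1` between their starts do not overlap, as the offsets within a block
are at most `L`. -/
theorem block_inj {t t' e e' : ℕ} (he : e < L + 1) (he' : e' < L + 1)
    (h : t * (L + 1) + e = t' * (L + 1) + e') : t = t' ∧ e = e' := by
  have h₁ : t = t' := by
    rw [mul_comm t, mul_comm t'] at h
    simpa [Nat.mul_add_div, Nat.div_eq_of_lt he, Nat.div_eq_of_lt he'] using
      congrArg (· / (L + 1)) h
  subst h₁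
  exact ⟨rfl, by omega⟩

theorem clearPass_runs (hP : IsParent P L) (hA : A ⊆ Finset.range L)
    (hs : TreeReady P ord g x L s) (ha : Active A L s) (hd : GroupReady P L A d s) :
    RunsIn (interactionCost L) clearPass s fun s' => ∀ t ∈ A, P t ∉ A → ∀ e ≤ below P A t,
      s'.real rIn (t * (L + 1) + e) = 0 := by
  have hL := fun {i} (h : i ∈ A) => Finset.mem_range.1 (hA h)
  refine RunsIn.mono (RunsIn.forTops
    (fun t => (Nat.log 2 (8 * (below P A t + 1)) + 2) * (8 * (below P A t + 1)))
    (fun m s' => ∀ t ∈ A, P t ∉ A → t < m → ∀ e ≤ below P A t,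
      s'.real rIn (t * (L + 1) + e) = 0) hP hA hs ha hd (by decide) (by simp) ?_ ?_
    (fun t => Nat.mul_pos (by omega) (by omega)) (le_interactionCost L) (sum_weight_le hP hA))
    le_rfl fun s' _ h t ht ht' => h t ht ht' (hL ht)
  · intro t ht ht' s' hf hv hI
    have c := hs.frame hf (by decide) (by decide)
    have hd' := hd.frame hf (by decide)
    have hW : below P A t + 2 ≤
        (Nat.log 2 (8 * (below P A t + 1)) + 2) * (8 * (below P A t + 1)) :=
      le_trans (by omega) (Nat.le_mul_of_pos_left _ (by omega))
    refine .seq (Q₁ := fun s₁ => s₁.nat vM 0 = below P A t + 1) (.loopFree rfl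
      (by simp [Program.run, hv, hd'.size t ht]) (by omega)) fun s₁ f₁ h₁ => ?_
    have c₁ := c.frame f₁ (by decide) (by decide)
    have v₁ : s₁.nat vT 0 = t := by rw [f₁.nat _ (by decide), hv]
    have q₁ : s₁.real rIn = s'.real rIn := f₁.real _ (by decide)
    -- Only zeros are written, so cells that are zero stay zero, and disjointness of the blocks is
    -- not needed here.
    refine RunsIn.mono (RunsIn.forTo_loopFree (below P A t + 1) (fun j s₂ =>
      (∀ e < j, s₂.real rIn (t * (L + 1) + e) = 0) ∧
        ∀ a, s'.real rIn a = 0 → s₂.real rIn a = 0) rfl (by decide)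
      (fun s₂ hf => by
        simp only [NExp.eval_get, NExp.eval_ofNat]
        rw [hf.nat _ (by decide), h₁]) ⟨by simp, by simp [q₁]⟩ ?_ hW) le_rfl ?_
    · rintro j hj s₂ f₂ hv₂ ⟨i₁, i₂⟩
      have c₂ := c₁.frame f₂ (by decide) (by decide)
      have v₂ : s₂.nat vT 0 = t := by rw [f₂.nat _ (by decide), v₁]
      refine ⟨fun e he => ?_, fun a ha => ?_⟩
      · by_cases hej : e = j
        · simp [Program.run, v₂, hv₂, c₂.off t (hL ht), hej]
        · simpa [Program.run, v₂, hv₂, c₂.off t (hL ht), hej] using i₁ e (by omega)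
      · simp only [Program.run, Memory.writeNat_real, Memory.writeReal_real, RExp.eval_lit]
        split_ifs
        · simp
        · exact i₂ a ha
    · rintro s₂ _ ⟨i₁, i₂⟩ t' ht₁ ht₂ ht₃ e he
      rcases Nat.lt_succ_iff_lt_or_eq.1 ht₃ with h | rfl
      · exact i₂ _ (hI t' ht₁ ht₂ h e he)
      · exact i₁ e (by omega)
  · intro t ht hn s' hI t' ht₁ ht₂ ht₃ e he
    rcases Nat.lt_succ_iff_lt_or_eq.1 ht₃ with h | rfl
    · exact hI t' ht₁ ht₂ h e he
    · exact absurd ⟨ht₁, ht₂⟩ hn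

theorem gatherPass_runs (hP : IsParent P L) (hA : A ⊆ Finset.range L)
    (hs : TreeReady P ord g x L s) (ha : Active A L s) (hd : GroupReady P L A d s)
    (hdle : ∀ i ∈ A, d i ≤ below P A (top P L A i))
    (h0 : ∀ t ∈ A, P t ∉ A → ∀ e ≤ below P A t, s.real rIn (t * (L + 1) + e) = 0) :
    RunsIn (L + 1) gatherPass s fun s' => ∀ t ∈ A, P t ∉ A → ∀ e ≤ below P A t,
      s'.real rIn (t * (L + 1) + e) =
        ∑ j ∈ A.filter (fun j => top P L A j = t ∧ d j = e), x (ord j) := by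
  have hL := fun {i} (h : i ∈ A) => Finset.mem_range.1 (hA h)
  refine RunsIn.mono (RunsIn.forTo_loopFree L (fun m s' => ∀ t ∈ A, P t ∉ A → ∀ e ≤ below P A t,
      s'.real rIn (t * (L + 1) + e) =
        ∑ j ∈ A.filter (fun j => top P L A j = t ∧ d j = e), if j < m then x (ord j) else 0)
    rfl (by decide) (fun s' hf => (hs.frame hf (by decide) (by decide)).len)
    (by simpa using h0) ?_ le_rfl) le_rfl ?_
  · intro m hm s' hf hv hI t ht ht' e he
    have c := hs.frame hf (by decide) (by decide)
    have a := ha.frame hf (by decide)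
    have hd' := hd.frame hf (by decide)
    have key : ∀ j, (if j < m + 1 then x (ord j) else 0) =
        (if j < m then x (ord j) else 0) + if j = m then x (ord m) else 0 := by
      intro j
      by_cases h₁ : j < m
      · rw [if_pos h₁, if_pos (by omega), if_neg (by omega), add_zero]
      · by_cases h₂ : j = m
        · rw [if_neg h₁, if_pos (by omega), if_pos h₂, h₂, zero_add]
        · rw [if_neg h₁, if_neg (by omega), if_neg h₂, add_zero]
    simp only [key]
    rw [Finset.sum_add_distrib, ← hI t ht ht' e he, Finset.sum_ite_eq']
    simp only [Finset.mem_filter]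
    by_cases hmA : m ∈ A
    · have r₁ := (a m hm.le).2 hmA
      have htop := rep_mem hP (m := L) hmA
      have hb := below_le (P := P) hA
      -- The cell determines component and distance, so the entry of the node `m` is added to one
      -- cell only.
      have hiff : (t * (L + 1) + e = top P L A m * (L + 1) + d m) ↔
          (top P L A m = t ∧ d m = e) := by
        refine ⟨fun h => ?_, fun h => by rw [h.1, h.2]⟩
        have := block_inj (by have := hb t; omega)
          (by have := hdle m hmA; have := hb (top P L A m); omega) h
        exact ⟨this.1.symm, this.2.symm⟩
      by_cases h : top P L A m = t ∧ d m = e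
      · rw [if_pos ⟨hmA, h⟩]
        simp [Program.run, hv, r₁, hd'.top m hmA, hd'.dist m hmA, c.ord m hm, c.x,
          h.1, h.2, c.off _ (hL ht)]
      · rw [if_neg (fun h' => h h'.2), add_zero]
        simp [Program.run, hv, r₁, hd'.top m hmA, hd'.dist m hmA, c.off _ (hL htop), c.ord m hm, c.x,
          hiff, h]
    · have r₁ := mt (a m hm.le).1 hmA
      simp [Program.run, hv, r₁, hmA]
  · intro s' _ h t ht ht' e he
    rw [h t ht ht' e he]
    refine Finset.sum_congr rfl fun j hj => if_pos (hL (Finset.mem_filter.1 hj).1)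

theorem blockPass_runs (hP : IsParent P L) (hA : A ⊆ Finset.range L)
    (hs : TreeReady P ord g x L s) (ha : Active A L s) (hd : GroupReady P L A d s) :
    RunsIn (interactionCost L) blockPass s fun s' => ∀ t ∈ A, P t ∉ A → ∀ e ≤ below P A t,
      s'.real rOut (t * (L + 1) + e) = ∑ e' ∈ Finset.range (below P A t + 1),
        g (e + e') * s.real rIn (t * (L + 1) + e') := by
  have hL := fun {i} (h : i ∈ A) => Finset.mem_range.1 (hA h)
  refine RunsIn.mono (RunsIn.forTops
    (fun t => (Nat.log 2 (8 * (below P A t + 1)) + 2) * (8 * (below P A t + 1)))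
    (fun m s' => ∀ t ∈ A, P t ∉ A → t < m → ∀ e ≤ below P A t,
      s'.real rOut (t * (L + 1) + e) = ∑ e' ∈ Finset.range (below P A t + 1),
        g (e + e') * s.real rIn (t * (L + 1) + e')) hP hA hs ha hd (by decide) (by simp) ?_ ?_
    (fun t => Nat.mul_pos (by omega) (by omega)) (le_interactionCost L) (sum_weight_le hP hA))
    le_rfl fun s' _ h t ht ht' => h t ht ht' (hL ht)
  · intro t ht ht' s' hf hv hI
    have c := hs.frame hf (by decide) (by decide)
    have hd' := hd.frame hf (by decide)
    have hb := below_le (P := P) hA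
    refine .seq (Q₁ := fun s₁ => s₁.nat vM 0 = below P A t + 1) (.loopFree rfl
      (by simp [Program.run, hv, hd'.size t ht]) (Nat.mul_pos (by omega) (by omega)))
      fun s₁ f₁ h₁ => ?_
    have c₁ := c.frame f₁ (by decide) (by decide)
    have v₁ : s₁.nat vT 0 = t := by rw [f₁.nat _ (by decide), hv]
    have q₁ : s₁.real rOut = s'.real rOut := f₁.real _ (by decide)
    have q₂ : s₁.real rIn = s.real rIn := by rw [f₁.real _ (by decide), hf.real _ (by decide)]
    refine RunsIn.mono (hankelBlock_runs (by omega) h₁ c₁.twiddle (by have := hb t; omega)) le_rfl ?_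
    rw [v₁, c₁.off t (hL ht), q₁, q₂, c₁.f]
    rintro s₂ _ ⟨i₁, i₂⟩ t' ht₁ ht₂ ht₃ e he
    rw [Memory.writeNat_real]
    rcases Nat.lt_succ_iff_lt_or_eq.1 ht₃ with h | rfl
    · rw [i₂, hI t' ht₁ ht₂ h e he]
      intro e' he' heq
      have := hb t
      have := hb t'
      exact h.ne (block_inj (by omega) (by omega) heq).1
    · exact i₁ e (by omega)
  · intro t ht hn s' hI t' ht₁ ht₂ ht₃ e he
    rcases Nat.lt_succ_iff_lt_or_eq.1 ht₃ with h | rfl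
    · exact hI t' ht₁ ht₂ h e he
    · exact absurd ⟨ht₁, ht₂⟩ hn

/-- The sum of the interactions of the node `i` with the nodes of its component. -/
noncomputable def interaction (P ord : ℕ → ℕ) (g x : ℕ → ℝ) (L : ℕ) (A : Finset ℕ) (d : ℕ → ℕ)
    (i : ℕ) : ℝ :=
  ∑ j ∈ A.filter (fun j => top P L A j = top P L A i), g (d i + d j) * x (ord j)

theorem scatterPass_runs (q : ℚ) (hP : IsParent P L) (hA : A ⊆ Finset.range L)
    (hord : Set.InjOn ord (Finset.range L))
    (hs : TreeReady P ord g x L s) (ha : Active A L s) (hd : GroupReady P L A d s)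
    (h : ∀ i ∈ A, s.real rOut (top P L A i * (L + 1) + d i) = interaction P ord g x L A d i) :
    RunsIn (L + 1) (scatterPass q) s fun s' => ∀ i < L, s'.real rY (ord i) =
      s.real rY (ord i) + if i ∈ A then q * interaction P ord g x L A d i else 0 := by
  have hL := fun {i} (h : i ∈ A) => Finset.mem_range.1 (hA h)
  refine RunsIn.mono (RunsIn.forTo_loopFree L (fun m s' => ∀ i < L, s'.real rY (ord i) =
      s.real rY (ord i) + if i < m ∧ i ∈ A then q * interaction P ord g x L A d i else 0)
    rfl (by simp [Program.natBanks])
    (fun s' hf => (hs.frame hf (by simp [forTo, Program.natBanks])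
      (by simp [forTo, Program.realBanks])).len)
    (by simp) ?_ le_rfl) le_rfl ?_
  · intro m hm s' hf hv hI i hi
    have c := hs.frame hf (by simp [forTo, Program.natBanks]) (by simp [forTo, Program.realBanks])
    have a := ha.frame hf (by simp [forTo, Program.natBanks])
    have hd' := hd.frame hf (by simp [forTo, Program.natBanks])
    have hout : s'.real rOut = s.real rOut := hf.real _ (by simp [forTo, Program.realBanks])
    have hIi := hI i hi
    by_cases him : i = m
    · subst him
      rw [if_neg (by omega), add_zero] at hIi
      by_cases hA' : i ∈ A
      · rw [if_pos ⟨by omega, hA'⟩, ← h i hA', ← hIi]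
        simp [Program.run, hv, (a i hi.le).2 hA', c.ord i hi, hd'.top i hA', hd'.dist i hA',
          c.off _ (hL (rep_mem hP (m := L) hA')), hout]
      · rw [if_neg (fun h => hA' h.2), add_zero, ← hIi]
        simp [Program.run, hv, mt (a i hi.le).1 hA']
    · have e : (i < m + 1 ∧ i ∈ A) ↔ (i < m ∧ i ∈ A) := by
        constructor <;> rintro ⟨h₁, h₂⟩ <;> exact ⟨by omega, h₂⟩
      rw [if_congr e rfl rfl, ← hIi]
      have hne : ord i ≠ ord m := fun h =>
        him (hord (by simpa using hi) (by simpa using hm) h)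
      by_cases hA' : m ∈ A
      · simp [Program.run, hv, (a m hm.le).2 hA', c.ord m hm, hne]
      · simp [Program.run, hv, mt (a m hm.le).1 hA']
  · intro s' _ h i hi
    simp only [h i hi, hi, true_and]

/-- The distances `d` are arbitrary apart from fitting into the blocks. The pass can thus be used
both before the removal of the centroids and after it, with the same distances. -/
theorem interactionPass_runs (q : ℚ) (hP : IsParent P L) (hA : A ⊆ Finset.range L)
    (hord : Set.InjOn ord (Finset.range L))
    (hs : TreeReady P ord g x L s) (ha : Active A L s) (hd : GroupReady P L A d s)
    (hdle : ∀ i ∈ A, d i ≤ below P A (top P L A i)) :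
    RunsIn (interactionCost L) (interactionPass q) s fun s' => ∀ i < L, s'.real rY (ord i) =
      s.real rY (ord i) + if i ∈ A then q * interaction P ord g x L A d i else 0 := by
  refine .seq (clearPass_runs hP hA hs ha hd) fun s₁ f₁ h₁ => ?_
  have hs₁ := hs.frame f₁ (by decide) (by decide)
  have ha₁ := ha.frame f₁ (by decide)
  have hd₁ := hd.frame f₁ (by decide)
  refine .seq ((gatherPass_runs hP hA hs₁ ha₁ hd₁ hdle h₁).mono (le_interactionCost L)
    fun _ _ h => h) fun s₂ f₂ h₂ => ?_
  have hs₂ := hs₁.frame f₂ (by decide) (by decide)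
  have ha₂ := ha₁.frame f₂ (by decide)
  have hd₂ := hd₁.frame f₂ (by decide)
  refine .seq (blockPass_runs hP hA hs₂ ha₂ hd₂) fun s₃ f₃ h₃ => ?_
  have hs₃ := hs₂.frame f₃ (by decide) (by decide)
  have ha₃ := ha₂.frame f₃ (by decide)
  have hd₃ := hd₂.frame f₃ (by decide)
  have hY : s₃.real rY = s.real rY := by
    rw [f₃.real _ (by decide), f₂.real _ (by decide), f₁.real _ (by decide)]
  rw [← hY]
  refine (scatterPass_runs q hP hA hord hs₃ ha₃ hd₃ fun i hi => ?_).mono (le_interactionCost L)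
    fun _ _ h => h
  have hT := rep_mem hP (m := L) hi
  have hT' := parent_top_notMem hP hA i
  rw [h₃ _ hT hT' _ (hdle i hi), interaction]
  -- Grouping the nodes of the component by `d j = e` gives the factor `g (d i + e)` times the
  -- gathered entry, which is row `d i` of the Hankel product.
  rw [← Finset.sum_fiberwise_of_maps_to (s := A.filter fun j => top P L A j = top P L A i) (g := d)
    (t := Finset.range (below P A (top P L A i) + 1))]
  · refine Finset.sum_congr rfl fun e he => ?_
    rw [h₂ _ hT hT' e (Nat.lt_succ_iff.1 (Finset.mem_range.1 he)), Finset.mul_sum,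
      Finset.filter_filter]
    exact Finset.sum_congr rfl fun j hj => by rw [(Finset.mem_filter.1 hj).2.2]
  · intro j hj
    obtain ⟨h₁, h₂⟩ := Finset.mem_filter.1 hj
    have := hdle j h₁
    rw [h₂] at this
    exact Finset.mem_range.2 (by omega)

end interactions

end RealRAM

/-! ### Rounds of the centroid decomposition -/

namespace RealRAM

open ParentTree

/-- Adds the interactions of all pairs that the removal of the centroids separates. -/
def round : Program :=
  labelPass ;; sizePass ;; centroidPass ;; distPass ;; interactionPass 1 ;;
  removePass ;; labelPass ;; sizePass ;; interactionPass (-1) ;;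
  setVar vRound (var vRound + var vRound)

/-- Removes centroids until no node is left. -/
def allRounds : Program := setVar vRound 1 ;; .whileLt (var vRound) (len + 1) round

section rounds

variable {P ord : ℕ → ℕ} {g x : ℕ → ℝ} {L : ℕ} {A : Finset ℕ} {s : Memory}

/-- The nodes `i` and `j` belong to the same component of `A`. -/
def SameComp (P : ℕ → ℕ) (L : ℕ) (A : Finset ℕ) (i j : ℕ) : Prop :=
  i ∈ A ∧ j ∈ A ∧ top P L A i = top P L A j

open Classical in
/-- The contribution to the product at the node `i` of the nodes in its component. -/
noncomputable def compSum (P ord : ℕ → ℕ) (g x : ℕ → ℝ) (L : ℕ) (A : Finset ℕ) (i : ℕ) : ℝ :=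
  ∑ j ∈ Finset.range L, if SameComp P L A i j then g (dist P L i j) * x (ord j) else 0

theorem SameComp.of_next (hP : IsParent P L) (hA : A ⊆ Finset.range L) {i j : ℕ}
    (h : SameComp P L (next P L A) i j) : SameComp P L A i j :=
  ⟨next_subset h.1, next_subset h.2.1, by
    rw [← top_top_of_subset hP next_subset hA i, h.2.2, top_top_of_subset hP next_subset hA j]⟩

open Classical in
theorem ite_interaction_eq_sum (hA : A ⊆ Finset.range L) (d : ℕ → ℕ) (i : ℕ) :
    (if i ∈ A then interaction P ord g x L A d i else 0) =
      ∑ j ∈ Finset.range L, if SameComp P L A i j then g (d i + d j) * x (ord j) else 0 := by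
  by_cases hi : i ∈ A
  · rw [if_pos hi, interaction, ← Finset.sum_filter]
    refine Finset.sum_congr ?_ fun _ _ => rfl
    ext j
    simp only [Finset.mem_filter, SameComp, hi, true_and]
    exact ⟨fun h => ⟨hA h.1, h.1, h.2.symm⟩, fun h => ⟨h.2.1, h.2.2.symm⟩⟩
  · simp [hi, SameComp]

/-- Pairs that stay together cancel on both sides, whatever `d i + d j` is. For pairs that are
separated, `d i + d j` is their true distance. -/
theorem interaction_sub_interaction (hP : IsParent P L) (hA : A ⊆ Finset.range L) {d : ℕ → ℕ}
    (hd : ∀ i ∈ A, d i = dist P L i (centroid P L A i)) (i : ℕ) :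
    (if i ∈ A then interaction P ord g x L A d i else 0) -
      (if i ∈ next P L A then interaction P ord g x L (next P L A) d i else 0) =
      compSum P ord g x L A i - compSum P ord g x L (next P L A) i := by
  classical
  rw [ite_interaction_eq_sum hA, ite_interaction_eq_sum (next_subset.trans hA), compSum, compSum,
    ← Finset.sum_sub_distrib, ← Finset.sum_sub_distrib]
  refine Finset.sum_congr rfl fun j _ => ?_
  by_cases h' : SameComp P L (next P L A) i j
  · rw [if_pos h', if_pos h', if_pos (h'.of_next hP hA), if_pos (h'.of_next hP hA), sub_self,
      sub_self]
  · by_cases h : SameComp P L A i j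
    · rw [if_pos h, if_pos h, dist_eq_add_of_separated hP hA h.1 h.2.1 h.2.2 h', hd i h.1,
        hd j h.2.1, if_neg h']
    · rw [if_neg h, if_neg h, if_neg h', if_neg h']

theorem round_runs (hP : IsParent P L) (hPL : ∀ i < L, P i ≤ L) (hA : A ⊆ Finset.range L)
    (hord : Set.InjOn ord (Finset.range L))
    (hs : TreeReady P ord g x L s) (ha : Active A L s) :
    RunsIn (interactionCost L) round s fun s' => s'.nat vRound 0 = 2 * s.nat vRound 0 ∧
      Active (next P L A) L s' ∧ ∀ i < L, s'.real rY (ord i) = s.real rY (ord i) +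
        (compSum P ord g x L A i - compSum P ord g x L (next P L A) i) := by
  have hW := le_interactionCost L
  have hL := fun {i} (h : i ∈ A) => Finset.mem_range.1 (hA h)
  have hA' : next P L A ⊆ Finset.range L := next_subset.trans hA
  have hbc : ∀ B ⊆ Finset.range L, ∀ i ∈ B,
      below P B (top P L B i) = (comp P L B (top P L B i)).card := fun B hB i hi =>
    below_eq_card_comp hP (Finset.mem_range.1 (hB (rep_mem hP hi))) (parent_top_notMem hP hB i)
  refine .seq ((labelPass_runs hP hPL hA hs ha).mono hW fun _ _ h => h) fun s₁ f₁ t₁ => ?_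
  have hs₁ := hs.frame f₁ (by decide) (by decide)
  have ha₁ := ha.frame f₁ (by decide)
  refine .seq ((sizePass_runs hP hPL hA hs₁ ha₁).mono hW fun _ _ h => h) fun s₂ f₂ z₂ => ?_
  have hs₂ := hs₁.frame f₂ (by decide) (by decide)
  have ha₂ := ha₁.frame f₂ (by decide)
  have t₂ : ∀ i ∈ A, s₂.nat bTop i = top P L A i := by rw [f₂.nat _ (by decide)]; exact t₁
  refine .seq ((centroidPass_runs hP hA hs₂ ha₂ t₂ z₂).mono hW fun _ _ h => h) fun s₃ f₃ c₃ => ?_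
  have hs₃ := hs₂.frame f₃ (by decide) (by decide)
  have ha₃ := ha₂.frame f₃ (by decide)
  refine .seq ((distPass_runs hP hPL hA hs₃ ha₃ c₃).mono hW fun _ _ h => h) fun s₄ f₄ d₄ => ?_
  have hs₄ := hs₃.frame f₄ (by decide) (by decide)
  have ha₄ := ha₃.frame f₄ (by decide)
  have c₄ := c₃.frame f₄ (by decide) (by decide)
  have g₄ : GroupReady P L A (fun i => dist P L i (centroid P L A i)) s₄ :=
    ⟨fun i hi => (c₄ i hi).1, by rw [f₄.nat _ (by decide), f₃.nat _ (by decide)]; exact z₂, d₄⟩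
  refine .seq (interactionPass_runs 1 hP hA hord hs₄ ha₄ g₄ fun i hi => ?_) fun s₅ f₅ y₅ => ?_
  · rw [hbc A hA i hi]; exact (dist_centroid_lt_card hP hA hi).le
  have hs₅ := hs₄.frame f₅ (by decide) (by decide)
  have ha₅ := ha₄.frame f₅ (by decide)
  have c₅ := c₄.frame f₅ (by decide) (by decide)
  refine .seq ((removePass_runs hA hs₅ ha₅ c₅).mono hW fun _ _ h => h) fun s₆ f₆ a₆ => ?_
  have hs₆ := hs₅.frame f₆ (by decide) (by decide)
  refine .seq ((labelPass_runs hP hPL hA' hs₆ a₆).mono hW fun _ _ h => h) fun s₇ f₇ t₇ => ?_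
  have hs₇ := hs₆.frame f₇ (by decide) (by decide)
  have a₇ := a₆.frame f₇ (by decide)
  refine .seq ((sizePass_runs hP hPL hA' hs₇ a₇).mono hW fun _ _ h => h) fun s₈ f₈ z₈ => ?_
  have hs₈ := hs₇.frame f₈ (by decide) (by decide)
  have a₈ := a₇.frame f₈ (by decide)
  -- Labels and sizes are those of the new components, but the distances are still those to the
  -- removed centroids, as the cancellation requires.
  have g₈ : GroupReady P L (next P L A) (fun i => dist P L i (centroid P L A i)) s₈ := by
    refine ⟨by rw [f₈.nat _ (by decide)]; exact t₇, z₈, ?_⟩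
    rw [f₈.nat _ (by decide), f₇.nat _ (by decide), f₆.nat _ (by decide), f₅.nat _ (by decide)]
    exact fun i hi => d₄ i (next_subset hi)
  refine .seq (interactionPass_runs (-1) hP hA' hord hs₈ a₈ g₈ fun i hi => ?_) fun s₉ f₉ y₉ => ?_
  · rw [hbc _ hA' i hi]; exact dist_centroid_le_card_next hP hA hi
  have a₉ := a₈.frame f₉ (by decide)
  refine .loopFree rfl ⟨?_, ?_, fun i hi => ?_⟩ (by omega)
  · simp only [Program.run, NExp.eval_add, NExp.eval_get, NExp.eval_ofNat, Memory.writeNat_nat]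
    rw [f₉.nat _ (by decide), f₈.nat _ (by decide), f₇.nat _ (by decide), f₆.nat _ (by decide),
      f₅.nat _ (by decide), f₄.nat _ (by decide), f₃.nat _ (by decide), f₂.nat _ (by decide),
      f₁.nat _ (by decide)]
    simp; omega
  · simpa [Active, Program.run] using a₉
  · rw [← interaction_sub_interaction hP hA (fun i _ => rfl)]
    simp only [Program.run, Memory.writeNat_real]
    rw [y₉ i hi, f₈.real _ (by decide), f₇.real _ (by decide), f₆.real _ (by decide), y₅ i hi,
      f₄.real _ (by decide), f₃.real _ (by decide), f₂.real _ (by decide), f₁.real _ (by decide)]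
    split_ifs <;> push_cast <;> ring

theorem two_pow_mul_card_comp_le (hP : IsParent P L) (r : ℕ) :
    (next P L)^[r] (Finset.range L) ⊆ Finset.range L ∧
    ∀ i ∈ (next P L)^[r] (Finset.range L), 2 ^ r * (comp P L ((next P L)^[r] (Finset.range L))
      (top P L ((next P L)^[r] (Finset.range L)) i)).card ≤ L := by
  induction r with
  | zero =>
    refine ⟨subset_rfl, fun i _ => ?_⟩
    rw [pow_zero, one_mul, Function.iterate_zero, id]
    exact (Finset.card_le_card (Finset.filter_subset _ _)).trans (by rw [Finset.card_range])
  | succ r ih =>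
    rw [Function.iterate_succ_apply']
    refine ⟨next_subset.trans ih.1, fun i hi => ?_⟩
    have h₁ := two_mul_card_comp_next_le hP ih.1 hi
    have h₂ := ih.2 i (next_subset hi)
    have h₃ := Nat.mul_le_mul_left (2 ^ r) h₁
    rw [pow_succ, mul_assoc]
    exact h₃.trans h₂

theorem iterate_next_eq_empty (hP : IsParent P L) {r : ℕ} (hr : L < 2 ^ r) :
    (next P L)^[r] (Finset.range L) = ∅ := by
  by_contra h
  obtain ⟨i, hi⟩ := Finset.nonempty_iff_ne_empty.2 h
  have h₁ := (two_pow_mul_card_comp_le hP r).2 i hi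
  have h₂ : 0 < (comp P L ((next P L)^[r] (Finset.range L))
      (top P L ((next P L)^[r] (Finset.range L)) i)).card :=
    Finset.card_pos.2 ⟨i, Finset.mem_filter.2 ⟨hi, rfl⟩⟩
  have h₃ : 2 ^ r ≤ 2 ^ r * _ := Nat.le_mul_of_pos_right (2 ^ r) h₂
  omega

/-- The cost factor of all rounds on `L` nodes. -/
def totalCost (L : ℕ) : ℕ := (Nat.log 2 L + 2) * interactionCost L

/-- The contributions of the rounds telescope: after `r` rounds the output is `compSum` of the full
set minus `compSum` of the active set. The former is the whole product, and the latter vanishes in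
the end. -/
theorem allRounds_runs (hL : 1 ≤ L) (hP : IsParent P L) (hPL : ∀ i < L, P i ≤ L)
    (hord : Set.InjOn ord (Finset.range L)) (hs : TreeReady P ord g x L s)
    (ha : Active (Finset.range L) L s) (hy : ∀ a, s.real rY a = 0) :
    RunsIn (totalCost L) allRounds s fun s' => ∀ i < L, s'.real rY (ord i) =
      ∑ j ∈ Finset.range L, g (dist P L i j) * x (ord j) := by
  have hc : 1 ≤ interactionCost L := le_trans (by omega) (le_interactionCost L)
  refine .seq (Q₁ := fun s₁ => s₁ = (setVar vRound 1).run s)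
    (.loopFree rfl rfl (Nat.mul_pos (by omega) hc)) fun s₁ f₁ h₁ => ?_
  have hs₁ := hs.frame f₁ (by decide) (by decide)
  have ha₁ := ha.frame f₁ (by decide)
  -- The variable `vRound` holds `2 ^ r`. Components of round `r` have at most `L / 2 ^ r` nodes, so
  -- none exist once `2 ^ r` exceeds `L`.
  have hpow : ∀ j, 2 ^ j < L + 1 ↔ j < Nat.log 2 L + 1 := by
    intro j
    rw [Nat.lt_succ_iff, Nat.lt_succ_iff, Nat.le_log_iff_pow_le (by omega) (by omega)]
  set N := next P L with hN
  refine RunsIn.mono (RunsIn.whileLt (Nat.log 2 L + 1) (W' := interactionCost L) (fun r s' =>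
    s'.nat vRound 0 = 2 ^ r ∧ Active (N^[r] (Finset.range L)) L s' ∧ ∀ i < L, s'.real rY (ord i) =
      compSum P ord g x L (Finset.range L) i - compSum P ord g x L (N^[r] (Finset.range L)) i)
    ⟨?_, ha₁, ?_⟩ ?_ ?_ le_rfl hc) le_rfl ?_
  · simp [h₁, Program.run]
  · intro i _
    rw [f₁.real _ (by decide), hy, Function.iterate_zero, id, sub_self]
  · rintro r hr s' hf ⟨i₁, i₂, i₃⟩
    have hs' := hs₁.frame hf (by decide) (by decide)
    have hlen := hs'.len
    refine ⟨by have := (hpow r).2 hr; simpa [i₁, hlen] using this, ?_⟩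
    refine (round_runs hP hPL (two_pow_mul_card_comp_le hP r).1 hord hs' i₂).mono le_rfl ?_
    rintro s'' - ⟨j₁, j₂, j₃⟩
    rw [Function.iterate_succ_apply']
    exact ⟨by rw [j₁, i₁, pow_succ]; ring, j₂, fun i hi => by rw [j₃ i hi, i₃ i hi]; ring⟩
  · rintro s' hf ⟨i₁, -, -⟩
    have hlen := (hs₁.frame hf (by decide) (by decide)).len
    have := (hpow (Nat.log 2 L + 1)).not.2 (by omega)
    simpa [i₁, hlen] using this
  · rintro s' - ⟨-, -, i₃⟩ i hi
    have hemp : N^[Nat.log 2 L + 1] (Finset.range L) = ∅ :=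
      iterate_next_eq_empty hP (Nat.lt_pow_succ_log_self (by omega) L)
    rw [i₃ i hi, hemp]
    have h₀ : compSum P ord g x L ∅ i = 0 := by simp [compSum, SameComp]
    rw [h₀, sub_zero, compSum]
    -- While all nodes are active, any two of them are trivially connected within the active set.
    refine Finset.sum_congr rfl fun j hj => if_pos ?_
    have hi' := Finset.mem_range.2 hi
    exact ⟨hi', hj, (top_eq_top_iff_conn hP subset_rfl hi' hj).2
      fun w hw _ => Finset.mem_range.2 hw⟩

end rounds

end RealRAM

/-! ### Rooting the tree by leaf stripping -/

namespace Elimination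

variable {H : SimpleGraph ℕ} {L : ℕ}

open Classical in
/-- The neighbours of `v` in `R`. -/
noncomputable def nbrs (H : SimpleGraph ℕ) (R : Finset ℕ) (v : ℕ) : Finset ℕ := R.filter (H.Adj v)

theorem mem_nbrs {R : Finset ℕ} {v w : ℕ} : w ∈ nbrs H R v ↔ w ∈ R ∧ H.Adj v w := by
  simp [nbrs]

/-- The set `R` of nodes spans a subtree: it is connected and has one edge less than nodes. -/
structure Subtree (H : SimpleGraph ℕ) (R : Finset ℕ) : Prop where
  cut : ∀ S ⊆ R, S.Nonempty → S ≠ R → ∃ a ∈ S, ∃ b ∈ R \ S, H.Adj a b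
  sum_card : ∑ v ∈ R, (nbrs H R v).card + 2 = 2 * R.card

theorem Subtree.card_pos {R : Finset ℕ} (hR : Subtree H R) (h : 2 ≤ R.card) {v : ℕ} (hv : v ∈ R) :
    0 < (nbrs H R v).card := by
  obtain ⟨a, ha, b, hb, hab⟩ := hR.cut {v} (by simpa using hv) (by simp)
    (fun e => by rw [← e] at h; simp at h)
  rw [Finset.mem_singleton] at ha
  exact Finset.card_pos.2 ⟨b, mem_nbrs.2 ⟨(Finset.mem_sdiff.1 hb).1, ha ▸ hab⟩⟩

/-- The sum of the degrees is less than twice the number of nodes. -/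
theorem Subtree.exists_leaf {R : Finset ℕ} (hR : Subtree H R) :
    ∃ v ∈ R, (nbrs H R v).card ≤ 1 := by
  by_contra! hc
  have := Finset.sum_le_sum (f := fun _ => 2) fun v hv => hc v hv
  rw [Finset.sum_const, smul_eq_mul] at this
  have := hR.sum_card
  omega

theorem nbrs_erase (R : Finset ℕ) (v w : ℕ) : nbrs H (R.erase v) w = (nbrs H R w).erase v := by
  ext a; simp only [mem_nbrs, Finset.mem_erase]; tauto

theorem nbrs_erase_of_ne {R : Finset ℕ} {v q w : ℕ} (hw : w ∈ R)
    (hq : nbrs H R v = {q}) (hwq : w ≠ q) : nbrs H (R.erase v) w = nbrs H R w := by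
  rw [nbrs_erase, Finset.erase_eq_of_notMem]
  intro h
  have : w ∈ nbrs H R v := mem_nbrs.2 ⟨hw, (mem_nbrs.1 h).2.symm⟩
  rw [hq, Finset.mem_singleton] at this
  exact hwq this

theorem mem_nbrs_of_eq_singleton {R : Finset ℕ} {v q : ℕ} (hv : v ∈ R)
    (hq : nbrs H R v = {q}) : v ∈ nbrs H R q := by
  have : q ∈ nbrs H R v := by rw [hq]; simp
  exact mem_nbrs.2 ⟨hv, (mem_nbrs.1 this).2.symm⟩

/-- To find an edge that leaves `S`, add the leaf `v` to `S` if `S` contains its neighbour `q`, and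
otherwise use `S` itself; in neither case can the edge involve `v`. The degree sum drops by two:
once for `v` and once for `q`. -/
theorem Subtree.erase {R : Finset ℕ} (hR : Subtree H R) {v q : ℕ} (hv : v ∈ R)
    (hq : nbrs H R v = {q}) : Subtree H (R.erase v) := by
  have hq' : q ∈ nbrs H R v := by rw [hq]; simp
  rw [mem_nbrs] at hq'
  have hne : q ≠ v := hq'.2.ne'
  have huniq : ∀ w ∈ R, H.Adj v w → w = q := fun w hw h => by
    have : w ∈ nbrs H R v := mem_nbrs.2 ⟨hw, h⟩
    simpa [hq] using this
  constructor
  · intro S hS hn hne'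
    have hSR : S ⊆ R := hS.trans (Finset.erase_subset _ _)
    have hvS : v ∉ S := fun h => by simpa using hS h
    by_cases hqS : q ∈ S
    · obtain ⟨a, ha, b, hb, hab⟩ := hR.cut (insert v S) (Finset.insert_subset hv hSR) (by simp)
        (fun e => hne' (by rw [← e, Finset.erase_insert hvS]))
      simp only [Finset.mem_insert, Finset.mem_sdiff, not_or] at ha hb
      rcases ha with rfl | ha
      · exact absurd hqS (huniq b hb.1 hab ▸ hb.2.2)
      · exact ⟨a, ha, b, by simp [hb], hab⟩
    · obtain ⟨a, ha, b, hb, hab⟩ := hR.cut S hSR hn (fun e => hvS (e ▸ hv))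
      rw [Finset.mem_sdiff] at hb
      refine ⟨a, ha, b, ?_, hab⟩
      have : b ≠ v := by
        rintro rfl
        exact hqS (huniq a (hSR ha) hab.symm ▸ ha)
      simp [hb, this]
  · have h₁ := hR.sum_card
    have hqv : q ∈ R.erase v := Finset.mem_erase.2 ⟨hne, hq'.1⟩
    rw [← Finset.add_sum_erase R _ hv, hq, Finset.card_singleton, ← Finset.add_sum_erase _ _ hqv]
      at h₁
    rw [← Finset.add_sum_erase _ _ hqv, nbrs_erase,
      Finset.card_erase_of_mem (mem_nbrs_of_eq_singleton hv hq), Finset.card_erase_of_mem hv,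
      Finset.sum_congr rfl fun w hw => by
        rw [nbrs_erase_of_ne (Finset.mem_of_mem_erase (Finset.mem_of_mem_erase hw)) hq
          (Finset.ne_of_mem_erase hw)]]
    have := Finset.card_pos.2 ⟨v, mem_nbrs_of_eq_singleton hv hq⟩
    omega

/-- The nodes that remain after the removal of `ord 0, …, ord (i - 1)`. -/
def remaining (L : ℕ) (ord : ℕ → ℕ) (i : ℕ) : Finset ℕ :=
  Finset.range L \ (Finset.range i).image ord

theorem mem_remaining {ord : ℕ → ℕ} {i v : ℕ} :
    v ∈ remaining L ord i ↔ v < L ∧ ∀ k < i, ord k ≠ v := by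
  simp [remaining]

theorem remaining_congr {ord ord' : ℕ → ℕ} {i : ℕ} (h : ∀ k < i, ord' k = ord k) :
    remaining L ord' i = remaining L ord i := by
  ext v
  rw [mem_remaining, mem_remaining]
  exact and_congr_right fun _ => forall₂_congr fun k hk => by rw [h k hk]

theorem remaining_succ (ord : ℕ → ℕ) (i : ℕ) :
    remaining L ord (i + 1) = (remaining L ord i).erase (ord i) := by
  ext v
  simp only [mem_remaining, Finset.mem_erase, Nat.lt_succ_iff_lt_or_eq, or_imp, forall_and,
    forall_eq]
  constructor
  · rintro ⟨h, h', h''⟩; exact ⟨h''.symm, h, h'⟩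
  · rintro ⟨h'', h, h'⟩; exact ⟨h, h', h''.symm⟩

/-- The state of leaf stripping after `i` nodes have been removed, with `t` nodes in the list. -/
structure Stripped (H : SimpleGraph ℕ) (L i t : ℕ) (ord par deg sum : ℕ → ℕ) : Prop where
  le : i ≤ t
  lt : ∀ k < t, ord k < L
  inj : Set.InjOn ord (Finset.range t)
  subtree : Subtree H (remaining L ord i)
  deg_eq : ∀ v ∈ remaining L ord i, deg v = (nbrs H (remaining L ord i) v).card
  sum_eq : ∀ v ∈ remaining L ord i, sum v = ∑ w ∈ nbrs H (remaining L ord i) v, w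
  queue : ∀ v ∈ remaining L ord i,
    (∃ k, i ≤ k ∧ k < t ∧ ord k = v) ↔ (nbrs H (remaining L ord i) v).card ≤ 1
  par_eq : ∀ k < i, nbrs H (remaining L ord k) (ord k) = {par (ord k)}

namespace Stripped

variable {i t : ℕ} {ord par deg sum : ℕ → ℕ}

theorem ord_ne (h : Stripped H L i t ord par deg sum) {k l : ℕ} (hk : k < l) (hl : l < t) :
    ord k ≠ ord l := fun e => by
  have := h.inj (by simp; omega) (by simpa using hl) e
  omega

theorem ord_mem (h : Stripped H L i t ord par deg sum) {j k : ℕ} (hj : j ≤ k) (hk : k < t) :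
    ord k ∈ remaining L ord j :=
  mem_remaining.2 ⟨h.lt k hk, fun _ hl => h.ord_ne (by omega) hk⟩

theorem card_remaining (h : Stripped H L i t ord par deg sum) {j : ℕ} (hj : j ≤ t) :
    (remaining L ord j).card = L - j := by
  rw [remaining, Finset.card_sdiff_of_subset, Finset.card_range, Finset.card_image_of_injOn,
    Finset.card_range]
  · exact h.inj.mono (by simpa using hj)
  · intro v hv
    obtain ⟨k, hk, rfl⟩ := Finset.mem_image.1 hv
    exact Finset.mem_range.2 (h.lt k (by have := Finset.mem_range.1 hk; omega))

/-- The queue is never exhausted, because what remains has a leaf and every remaining leaf is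
queued. -/
theorem lt_length (h : Stripped H L i t ord par deg sum) : i < t := by
  obtain ⟨v, hv, hv'⟩ := h.subtree.exists_leaf
  obtain ⟨k, hk, hk', -⟩ := (h.queue v hv).2 hv'
  omega

/-- The next node in the queue has exactly one remaining neighbour, so the stored sum of its
neighbours is that neighbour. No adjacency lists are needed. -/
theorem nbrs_eq (h : Stripped H L i t ord par deg sum) (hi : i + 1 < L) :
    nbrs H (remaining L ord i) (ord i) = {sum (ord i)} := by
  have hit := h.lt_length
  have hm := h.ord_mem le_rfl hit
  have h₁ := (h.queue _ hm).1 ⟨i, le_rfl, hit, rfl⟩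
  have h₂ := h.subtree.card_pos (by rw [h.card_remaining h.le]; omega) hm
  obtain ⟨q, hq⟩ := Finset.card_eq_one.1 (le_antisymm h₁ h₂)
  rw [h.sum_eq _ hm, hq, Finset.sum_singleton]

/-- Removing the leaf `ord i` affects the degree and the neighbour sum of its neighbour only. That
neighbour enters the queue exactly when its degree falls from two to one; if its degree was already
one, it is in the queue. -/
theorem step (h : Stripped H L i t ord par deg sum) (hi : i + 1 < L) {t' : ℕ}
    {ord' par' deg' sum' : ℕ → ℕ}
    (hpar : ∀ w, par' w = if w = ord i then sum (ord i) else par w)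
    (hdeg : ∀ w, deg' w = if w = sum (ord i) then deg (sum (ord i)) - 1 else deg w)
    (hsum : ∀ w, sum' w = if w = sum (ord i) then sum (sum (ord i)) - ord i else sum w)
    (ht : t' = if deg (sum (ord i)) = 2 then t + 1 else t)
    (hord : ∀ k < t, ord' k = ord k) (hord' : deg (sum (ord i)) = 2 → ord' t = sum (ord i)) :
    Stripped H L (i + 1) t' ord' par' deg' sum' := by
  have hit := h.lt_length
  have hv := h.ord_mem le_rfl hit
  have hq := h.nbrs_eq hi
  set v := ord i with hvdef
  set q := sum v with hqdef
  set R := remaining L ord i with hR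
  have hqR : q ∈ R := by
    have : q ∈ nbrs H R v := by rw [hq]; simp
    exact (mem_nbrs.1 this).1
  have hvq := mem_nbrs_of_eq_singleton hv hq
  have hqv : q ≠ v := by
    have : q ∈ nbrs H R v := by rw [hq]; simp
    exact (mem_nbrs.1 this).2.ne'
  have hR' : ∀ j ≤ t, remaining L ord' j = remaining L ord j := fun j hj =>
    remaining_congr fun k hk => hord k (by omega)
  have hR₁ : remaining L ord' (i + 1) = R.erase v := by rw [hR' _ (by omega), remaining_succ]
  have hcard : (nbrs H R q).card = deg q := (h.deg_eq q hqR).symm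
  have htt : t ≤ t' := by rw [ht]; split_ifs <;> omega
  -- A node of degree two is not in the queue yet, so appending it keeps the list free of
  -- repetitions.
  have hnew : deg q = 2 → ∀ k < t, ord k ≠ q := fun h2 k hk e => by
    rcases lt_or_ge k i with hki | hki
    · exact (mem_remaining.1 hqR).2 k hki e
    · have : (nbrs H R q).card ≤ 1 := (h.queue q hqR).1 ⟨k, hki, hk, e⟩
      omega
  refine ⟨by omega, ?_, ?_, ?_, ?_, ?_, ?_, ?_⟩
  · intro k hk
    rcases lt_or_ge k t with hkt | hkt
    · rw [hord k hkt]; exact h.lt k hkt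
    · by_cases h2 : deg q = 2
      · rw [if_pos h2] at ht
        obtain rfl : k = t := by omega
        rw [hord' h2]; exact (mem_remaining.1 hqR).1
      · rw [if_neg h2] at ht; omega
  · have key : ∀ k l, k < l → l < t' → ord' k ≠ ord' l := by
      intro k l hkl hl
      rcases lt_or_ge l t with hlt | hlt
      · rw [hord l hlt, hord k (by omega)]; exact h.ord_ne hkl hlt
      · by_cases h2 : deg q = 2
        · rw [if_pos h2] at ht
          obtain rfl : l = t := by omega
          rw [hord' h2, hord k hkl]; exact hnew h2 k hkl
        · rw [if_neg h2] at ht; omega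
    intro k hk l hl e
    simp only [Finset.coe_range, Set.mem_Iio] at hk hl
    rcases lt_trichotomy k l with hkl | hkl | hkl
    · exact absurd e (key k l hkl hl)
    · exact hkl
    · exact absurd e.symm (key l k hkl hk)
  · rw [hR₁]; exact h.subtree.erase hv hq
  · rw [hR₁]
    intro w hw
    rw [hdeg]
    split_ifs with hwq
    · rw [hwq, nbrs_erase, Finset.card_erase_of_mem hvq, hcard]
    · rw [nbrs_erase_of_ne (Finset.mem_of_mem_erase hw) hq hwq,
        h.deg_eq w (Finset.mem_of_mem_erase hw)]
  · rw [hR₁]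
    intro w hw
    rw [hsum]
    split_ifs with hwq
    · rw [hwq, nbrs_erase, h.sum_eq q hqR, ← Finset.add_sum_erase _ _ hvq, Nat.add_sub_cancel_left]
    · rw [nbrs_erase_of_ne (Finset.mem_of_mem_erase hw) hq hwq,
        h.sum_eq w (Finset.mem_of_mem_erase hw)]
  · rw [hR₁]
    intro w hw
    have hwR := Finset.mem_of_mem_erase hw
    have hwv := Finset.ne_of_mem_erase hw
    have hold : (∃ k, i + 1 ≤ k ∧ k < t ∧ ord' k = w) ↔ (nbrs H R w).card ≤ 1 := by
      rw [← h.queue w hwR]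
      constructor
      · rintro ⟨k, h₁, h₂, h₃⟩; exact ⟨k, by omega, h₂, by rw [← hord k h₂, h₃]⟩
      · rintro ⟨k, h₁, h₂, h₃⟩
        refine ⟨k, ?_, h₂, by rw [hord k h₂, h₃]⟩
        rcases h₁.lt_or_eq with h₁ | rfl
        · exact h₁
        · exact absurd h₃.symm hwv
    have hsplit : (∃ k, i + 1 ≤ k ∧ k < t' ∧ ord' k = w) ↔
        (nbrs H R w).card ≤ 1 ∨ (deg q = 2 ∧ w = q) := by
      rw [← hold]
      constructor
      · rintro ⟨k, h₁, h₂, h₃⟩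
        rcases lt_or_ge k t with hkt | hkt
        · exact .inl ⟨k, h₁, hkt, h₃⟩
        · by_cases h2 : deg q = 2
          · rw [if_pos h2] at ht
            obtain rfl : k = t := by omega
            exact .inr ⟨h2, by rw [← h₃, hord' h2]⟩
          · rw [if_neg h2] at ht; omega
      · rintro (⟨k, h₁, h₂, h₃⟩ | ⟨h2, rfl⟩)
        · exact ⟨k, h₁, by omega, h₃⟩
        · exact ⟨t, by omega, by rw [ht, if_pos h2]; omega, hord' h2⟩
    rw [hsplit]
    by_cases hwq : w = q
    · have := Finset.card_pos.2 ⟨v, hvq⟩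
      rw [hwq, nbrs_erase, Finset.card_erase_of_mem hvq, hcard]
      simp only [and_true]; omega
    · rw [nbrs_erase_of_ne hwR hq hwq]; simp [hwq]
  · intro k hk
    rw [hR' k (by omega), hord k (by omega), hpar]
    rcases (Nat.lt_succ_iff.1 hk).lt_or_eq with hk | rfl
    · rw [if_neg (h.ord_ne hk hit)]; exact h.par_eq k hk
    · rw [if_pos rfl]; exact hq

theorem length_eq (h : Stripped H L i t ord par deg sum) (hi : i + 1 = L) : t = L := by
  have := h.lt_length
  have := Finset.card_le_card (show (Finset.range t).image ord ⊆ Finset.range L from fun v hv => by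
    obtain ⟨k, hk, rfl⟩ := Finset.mem_image.1 hv
    exact Finset.mem_range.2 (h.lt k (Finset.mem_range.1 hk)))
  rw [Finset.card_image_of_injOn h.inj, Finset.card_range, Finset.card_range] at this
  omega

theorem exists_ord_eq (h : Stripped H L i t ord par deg sum) (hi : i + 1 = L) {v : ℕ}
    (hv : v < L) : ∃ k < L, ord k = v := by
  obtain rfl := h.length_eq hi
  have hs := Finset.eq_of_subset_of_card_le (show (Finset.range t).image ord ⊆ Finset.range t from
    fun v hv => by
      obtain ⟨k, hk, rfl⟩ := Finset.mem_image.1 hv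
      exact Finset.mem_range.2 (h.lt k (Finset.mem_range.1 hk)))
    (by rw [Finset.card_image_of_injOn h.inj])
  have : v ∈ (Finset.range t).image ord := by rw [hs]; exact Finset.mem_range.2 hv
  obtain ⟨k, hk, e⟩ := Finset.mem_image.1 this
  exact ⟨k, Finset.mem_range.1 hk, e⟩

/-- The parent was still present when its child was removed, so it comes later in the order. -/
theorem exists_parent (h : Stripped H L i t ord par deg sum) (hi : i + 1 = L) {k : ℕ}
    (hk : k < i) : ∃ l, k < l ∧ l < L ∧ ord l = par (ord k) := by
  have hm : par (ord k) ∈ nbrs H (remaining L ord k) (ord k) := by rw [h.par_eq k hk]; simp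
  obtain ⟨h₁, h₂⟩ := mem_nbrs.1 hm
  obtain ⟨l, hl, e⟩ := h.exists_ord_eq hi (mem_remaining.1 h₁).1
  refine ⟨l, ?_, hl, e⟩
  rcases lt_trichotomy k l with hkl | rfl | hkl
  · exact hkl
  · rw [← e] at h₂; exact absurd h₂ (H.irrefl)
  · exact absurd e ((mem_remaining.1 h₁).2 l hkl)

/-- A later node was still present when `ord k` was removed, and at that time `ord k` had its parent
as its only neighbour. -/
theorem adj_iff (h : Stripped H L i t ord par deg sum) (hi : i + 1 = L) {k l : ℕ} (hkl : k < l)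
    (hl : l < L) : H.Adj (ord k) (ord l) ↔ ord l = par (ord k) := by
  have ht := h.length_eq hi
  have hm : ord l ∈ nbrs H (remaining L ord k) (ord k) ↔ ord l = par (ord k) := by
    rw [h.par_eq k (by omega), Finset.mem_singleton]
  rw [← hm, mem_nbrs]
  exact (and_iff_right (h.ord_mem hkl.le (by omega))).symm

end Stripped

end Elimination

/-! ### Degrees and neighbour sums from the list of edges -/

namespace Elimination

variable {H : SimpleGraph ℕ} {L : ℕ}

/-- The graph `G` with the nodes read as natural numbers. -/
abbrev natGraph (G : SimpleGraph (Fin L)) : SimpleGraph ℕ := G.map Fin.valEmbedding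

theorem natGraph_adj {G : SimpleGraph (Fin L)} {a b : Fin L} :
    (natGraph G).Adj a b ↔ G.Adj a b :=
  SimpleGraph.map_adj_apply (f := Fin.valEmbedding)

theorem sum_nbrs (G : SimpleGraph (Fin L)) (φ : ℕ → ℕ) (v : Fin L) (c : Fin L → Prop)
    [DecidablePred c] (hc : ∀ w, G.Adj v w ↔ c w) :
    ∑ w ∈ nbrs (natGraph G) (Finset.range L) v, φ w = ∑ w : Fin L, if c w then φ w else 0 := by
  classical
  rw [nbrs, Finset.sum_filter, Finset.sum_range]
  refine Finset.sum_congr rfl fun w _ => ?_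
  by_cases h : c w
  · rw [if_pos h, if_pos (natGraph_adj.2 ((hc w).2 h))]
  · rw [if_neg h, if_neg fun h' => h ((hc w).1 (natGraph_adj.1 h'))]

/-- A walk from a node of `S` to a node outside `S` crosses the boundary. The degree condition is
the handshake lemma combined with the number of edges of a tree. -/
theorem subtree_range {G : SimpleGraph (Fin L)} (hG : G.IsTree) :
    Subtree (natGraph G) (Finset.range L) := by
  classical
  constructor
  · intro S hS ⟨u, hu⟩ hne
    obtain ⟨w, hw, hwS⟩ : ∃ w ∈ Finset.range L, w ∉ S := by
      by_contra! h
      exact hne (Finset.Subset.antisymm hS h)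
    have hu' := Finset.mem_range.1 (hS hu)
    rw [Finset.mem_range] at hw
    obtain ⟨p⟩ := hG.connected.preconnected ⟨u, hu'⟩ ⟨w, hw⟩
    obtain ⟨d, -, hd₁, hd₂⟩ := p.exists_boundary_dart {a | (a : ℕ) ∈ S} hu hwS
    exact ⟨d.fst, hd₁, d.snd, by simpa using hd₂, natGraph_adj.2 d.adj⟩
  · have h₁ := G.sum_degrees_eq_twice_card_edges
    have h₂ := hG.card_edgeFinset
    rw [Finset.sum_range]
    rw [Finset.sum_congr rfl fun v _ => show _ = G.degree v by
      rw [Finset.card_eq_sum_ones, sum_nbrs G (fun _ => 1) v _ fun _ => Iff.rfl,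
        ← Finset.sum_filter, ← Finset.card_eq_sum_ones, ← SimpleGraph.card_neighborFinset_eq_degree,
        SimpleGraph.neighborFinset_eq_filter], h₁, Finset.card_range]
    rw [Fintype.card_fin] at h₂
    omega

/-- The sum of `φ` over the neighbours of `v` that the listed edges provide. -/
def edgeSum (φ : ℕ → ℕ) (v : ℕ) (E : List (Fin L × Fin L)) : ℕ :=
  (E.map fun e => (if (e.1 : ℕ) = v then φ e.2 else 0) + if (e.2 : ℕ) = v then φ e.1 else 0).sum

theorem edgeSum_take_succ (φ : ℕ → ℕ) (v : ℕ) (E : List (Fin L × Fin L)) {m : ℕ}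
    (hm : m < E.length) : edgeSum φ v (E.take (m + 1)) = edgeSum φ v (E.take m) +
      ((if (E[m].1 : ℕ) = v then φ E[m].2 else 0) + if (E[m].2 : ℕ) = v then φ E[m].1 else 0) := by
  rw [List.take_succ_eq_append_getElem hm, edgeSum, List.map_append, List.sum_append]
  simp [edgeSum]

/-- Each neighbour is provided by exactly one listed edge, in exactly one orientation, as there are
no repetitions and no loops. Constant `φ = 1` yields degrees, and the identity yields neighbour
sums. -/
theorem edgeSum_eq (φ : ℕ → ℕ) (v : Fin L) {E : List (Fin L × Fin L)}
    (hE : (E.map fun e => s(e.1, e.2)).Nodup) (hne : ∀ e ∈ E, e.1 ≠ e.2) :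
    edgeSum φ v E = ∑ w : Fin L, if s(v, w) ∈ E.map (fun e => s(e.1, e.2)) then φ w else 0 := by
  induction E with
  | nil => simp [edgeSum]
  | cons e E ih =>
    rw [List.map_cons, List.nodup_cons] at hE
    have h := ih hE.2 fun e he => hne e (List.mem_cons_of_mem _ he)
    have he := hne e List.mem_cons_self
    rw [edgeSum, List.map_cons, List.sum_cons, ← edgeSum, h]
    have key : ∀ w : Fin L, (if s(v, w) ∈ (e :: E).map (fun e => s(e.1, e.2)) then φ w else 0) =
        ((if e.2 = w then (if e.1 = v then φ w else 0) else 0) +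
          if e.1 = w then (if e.2 = v then φ w else 0) else 0) +
        if s(v, w) ∈ E.map (fun e => s(e.1, e.2)) then φ w else 0 := by
      intro w
      have hE' := hE.1
      simp only [List.map_cons, List.mem_cons]
      by_cases h₁ : s(v, w) = s(e.1, e.2)
      · rw [if_pos (.inl h₁), if_neg (c := _ ∈ _) (by rw [h₁]; exact hE')]
        rcases Sym2.eq_iff.1 h₁ with ⟨rfl, rfl⟩ | ⟨rfl, rfl⟩
        · simp [he]
        · simp [he.symm]
      · have h₂ : ¬ (e.2 = w ∧ e.1 = v) := fun h => h₁ (by rw [h.1, h.2])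
        have h₃ : ¬ (e.1 = w ∧ e.2 = v) := fun h => h₁ (by rw [h.1, h.2, Sym2.eq_swap])
        rw [← ite_and, ← ite_and, if_neg h₂, if_neg h₃, zero_add, zero_add]
        exact if_congr (or_iff_right h₁) rfl rfl
    rw [Finset.sum_congr rfl fun w _ => key w, Finset.sum_add_distrib, Finset.sum_add_distrib,
      Finset.sum_ite_eq, Finset.sum_ite_eq]
    simp [Fin.ext_iff]

theorem edgeSum_eq_sum_nbrs {G : SimpleGraph (Fin L)} {E : List (Fin L × Fin L)}
    (hE : GraphMask.IsEdgeList G E) (φ : ℕ → ℕ) {v : ℕ} (hv : v < L) :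
    edgeSum φ v E = ∑ w ∈ nbrs (natGraph G) (Finset.range L) v, φ w := by
  rw [sum_nbrs G φ ⟨v, hv⟩ _ (hE.2 _)]
  refine edgeSum_eq φ ⟨v, hv⟩ hE.1 fun e he h => ?_
  have := (hE.2 e.1 e.2).2 (List.mem_map.2 ⟨e, he, rfl⟩)
  exact this.ne h

end Elimination

/-! ### Programs that root the tree and fill the tables -/

namespace RealRAM

open Elimination

notation "bSrc" => 1
notation "bTgt" => 2

/-- Computes the degree of each node and the sum of its neighbours. -/
def edgePass : Program :=
  forTo vI nat[bIn, 1] (setVar vU nat[bSrc, var vI] ;; setVar vQ nat[bTgt, var vI] ;;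
    .setNat bDeg (var vU) (nat[bDeg, var vU] + 1) ;;
    .setNat bDeg (var vQ) (nat[bDeg, var vQ] + 1) ;;
    .setNat bSum (var vU) (nat[bSum, var vU] + var vQ) ;;
    .setNat bSum (var vQ) (nat[bSum, var vQ] + var vU))

/-- Lists the nodes of degree at most one. -/
def leafPass : Program :=
  setVar vTail 0 ;; forTo vI len (.ifLt nat[bDeg, var vI] 2
    (.setNat bOrd (var vTail) (var vI) ;; setVar vTail (var vTail + 1)) .skip)

/-- Removes leaves one after the other, recording the only neighbour of each. -/
def stripPass : Program :=
  forTo vI (len - 1) (setVar vU nat[bOrd, var vI] ;; setVar vQ nat[bSum, var vU] ;;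
    .setNat bPar (var vU) (var vQ) ;;
    .ifLt nat[bDeg, var vQ] 3 (.ifLt 1 nat[bDeg, var vQ]
      (.setNat bOrd (var vTail) (var vQ) ;; setVar vTail (var vTail + 1)) .skip) .skip ;;
    .setNat bDeg (var vQ) (nat[bDeg, var vQ] - 1) ;;
    .setNat bSum (var vQ) (nat[bSum, var vQ] - var vU))

/-- Computes the position of each node in the order of removal. -/
def positionPass : Program := forTo vI len (.setNat bPos nat[bOrd, var vI] (var vI))

/-- Computes the parent of each position. -/
def upPass : Program :=
  forTo vI (len - 1) (.setNat bUp (var vI) nat[bPos, nat[bPar, nat[bOrd, var vI]]]) ;;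
  .setNat bUp (len - 1) len ;; .setNat bRem len 1

/-- Computes the offsets of the blocks of a two-dimensional array. -/
def offsetPass : Program :=
  forTo vI len (.setNat bOff (var vI + 1) (nat[bOff, var vI] + (len + 1)))

/-- Computes the roots of unity. -/
def twiddlePass : Program :=
  .setReal rTwRe 1 (.lit 1) ;; .setReal rTwIm 1 (.lit 0) ;;
  forTo vI (len + len + len + len + 4) (setVar vJ (var vI + 1) ;;
    .setReal rTwRe (var vJ + var vJ) (.sqrt ((.lit 1 + real[rTwRe, var vJ]) * .lit (1 / 2))) ;;
    .setReal rTwIm (var vJ + var vJ) (.sqrt ((.lit 1 - real[rTwRe, var vJ]) * .lit (1 / 2))) ;;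
    .setReal rTwRe (var vJ + var vJ + 1)
      (.lit 0 - .sqrt ((.lit 1 - real[rTwRe, var vJ]) * .lit (1 / 2))) ;;
    .setReal rTwIm (var vJ + var vJ + 1) (.sqrt ((.lit 1 + real[rTwRe, var vJ]) * .lit (1 / 2))))

section setup

variable {L : ℕ} {s : Memory}

theorem edgePass_runs {E : List (Fin L × Fin L)} (hL : E.length ≤ L)
    (f : ℝ → ℝ) (x : Fin L → ℝ) :
    RunsIn (L + 1) edgePass (GraphMask.input E f x) fun s' => ∀ v,
      s'.nat bDeg v = edgeSum (fun _ => 1) v E ∧ s'.nat bSum v = edgeSum (fun w => w) v E := by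
  refine RunsIn.mono (RunsIn.forTo_loopFree E.length (fun m s' => ∀ v,
      s'.nat bDeg v = edgeSum (fun _ => 1) v (E.take m) ∧
      s'.nat bSum v = edgeSum (fun w => w) v (E.take m)) rfl (by decide)
    (fun s' hf => ?_) (fun v => ?_) ?_ le_rfl) (by omega) fun s' _ h => by simpa using h
  · have := hf.nat bIn (by decide)
    simp [this, GraphMask.input]
  · simp [GraphMask.input, edgeSum]
  · intro m hm s' hf hv hI v
    have h₁ : s'.nat bSrc m = E[m].1 := by rw [hf.nat bSrc (by decide)]; simp [GraphMask.input, hm]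
    have h₂ : s'.nat bTgt m = E[m].2 := by rw [hf.nat bTgt (by decide)]; simp [GraphMask.input, hm]
    rw [edgeSum_take_succ _ _ _ hm, edgeSum_take_succ _ _ _ hm, ← (hI v).1, ← (hI v).2]
    simp only [Program.run, NExp.eval_add, NExp.eval_get, NExp.eval_ofNat, Memory.writeNat_nat]
    norm_num [hv, h₁, h₂]
    generalize (E[m].1 : ℕ) = a
    generalize (E[m].2 : ℕ) = b
    rcases eq_or_ne v a with rfl | c₁ <;> rcases eq_or_ne v b with rfl | c₂
    · simp; omega
    · simp [c₂, c₂.symm]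
    · simp [c₁, c₁.symm]
    · simp [c₁, c₂, c₁.symm, c₂.symm]

theorem leafPass_runs (hlen : s.nat bIn 0 = L) :
    RunsIn (L + 1) leafPass s fun s' => ∃ t, s'.nat vTail 0 = t ∧ (∀ k < t, s'.nat bOrd k < L) ∧
      Set.InjOn (s'.nat bOrd) (Finset.range t) ∧
      ∀ v < L, (∃ k < t, s'.nat bOrd k = v) ↔ s.nat bDeg v ≤ 1 := by
  refine .seq (Q₁ := fun s₁ => s₁.nat vTail 0 = 0) (.loopFree rfl (by simp [Program.run]) (by omega))
    fun s₁ f₁ h₁ => ?_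
  refine RunsIn.mono (RunsIn.forTo_loopFree L (fun m s' => ∃ t, s'.nat vTail 0 = t ∧
      (∀ k < t, s'.nat bOrd k < m) ∧ (∀ l < t, ∀ k < l, s'.nat bOrd k ≠ s'.nat bOrd l) ∧
      ∀ v < m, (∃ k < t, s'.nat bOrd k = v) ↔ s.nat bDeg v ≤ 1) rfl (by decide)
    (fun s' hf => ?_) ⟨0, by simpa using h₁, by simp, by simp, by simp⟩ ?_ le_rfl) le_rfl ?_
  · have := hf.nat bIn (by decide)
    have := f₁.nat bIn (by decide)
    simp_all
  · rintro m hm s' hf hv ⟨t, i₁, i₂, i₃, i₄⟩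
    have hd : s'.nat bDeg = s.nat bDeg := by rw [hf.nat bDeg (by decide), f₁.nat bDeg (by decide)]
    by_cases hc : s.nat bDeg m < 2
    · have e : ∀ k, ((((Program.ifLt nat[bDeg, var vI] 2 (.setNat bOrd (var vTail) (var vI) ;;
          setVar vTail (var vTail + 1)) .skip).run s').writeNat vI 0 (m + 1)).nat bOrd k) =
          if k = t then m else s'.nat bOrd k := by
        intro k
        simp [Program.run, hv, hd, hc, i₁]
      refine ⟨t + 1, by simp [Program.run, hv, hd, hc, i₁], fun k hk => ?_, fun l hl k hk => ?_,
        fun v hvm => ?_⟩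
      · rw [e]
        split_ifs with h
        · omega
        · have := i₂ k (by omega); omega
      · rw [e, e, if_neg (by omega)]
        have := i₂ k (by omega)
        split_ifs with h
        · omega
        · exact i₃ l (by omega) k hk
      · simp only [e]
        rcases Nat.lt_succ_iff_lt_or_eq.1 hvm with hvm | rfl
        · rw [← i₄ v hvm]
          constructor
          · rintro ⟨k, hk, h⟩
            split_ifs at h with hkt
            · omega
            · exact ⟨k, by omega, h⟩
          · rintro ⟨k, hk, h⟩
            exact ⟨k, by omega, by rw [if_neg (by omega), h]⟩
        · exact ⟨fun _ => by omega, fun _ => ⟨t, by omega, by simp⟩⟩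
    · have e : ∀ a k, ((((Program.ifLt nat[bDeg, var vI] 2 (.setNat bOrd (var vTail) (var vI) ;;
          setVar vTail (var vTail + 1)) .skip).run s').writeNat vI 0 (m + 1)).nat a k) =
          if a = vI ∧ k = 0 then m + 1 else s'.nat a k := by
        intro a k
        simp [Program.run, hv, hd, hc]
      simp only [e]
      refine ⟨t, by simp [i₁], fun k hk => ?_, fun l hl k hk => ?_, fun v hvm => ?_⟩
      · have := i₂ k hk
        simp; omega
      · simpa using i₃ l hl k hk
      · rcases Nat.lt_succ_iff_lt_or_eq.1 hvm with hvm | rfl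
        · simpa using i₄ v hvm
        · refine ⟨?_, fun h => by omega⟩
          rintro ⟨k, hk, h⟩
          have := i₂ k hk
          simp at h; omega
  · rintro s' - ⟨t, i₁, i₂, i₃, i₄⟩
    refine ⟨t, i₁, i₂, fun k hk l hl e => ?_, i₄⟩
    simp only [Finset.coe_range, Set.mem_Iio] at hk hl
    rcases lt_trichotomy k l with h | h | h
    · exact absurd e (i₃ l hl k h)
    · exact h
    · exact absurd e.symm (i₃ k hk l h)

theorem stripPass_runs {H : SimpleGraph ℕ} {t : ℕ} (hlen : s.nat bIn 0 = L)
    (ht : s.nat vTail 0 = t)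
    (hs : Stripped H L 0 t (s.nat bOrd) (s.nat bPar) (s.nat bDeg) (s.nat bSum)) :
    RunsIn (L + 1) stripPass s fun s' => ∃ t,
      Stripped H L (L - 1) t (s'.nat bOrd) (s'.nat bPar) (s'.nat bDeg) (s'.nat bSum) := by
  refine RunsIn.mono (RunsIn.forTo_loopFree (L - 1) (fun m s' => ∃ t, s'.nat vTail 0 = t ∧
      Stripped H L m t (s'.nat bOrd) (s'.nat bPar) (s'.nat bDeg) (s'.nat bSum)) rfl (by decide)
    (fun s' hf => ?_) ⟨t, by simpa using ht, by simpa [Memory.writeNat] using hs⟩ ?_ le_rfl) (by omega) ?_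
  · have := hf.nat bIn (by decide)
    simp [this, hlen]
  · rintro m hm s' hf hv ⟨t, ht, h⟩
    have hmt := h.lt_length
    refine ⟨if s'.nat bDeg (s'.nat bSum (s'.nat bOrd m)) = 2 then t + 1 else t, ?_,
      h.step (by omega) (fun w => ?_) (fun w => ?_) (fun w => ?_) rfl (fun k hk => ?_) fun h2 => ?_⟩
    -- The two tests of the program single out degree two among the cases below, equal and above.
    all_goals
      rcases lt_trichotomy (s'.nat bDeg (s'.nat bSum (s'.nat bOrd m))) 2 with c | c | c
      · have c₁ : s'.nat bDeg (s'.nat bSum (s'.nat bOrd m)) < 3 := by omega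
        have c₂ : ¬ 1 < s'.nat bDeg (s'.nat bSum (s'.nat bOrd m)) := by omega
        simp [Program.run, hv, ht, c₁, c₂, c.ne]
        try omega
      · simp [Program.run, hv, ht, c]
        try omega
      · have c₁ : ¬ s'.nat bDeg (s'.nat bSum (s'.nat bOrd m)) < 3 := by omega
        simp [Program.run, hv, ht, c₁, c.ne']
        try omega
  · rintro s' - ⟨t, -, h⟩
    exact ⟨t, h⟩

theorem positionPass_runs (hlen : s.nat bIn 0 = L)
    (hinj : Set.InjOn (s.nat bOrd) (Finset.range L)) :
    RunsIn (L + 1) positionPass s fun s' => ∀ k < L, s'.nat bPos (s.nat bOrd k) = k := by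
  refine RunsIn.mono (RunsIn.forTo_loopFree L (fun m s' => ∀ k < m, s'.nat bPos (s.nat bOrd k) = k)
    rfl (by decide) (fun s' hf => ?_) (by simp) ?_ le_rfl) le_rfl fun _ _ h => h
  · have := hf.nat bIn (by decide)
    simp [this, hlen]
  · intro m hm s' hf hv hI k hk
    have := hf.nat bOrd (by decide)
    simp only [Program.run, NExp.eval_get, NExp.eval_ofNat, Memory.writeNat_nat, hv, this]
    by_cases hkm : k = m
    · simp [hkm]
    · have : s.nat bOrd k ≠ s.nat bOrd m := fun e => hkm (hinj (by simp; omega) (by simpa) e)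
      simpa [this] using hI k (by omega)

/-- The root gets the sentinel `L` as its parent, and the sentinel is marked as removed, so that the
scans treat the root like any node with an inactive parent. -/
theorem upPass_runs (hL : 1 ≤ L) (hlen : s.nat bIn 0 = L) (hrem : s.nat bRem = 0) :
    RunsIn (L + 1) upPass s fun s' => (∀ k < L, s'.nat bUp k =
      if k + 1 = L then L else s.nat bPos (s.nat bPar (s.nat bOrd k))) ∧
      Active (Finset.range L) L s' := by
  refine .seq (Q₁ := fun s' => ∀ k < L - 1, s'.nat bUp k = s.nat bPos (s.nat bPar (s.nat bOrd k))) ?_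
    fun s₁ f₁ h₁ => ?_
  · refine RunsIn.mono (RunsIn.forTo_loopFree (L - 1) (fun m s' => ∀ k < m, s'.nat bUp k =
      s.nat bPos (s.nat bPar (s.nat bOrd k))) rfl (by decide) (fun s' hf => ?_) (by simp) ?_ le_rfl)
      (by omega) fun _ _ h => h
    · have := hf.nat bIn (by decide)
      simp [this, hlen]
    · intro m hm s' hf hv hI k hk
      have h₁ := hf.nat bOrd (by decide)
      have h₂ := hf.nat bPar (by decide)
      have h₃ := hf.nat bPos (by decide)
      by_cases hkm : k = m
      · simp [Program.run, hv, h₁, h₂, h₃, hkm]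
      · simpa [Program.run, hv, hkm] using hI k (by omega)
  · have hl : s₁.nat bIn 0 = L := by rw [f₁.nat bIn (by decide), hlen]
    have hr : s₁.nat bRem = 0 := by rw [f₁.nat bRem (by decide), hrem]
    refine .loopFree rfl ⟨fun k hk => ?_, fun k hk => ?_⟩ (by omega)
    · split_ifs with h
      · have : k = L - 1 := by omega
        simp [Program.run, hl, this]
      · have : k ≠ L - 1 := by omega
        simpa [Program.run, hl, this] using h₁ k (by omega)
    · simp [Program.run, hl, hr]; omega

/-- Natural numbers cannot be multiplied in unit time, so the multiples of `L + 1` are tabulated by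
repeated addition. -/
theorem offsetPass_runs (hlen : s.nat bIn 0 = L) (h0 : s.nat bOff 0 = 0) :
    RunsIn (L + 1) offsetPass s fun s' => ∀ k < L, s'.nat bOff k = k * (L + 1) := by
  refine RunsIn.mono (RunsIn.forTo_loopFree L (fun m s' => ∀ k ≤ m, s'.nat bOff k = k * (L + 1))
    rfl (by decide) (fun s' hf => ?_) (by simpa using h0) ?_ le_rfl) le_rfl
    fun _ _ h k hk => h k hk.le
  · have := hf.nat bIn (by decide)
    simp [this, hlen]
  · intro m hm s' hf hv hI k hk
    have hl : s'.nat bIn 0 = L := by rw [hf.nat bIn (by decide), hlen]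
    by_cases hkm : k = m + 1
    · simp [Program.run, hv, hl, hkm, hI m le_rfl]; ring
    · simpa [Program.run, hv, hkm] using hI k (by omega)

theorem twiddlePass_runs (hlen : s.nat bIn 0 = L) :
    RunsIn (8 * (L + 1)) twiddlePass s (TwiddleReady (8 * (L + 1))) := by
  refine .seq (Q₁ := fun s₁ => s₁.real rTwRe 1 = 1) (.loopFree rfl (by simp [Program.run])
    (by omega)) fun s₁ f₁ h₁ => ?_
  refine .seq (Q₁ := fun s₁ => s₁.cx rTwRe rTwIm 1 = 1) (.loopFree rfl
    (by apply Complex.ext <;> simp [Program.run, Memory.cx, h₁]) (by omega)) fun s₂ f₂ h₂ => ?_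
  -- Step `m` computes the two children of index `m + 1`, which is already in the table. Indices up
  -- to `8 * (L + 1)` suffice, because blocks have at most `L + 1` cells and transforms are shorter
  -- than eight times the block.
  refine RunsIn.mono (RunsIn.forTo_loopFree (4 * L + 4)
    (fun m s' => TwiddleReady (2 * (m + 1)) s') rfl (by decide) (fun s' hf => ?_) ?_ ?_ le_rfl)
    (by omega) fun _ _ h t h₁ h₂ => h t h₁ (by omega)
  · have : s'.nat bIn 0 = L := by
      rw [hf.nat bIn (by decide), f₂.nat bIn (by decide), f₁.nat bIn (by decide), hlen]
    simp [this]; omega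
  · intro t h₁ h₃
    obtain rfl : t = 1 := by omega
    rw [FFT.twiddle_one]; exact h₂
  · intro m hm s' hf hv hI t ht₁ ht₂
    have hre : s'.real rTwRe (m + 1) = (FFT.twiddle (m + 1)).re := by
      rw [← hI (m + 1) (by omega) (by omega)]; rfl
    rcases lt_or_ge t (2 * (m + 1)) with h | h
    · rw [← hI t ht₁ h]
      have e₁ : t ≠ m + 1 + (m + 1) := by omega
      have e₂ : t ≠ m + 1 + (m + 1) + 1 := by omega
      simp [Program.run, hv, Memory.cx, e₁, e₂]
    · have n₁ : m + 1 ≠ m + 1 + (m + 1) := by omega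
      have n₂ : m ≠ m + 1 + (m + 1) := by omega
      rcases (show t = 2 * (m + 1) ∨ t = 2 * (m + 1) + 1 by omega) with rfl | rfl
      · rw [FFT.twiddle_two_mul (by omega), two_mul]
        apply Complex.ext <;> simp [Program.run, hv, Memory.cx, hre, n₂]
      · rw [FFT.twiddle_two_mul_add_one (by omega), two_mul]
        apply Complex.ext <;> simp [Program.run, hv, Memory.cx, hre, n₂]

end setup

end RealRAM

/-! ### The complete program -/

namespace RealRAM

open Elimination ParentTree

/-- Reads the tree and computes the tables. -/
def setup : Program :=
  edgePass ;; leafPass ;; stripPass ;; positionPass ;; upPass ;; offsetPass ;; twiddlePass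

/-- Multiplies the mask of a tree and a vector. -/
def multiply : Program := setup ;; allRounds

/-- The nodes in the order `ord`, with the parent function `P`, form the tree `G`. -/
structure IsOrder {L : ℕ} (G : SimpleGraph (Fin L)) (P ord : ℕ → ℕ) : Prop where
  parent : IsParent P L
  parent_le : ∀ i < L, P i ≤ L
  lt : ∀ i < L, ord i < L
  inj : Set.InjOn ord (Finset.range L)
  adj : ∀ k l, k < l → l < L → ((natGraph G).Adj (ord k) (ord l) ↔ P k = l)

section setup

variable {L : ℕ} {G : SimpleGraph (Fin L)} {E : List (Fin L × Fin L)}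

theorem length_edgeList (hG : G.IsTree) (hE : GraphMask.IsEdgeList G E) : E.length ≤ L := by
  classical
  have h₁ := hG.card_edgeFinset
  have h₂ : (E.map fun e => s(e.1, e.2)).toFinset = G.edgeFinset := by
    ext e
    induction e with
    | h a b => rw [List.mem_toFinset, ← hE.2, SimpleGraph.mem_edgeFinset, SimpleGraph.mem_edgeSet]
  rw [← h₂, List.toFinset_card_of_nodup hE.1, List.length_map, Fintype.card_fin] at h₁
  omega

theorem setup_runs (hL : 1 ≤ L) (hG : G.IsTree) (hE : GraphMask.IsEdgeList G E) (f : ℝ → ℝ)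
    (x : Fin L → ℝ) :
    RunsIn (8 * (L + 1)) setup (GraphMask.input E f x) fun s' => ∃ P ord, IsOrder G P ord ∧
      TreeReady P ord ((GraphMask.input E f x).real rF) ((GraphMask.input E f x).real rX) L s' ∧
      Active (Finset.range L) L s' ∧ ∀ a, s'.real rY a = 0 := by
  have hW : L + 1 ≤ 8 * (L + 1) := by omega
  set s := GraphMask.input E f x with hs
  have l₀ : s.nat bIn 0 = L := rfl
  have r₀ : s.nat bRem = 0 := rfl
  have o₀ : s.nat bOff 0 = 0 := rfl
  have y₀ : ∀ a, s.real rY a = 0 := fun _ => rfl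
  refine .seq ((edgePass_runs (length_edgeList hG hE) f x).mono hW fun _ _ h => h)
    fun s₁ f₁ e₁ => ?_
  have l₁ : s₁.nat bIn 0 = L := by rw [f₁.nat _ (by decide), l₀]
  refine .seq ((leafPass_runs l₁).mono hW fun _ _ h => h) fun s₂ f₂ ⟨t, t₂, lt₂, inj₂, q₂⟩ => ?_
  have l₂ : s₂.nat bIn 0 = L := by rw [f₂.nat _ (by decide), l₁]
  have hrem : ∀ o, remaining L o 0 = Finset.range L := fun o => by simp [remaining]
  have hdeg : ∀ v < L, s₁.nat bDeg v = (nbrs (natGraph G) (Finset.range L) v).card := fun v hv => by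
    rw [(e₁ v).1, edgeSum_eq_sum_nbrs hE _ hv, Finset.card_eq_sum_ones]
  have hsum : ∀ v < L, s₁.nat bSum v = ∑ w ∈ nbrs (natGraph G) (Finset.range L) v, w :=
    fun v hv => by rw [(e₁ v).2, edgeSum_eq_sum_nbrs hE _ hv]
  have S₂ : Stripped (natGraph G) L 0 t (s₂.nat bOrd) (s₂.nat bPar) (s₂.nat bDeg) (s₂.nat bSum) := by
    rw [f₂.nat bDeg (by decide), f₂.nat bSum (by decide)]
    refine ⟨Nat.zero_le _, lt₂, inj₂, ?_, ?_, ?_, ?_, by simp⟩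
    · rw [hrem]; exact subtree_range hG
    · rw [hrem]; exact fun v hv => hdeg v (Finset.mem_range.1 hv)
    · rw [hrem]; exact fun v hv => hsum v (Finset.mem_range.1 hv)
    · rw [hrem]
      intro v hv
      rw [← hdeg v (Finset.mem_range.1 hv), ← q₂ v (Finset.mem_range.1 hv)]
      simp
  refine .seq ((stripPass_runs l₂ t₂ S₂).mono hW fun _ _ h => h) fun s₃ f₃ ⟨t', S₃⟩ => ?_
  have l₃ : s₃.nat bIn 0 = L := by rw [f₃.nat _ (by decide), l₂]
  have hi : L - 1 + 1 = L := by omega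
  rw [S₃.length_eq hi] at S₃
  refine .seq ((positionPass_runs l₃ S₃.inj).mono hW fun _ _ h => h) fun s₄ f₄ p₄ => ?_
  have l₄ : s₄.nat bIn 0 = L := by rw [f₄.nat _ (by decide), l₃]
  have r₄ : s₄.nat bRem = 0 := by
    rw [f₄.nat _ (by decide), f₃.nat _ (by decide), f₂.nat _ (by decide), f₁.nat _ (by decide), r₀]
  refine .seq ((upPass_runs hL l₄ r₄).mono hW fun _ _ h => h) fun s₅ f₅ ⟨u₅, a₅⟩ => ?_
  have l₅ : s₅.nat bIn 0 = L := by rw [f₅.nat _ (by decide), l₄]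
  have o₅ : s₅.nat bOff 0 = 0 := by
    rw [f₅.nat _ (by decide), f₄.nat _ (by decide), f₃.nat _ (by decide), f₂.nat _ (by decide),
      f₁.nat _ (by decide), o₀]
  refine .seq ((offsetPass_runs l₅ o₅).mono hW fun _ _ h => h) fun s₆ f₆ o₆ => ?_
  have l₆ : s₆.nat bIn 0 = L := by rw [f₆.nat _ (by decide), l₅]
  refine (twiddlePass_runs l₆).mono le_rfl fun s₇ f₇ w₇ => ?_
  have hreal : ∀ b ∈ [rF, rX, rY], s₇.real b = s.real b := fun b hb => by
    rw [f₇.real _ (by revert b; decide), f₆.real _ (by revert b; decide),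
      f₅.real _ (by revert b; decide), f₄.real _ (by revert b; decide),
      f₃.real _ (by revert b; decide), f₂.real _ (by revert b; decide),
      f₁.real _ (by revert b; decide)]
  have hup : ∀ k < L, s₇.nat bUp k =
      if k + 1 = L then L else s₄.nat bPos (s₃.nat bPar (s₃.nat bOrd k)) := by
    rw [f₇.nat _ (by decide), f₆.nat _ (by decide), ← f₄.nat bPar (by decide),
      ← f₄.nat bOrd (by decide)]
    exact u₅
  have hpar : ∀ k, k + 1 < L → ∃ l, k < l ∧ l < L ∧ s₃.nat bOrd l = s₃.nat bPar (s₃.nat bOrd k) ∧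
      s₇.nat bUp k = l := fun k hk => by
    obtain ⟨l, h₁, h₂, h₃⟩ := S₃.exists_parent hi (show k < L - 1 by omega)
    exact ⟨l, h₁, h₂, h₃, by rw [hup k (by omega), if_neg (by omega), ← h₃, p₄ l h₂]⟩
  -- `IsParent` demands `i < P i` for all natural numbers, so the table is continued by the
  -- successor. At the root this gives `L`, in agreement with the sentinel.
  have hP : IsParent (fun k => if k + 1 < L then s₇.nat bUp k else k + 1) L := by
    refine ⟨fun k => ?_, fun k hk => ?_⟩
    · split_ifs with hk
      · obtain ⟨l, h₁, h₂, h₃, h₄⟩ := hpar k hk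
        rwa [h₄]
      · omega
    · obtain ⟨l, h₁, h₂, h₃, h₄⟩ := hpar k hk
      simpa [hk, h₄] using h₂
  refine ⟨_, s₃.nat bOrd, ⟨hP, fun k hk => ?_, S₃.lt, S₃.inj, fun k l hkl hl => ?_⟩,
    ⟨?_, fun k hk => ?_, fun k _ => ?_, ?_, hreal rF (by simp), hreal rX (by simp), w₇⟩,
    ?_, fun a => ?_⟩
  · split_ifs with hk'
    · obtain ⟨l, h₁, h₂, h₃, h₄⟩ := hpar k hk'
      omega
    · omega
  · obtain ⟨l', h₁, h₂, h₃, h₄⟩ := hpar k (by omega)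
    rw [S₃.adj_iff hi hkl hl, if_pos (by omega), h₄, ← h₃]
    exact ⟨fun h => S₃.inj (by simpa) (by simpa) h.symm, fun h => by rw [h]⟩
  · rw [f₇.nat _ (by decide), l₆]
  · split_ifs with hk'
    · rfl
    · rw [hup k hk, if_pos (by omega)]; omega
  · rw [f₇.nat _ (by decide), f₆.nat _ (by decide), f₅.nat _ (by decide), f₄.nat _ (by decide)]
  · rw [f₇.nat _ (by decide)]; exact o₆
  · exact (a₅.frame f₆ (by decide)).frame f₇ (by decide)
  · rw [hreal rY (by simp), y₀]

end setup

/-! ### Comparison with the distance in the graph -/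

section distance

variable {L : ℕ} {G : SimpleGraph (Fin L)} {P ord : ℕ → ℕ}

namespace IsOrder

/-- The node at each position. -/
noncomputable def equiv (h : IsOrder G P ord) : Fin L ≃ Fin L :=
  Equiv.ofBijective (fun i => ⟨ord i, h.lt i i.2⟩) <| Finite.injective_iff_bijective.1
    fun i j e => Fin.ext (h.inj (by simp) (by simp) (by simpa using e))

theorem adj_equiv (h : IsOrder G P ord) (i j : Fin L) :
    G.Adj (h.equiv i) (h.equiv j) ↔ (i < j ∧ P i = j) ∨ (j < i ∧ P j = i) := by
  have key : ∀ i j : Fin L, i < j → (G.Adj (h.equiv i) (h.equiv j) ↔ P i = j) := fun i j hij => by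
    rw [← h.adj i j hij j.2, ← natGraph_adj]; rfl
  rcases lt_trichotomy i j with hij | rfl | hij
  · rw [key i j hij]; simp [hij, hij.not_gt]
  · simp
  · rw [G.adj_comm, key j i hij]; simp [hij, hij.not_gt]

/-- Every edge joins a node to its parent, so each step of a walk changes the recursive distance by
at most one. -/
theorem dist_le_length (h : IsOrder G P ord) {a b : Fin L} (p : G.Walk a b) :
    dist P L (h.equiv.symm a) (h.equiv.symm b) ≤ p.length := by
  induction p with
  | nil => rw [dist_self]; exact Nat.zero_le _
  | @cons a b c hab p ih =>
    rw [SimpleGraph.Walk.length_cons]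
    obtain ⟨i, rfl⟩ := h.equiv.surjective a
    obtain ⟨j, rfl⟩ := h.equiv.surjective b
    rw [Equiv.symm_apply_apply] at ih ⊢
    rcases (h.adj_equiv i j).1 hab with ⟨hij, e⟩ | ⟨hij, e⟩
    · have := (dist_parent h.parent (show (i : ℕ) + 1 < L by omega) (h.equiv.symm c).2).1
      rw [e] at this; omega
    · have := (dist_parent h.parent (show (j : ℕ) + 1 < L by omega) (h.equiv.symm c).2).2
      rw [e] at this; omega

/-- Each unfolding of the recursive distance moves one end along an edge of the graph. -/
theorem dist_le_dist (h : IsOrder G P ord) (hG : G.Connected) {i j : ℕ} (hi : i < L) (hj : j < L) :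
    G.dist (h.equiv ⟨i, hi⟩) (h.equiv ⟨j, hj⟩) ≤ dist P L i j := by
  refine pair_induction h.parent (motive := fun i j => ∀ (hi : i < L) (hj : j < L),
    G.dist (h.equiv ⟨i, hi⟩) (h.equiv ⟨j, hj⟩) ≤ dist P L i j) ?_ ?_ ?_ hi hj hi hj
  · intro i _ hi hj
    rw [SimpleGraph.dist_self]; exact Nat.zero_le _
  · intro i j hij _ ih hi hj
    have hPi := h.parent.le i (by omega)
    have h₁ : G.Adj (h.equiv ⟨i, hi⟩) (h.equiv ⟨P i, hPi⟩) :=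
      (h.adj_equiv _ _).2 (.inl ⟨h.parent.lt i, rfl⟩)
    rw [dist_of_lt h.parent hij hj, ← SimpleGraph.dist_eq_one_iff_adj.2 h₁]
    exact hG.dist_triangle.trans (Nat.add_le_add_left (ih hPi hj) _)
  · intro i j hij _ ih hi hj
    have hPj := h.parent.le j (by omega)
    have h₁ : G.Adj (h.equiv ⟨P j, hPj⟩) (h.equiv ⟨j, hj⟩) :=
      (h.adj_equiv _ _).2 (.inr ⟨h.parent.lt j, rfl⟩)
    rw [dist_of_gt h.parent hij hi, ← SimpleGraph.dist_eq_one_iff_adj.2 h₁, add_comm]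
    exact hG.dist_triangle.trans (Nat.add_le_add_right (ih hi hPj) _)

theorem dist_equiv (h : IsOrder G P ord) (hG : G.Connected) (i j : Fin L) :
    G.dist (h.equiv i) (h.equiv j) = dist P L i j := by
  refine le_antisymm (h.dist_le_dist hG i.2 j.2) ?_
  obtain ⟨p, hp⟩ := hG.exists_walk_length_eq_dist (h.equiv i) (h.equiv j)
  rw [← hp]
  simpa using h.dist_le_length p

theorem sum_eq_mulVec (h : IsOrder G P ord) (hG : G.Connected) (E : List (Fin L × Fin L))
    (f : ℝ → ℝ) (x : Fin L → ℝ) (i : Fin L) :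
    ∑ j ∈ Finset.range L, (GraphMask.input E f x).real rF (dist P L i j) *
      (GraphMask.input E f x).real rX (ord j) = ((GraphMask.mask G f).mulVec x) (h.equiv i) := by
  rw [Matrix.mulVec, dotProduct, ← Equiv.sum_comp h.equiv, Finset.sum_range]
  refine Finset.sum_congr rfl fun j _ => ?_
  -- A shortest path visits no node twice, so its length is below `L` and the value of `f` there is
  -- part of the input.
  have hlt : dist P L i j < L := by
    rw [← h.dist_equiv hG]
    obtain ⟨p, hp, hp'⟩ := hG.exists_path_of_dist (h.equiv i) (h.equiv j)
    rw [← hp']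
    simpa using hp.length_lt
  have e₁ : (GraphMask.input E f x).real rF (dist P L i j) = f (dist P L i j : ℝ) := if_pos hlt
  have e₂ : (GraphMask.input E f x).real rX (ord j) = x (h.equiv j) := dif_pos (h.lt j j.2)
  rw [e₁, e₂, GraphMask.mask, Matrix.of_apply, h.dist_equiv hG]

end IsOrder

theorem multipliesMaskIn (hL : 1 ≤ L) (hG : G.IsTree) (f : ℝ → ℝ) :
    GraphMask.MultipliesMaskIn multiply G f (totalCost L * multiply.size) := by
  intro E hE x
  have hc : 8 * (L + 1) ≤ interactionCost L := by
    rw [interactionCost, ← mul_assoc]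
    exact Nat.mul_le_mul_right _ (by omega)
  have hW : 8 * (L + 1) ≤ totalCost L := hc.trans (Nat.le_mul_of_pos_left _ (by omega))
  have key : RunsIn (totalCost L) multiply (GraphMask.input E f x) fun s' => ∀ i : Fin L,
      s'.real rY i = ((GraphMask.mask G f).mulVec x) i := by
    refine .seq ((setup_runs hL hG hE f x).mono hW fun _ _ h => h)
      fun s₁ _ ⟨P, ord, h, hs, ha, hy⟩ => ?_
    refine (allRounds_runs hL h.parent h.parent_le h.inj hs ha hy).mono le_rfl fun s' _ h' i => ?_
    obtain ⟨i, rfl⟩ := h.equiv.surjective i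
    rw [← h.sum_eq_mulVec hG.connected E]
    exact h' i i.2
  obtain ⟨t, s', ht, he, hq⟩ := key
  exact ⟨t, s', ht, he, hq⟩

end distance

/-! ### Asymptotics -/

theorem totalCost_isBigO (c : ℕ) : (fun L => ((totalCost L * c : ℕ) : ℝ)) =O[atTop]
    fun L : ℕ => (L : ℝ) * Real.log (L : ℝ) ^ 2 := by
  refine IsBigO.of_bound (32 * 64 * c / Real.log 2 ^ 2) ?_
  filter_upwards [eventually_ge_atTop 2] with L hL
  have h2 : 0 < Real.log 2 := Real.log_pos (by norm_num)
  have h₁ : 1 ≤ Nat.log 2 L := Nat.log_pos (by omega) hL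
  have h₂ : Nat.log 2 (8 * (L + 1)) ≤ Nat.log 2 L + 4 := by
    have e : Nat.log 2 (L * 2 * 2 * 2 * 2) = Nat.log 2 L + 4 := by
      rw [Nat.log_mul_base, Nat.log_mul_base, Nat.log_mul_base, Nat.log_mul_base] <;> omega
    rw [← e]
    exact Nat.log_mono_right (by omega)
  -- As the logarithm is at least `1`, both logarithmic factors are at most eight times it, and `16
  -- * (L + 1)` is at most `32 * L`.
  have h₃ : totalCost L ≤ 32 * 64 * (L * Nat.log 2 L ^ 2) := by
    calc totalCost L ≤ (8 * Nat.log 2 L) * ((8 * Nat.log 2 L) * (32 * L)) :=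
          Nat.mul_le_mul (by omega) (Nat.mul_le_mul (by omega) (by omega))
      _ = _ := by ring
  have h₄ : (Nat.log 2 L : ℝ) ≤ Real.log L / Real.log 2 := Real.natLog_le_logb L 2
  have h₅ : 0 ≤ Real.log L := Real.log_natCast_nonneg L
  rw [Real.norm_of_nonneg (by positivity), Real.norm_of_nonneg (by positivity)]
  calc ((totalCost L * c : ℕ) : ℝ) ≤ ((32 * 64 * (L * Nat.log 2 L ^ 2) * c : ℕ) : ℝ) := by
        exact_mod_cast Nat.mul_le_mul_right c h₃
    _ = 32 * 64 * c * (L * (Nat.log 2 L : ℝ) ^ 2) := by push_cast; ring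
    _ ≤ 32 * 64 * c * (L * (Real.log L / Real.log 2) ^ 2) := by gcongr
    _ = _ := by rw [div_pow]; ring

theorem supportsMulIn : GraphMask.SupportsMulIn GraphMask.treePairs
    fun L => totalCost L * multiply.size := by
  refine ⟨multiply, fun L G f hG => multipliesMaskIn ?_ hG f⟩
  -- A tree has a node, which excludes `L = 0`.
  obtain ⟨i⟩ := SimpleGraph.IsTree.connected hG |>.nonempty
  exact i.pos

theorem mul_log_sq_isLittleO : (fun L : ℕ => (L : ℝ) * Real.log (L : ℝ) ^ 2) =o[atTop]
    fun L : ℕ => (L : ℝ) ^ 2 := by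
  simp only [sq (Nat.cast _ : ℝ)]
  exact (isBigO_refl _ _).mul_isLittleO
    (Real.isLittleO_pow_log_id_atTop.comp_tendsto tendsto_natCast_atTop_atTop)

end RealRAM

theorem mainTheorem7 :
    (∃ T : ℕ → ℕ, GraphMask.SupportsMulIn GraphMask.treePairs T ∧
      (fun L => (T L : ℝ)) =O[atTop] fun L : ℕ => (L : ℝ) * Real.log (L : ℝ) ^ 2) ∧
    GraphMask.Tractable GraphMask.treePairs :=
  ⟨⟨_, RealRAM.supportsMulIn, RealRAM.totalCost_isBigO _⟩, _, RealRAM.supportsMulIn,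
    (RealRAM.totalCost_isBigO _).trans_isLittleO RealRAM.mul_log_sq_isLittleO⟩
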